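/- Let $d$ be a dimension, $T>0$, $\mathbb T^d=\mathbb R^d/\mathbb Z^d$ and $\Omega=(0,T)\times\mathbb T^d$. For $0\le s\le 1$ let $B_3^{s,\infty}(\Omega)$ be the space of all $w\in L^3(\Omega)$ with $\sup_{\xi\neq 0}|\xi|^{-s}\|w(\cdot+\xi)-w\|_{L^3(\Omega\cap(\Omega-\xi))}<\infty$. Let $\mu,\nu$ be real constants and put $$\mathbb S(\nabla u)=\mu\Big(\nabla u+(\nabla u)^T-\tfrac23(\operatorname{div}u)\,\mathbb I\Big)+\nu(\operatorname{div}u)\,\mathbb I .$$ Let $0\le\underline\rho\le\overline\rho$ be constants, let $p$ be continuous on $[\underline\rho,\overline\rho]$, and let $$P(r)=r\int_1^r\frac{p(s)}{s^2}\,ds\quad(r>0),\qquad P(0)=\lim_{r\to0^+}P(r)=-p(0),$$ be the pressure potential (if $1\notin[\underline\rho,\overline\rho]$, assume that $p$ is also defined between $1$ and $[\underline\rho,\overline\rho]$ so that $s\mapsto p(s)/s^2$ is integrable between $1$ and $r$ for every $r\in[\underline\rho,\overline\rho]$ with $r>0$). Let $\rho:\Omega\to\mathbb R$ and $u:\Omega\to\mathbb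 R^d$ satisfy $$u\in B_3^{\alpha,\infty}(\Omega),\quad u\in L^2(0,T;H^1(\mathbb T^d)),\quad \rho,\ \rho u\in B_3^{\beta,\infty}(\Omega),\quad \underline\rho\le\rho\le\overline\rho\ \text{ a.e. in }\Omega,$$ for some $0\le\alpha,\beta\le1$ with $$\beta>\max\Big\{1-2\alpha,\ \frac{1-\alpha}{2}\Big\}.$$ (i) (Constant viscosity.) If $(\rho,u)$ solves, in the sense of distributions on $\Omega$, $$\partial_t(\rho u)+\operatorname{div}(\rho u\otimes u)+\nabla p(\rho)=\operatorname{div}\mathbb S(\nabla u),\qquad \partial_t\rho+\operatorname{div}(\rho u)=0,$$ then, in the sense of distributions on $\Omega$, $$\partial_t\Big(\tfrac12\rho|u|^2+P(\rho)\Big)+\mathbb S(\nabla u):\nabla u+\operatorname{div}\Big[\Big(\tfrac12\rho|u|^2+p(\rho)+P(\rho)\Big)u-\mathbb S(\nabla u)u\Big]=0 .$$ (ii) (Degenerate viscosity.) If $(\rho,u)$ solves, in the sense of distributions on $\Omega$, $$\partial_t(\rho u)+\operatorname{div}(\rho u\otimes u)+\nabla p(\rho)=\operatorname{div}(\rho\,\mathbb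 S(\nabla u)),\qquad \partial_t\rho+\operatorname{div}(\rho u)=0,$$ then, in the sense of distributions on $\Omega$, $$\partial_t\Big(\tfrac12\rho|u|^2+P(\rho)\Big)+\rho\,\mathbb S(\nabla u):\nabla u+\operatorname{div}\Big[\Big(\tfrac12\rho|u|^2+p(\rho)+P(\rho)\Big)u-\rho\,\mathbb S(\nabla u)u\Big]=0 .$$ -/

import Mathlib

open Set Filter MeasureTheory
open scoped ENNReal NNReal ContDiff

noncomputable section

/-- Points of `ℝ^d`, with the Euclidean norm. -/
abbrev Space (d : ℕ) : Type := EuclideanSpace ℝ (Fin d)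

/-- Points `(t, x)` of `ℝ × ℝ^d`. -/
abbrev SpaceTime (d : ℕ) : Type := ℝ × Space d

/-- The integer vector `k ∈ ℤ^d`, as a point of `ℝ^d`. -/
def intVec {d : ℕ} (k : Fin d → ℤ) : Space d := WithLp.toLp 2 (fun i => (k i : ℝ))

/-- The fundamental cell `[0,1)^d` of the torus `𝕋^d = ℝ^d / ℤ^d`. -/
def torusCell (d : ℕ) : Set (Space d) := {x | ∀ i, x i ∈ Ico (0 : ℝ) 1}

/-- `f` is a function on `𝕋^d`, that is, a `ℤ^d`-periodic function on `ℝ^d`. -/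
def IsTorusPeriodic {d : ℕ} {F : Type*} (f : Space d → F) : Prop :=
  ∀ (k : Fin d → ℤ) (x : Space d), f (x + intVec k) = f x

/-- `f` is a function of `t` and of `x ∈ 𝕋^d`. -/
def IsSpacePeriodic {d : ℕ} {F : Type*} (f : SpaceTime d → F) : Prop :=
  ∀ t : ℝ, IsTorusPeriodic (fun x => f (t, x))

/-- Lebesgue measure on `(0,T) × 𝕋^d`, the torus being represented by its fundamental cell. -/
def slabMeasure (d : ℕ) (T : ℝ) : Measure (SpaceTime d) :=
  volume.restrict (Ioo 0 T ×ˢ torusCell d)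

/-- The Besov space `B_q^{s,∞}((0,T) × 𝕋^d)`: `f ∈ L^q`, and
`‖f(· + ξ) - f‖_{L^q(Ω ∩ (Ω - ξ))} ≤ C |ξ|^s` for all shifts `ξ = (τ, h)`, where
`Ω = (0,T) × 𝕋^d`; this is the finiteness of the Besov norm. Only the time shift leaves `Ω`. -/
structure MemBesov {d : ℕ} {F : Type*} [NormedAddCommGroup F] (q : ℝ≥0∞) (s T : ℝ)
    (f : SpaceTime d → F) : Prop where
  memLp : MemLp f q (slabMeasure d T)
  shift_bound : ∃ C : ℝ≥0, ∀ (τ : ℝ) (h : Space d),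
    eLpNorm (fun z : SpaceTime d => f (z.1 + τ, z.2 + h) - f z) q
        (volume.restrict {z | z.1 ∈ Ioo 0 T ∧ z.1 + τ ∈ Ioo 0 T ∧ z.2 ∈ torusCell d})
      ≤ C * ENNReal.ofReal (Real.sqrt (τ ^ 2 + ‖h‖ ^ 2) ^ s)

/-- `A` is the weak gradient on `𝕋^d` of the vector field `v`: `A i j = ∂_j v_i`. -/
def HasWeakGradient {d : ℕ} (v : Space d → Space d)
    (A : Space d → Matrix (Fin d) (Fin d) ℝ) : Prop :=
  ∀ ψ : Space d → ℝ, ContDiff ℝ ∞ ψ → IsTorusPeriodic ψ → ∀ i j : Fin d,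
    ∫ x in torusCell d, v x i * fderiv ℝ ψ x (EuclideanSpace.single j 1)
      = - ∫ x in torusCell d, A x i j * ψ x

/-- `u ∈ L²(0,T; H¹(𝕋^d))` with spatial weak gradient `∇u = G`, `G i j = ∂_j u_i`. -/
structure MemL2H1 {d : ℕ} (T : ℝ) (u : SpaceTime d → Space d)
    (G : SpaceTime d → Matrix (Fin d) (Fin d) ℝ) : Prop where
  memLp : MemLp u 2 (slabMeasure d T)
  periodic : IsSpacePeriodic G
  grad_memLp : ∀ i j, MemLp (fun z => G z i j) 2 (slabMeasure d T)
  weakGradient : ∀ᵐ t ∂(volume.restrict (Ioo 0 T)),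
    HasWeakGradient (fun x => u (t, x)) (fun x => G (t, x))

/-- Test functions `φ ∈ C_c^∞((0,T) × 𝕋^d)`. -/
structure IsTestFunction {d : ℕ} (T : ℝ) (φ : SpaceTime d → ℝ) : Prop where
  smooth : ContDiff ℝ ∞ φ
  periodic : IsSpacePeriodic φ
  support : ∃ a b : ℝ, 0 < a ∧ b < T ∧ ∀ t x, t ∉ Icc a b → φ (t, x) = 0

/-- Local integrability on `(0,T) × 𝕋^d`. -/
def LocIntegrable {d : ℕ} {F : Type*} [NormedAddCommGroup F] (T : ℝ)
    (f : SpaceTime d → F) : Prop :=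
  ∀ a b : ℝ, 0 < a → b < T → IntegrableOn f (Icc a b ×ˢ torusCell d) volume

/-- `∂_t A + div F + R = 0` in the sense of distributions on `(0,T) × 𝕋^d`. In the integral,
`fderiv ℝ φ z (1, 0) = ∂_t φ` and `fderiv ℝ φ z (0, F z) = F · ∇φ`. -/
structure DistribBalance {d : ℕ} (T : ℝ) (A : SpaceTime d → ℝ) (F : SpaceTime d → Space d)
    (R : SpaceTime d → ℝ) : Prop where
  density : LocIntegrable T A
  flux : LocIntegrable T F
  source : LocIntegrable T R
  balance : ∀ φ : SpaceTime d → ℝ, IsTestFunction T φ →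
    ∫ z, (A z * fderiv ℝ φ z (1, 0) + fderiv ℝ φ z (0, F z) - R z * φ z) ∂(slabMeasure d T) = 0

/-- The viscous stress `𝕊(A) = μ (A + Aᵀ - (2/3) (tr A) I) + ν (tr A) I`; for `A = ∇u` the trace
is `div u`. -/
def viscousStress {d : ℕ} (μ ν : ℝ) (A : Matrix (Fin d) (Fin d) ℝ) :
    Matrix (Fin d) (Fin d) ℝ :=
  μ • (A + A.transpose - ((2 / 3 : ℝ) * A.trace) • (1 : Matrix (Fin d) (Fin d) ℝ))
    + (ν * A.trace) • (1 : Matrix (Fin d) (Fin d) ℝ)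

/-- Distributional solutions on `(0,T) × 𝕋^d` of
`∂_t (ρ u) + div (ρ u ⊗ u) + ∇ p(ρ) = div σ`, `∂_t ρ + div (ρ u) = 0`, with stress field `σ`.
The `i`-th momentum equation has the flux `(ρ u_i u_j + p(ρ) δ_ij - σ_ij)_j`. -/
structure IsDistribSolution {d : ℕ} (T : ℝ) (p : ℝ → ℝ) (ρ : SpaceTime d → ℝ)
    (u : SpaceTime d → Space d) (σ : SpaceTime d → Matrix (Fin d) (Fin d) ℝ) : Prop where
  momentum : ∀ i : Fin d, DistribBalance T (fun z => ρ z * u z i)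
    (fun z => (ρ z * u z i) • u z + p (ρ z) • EuclideanSpace.single i 1
      - WithLp.toLp 2 (fun j => σ z i j)) (fun _ => 0)
  continuity : DistribBalance T ρ (fun z => ρ z • u z) (fun _ => 0)

/-- The pressure potential `P(r) = r ∫_1^r p(s)/s² ds`; at `r = 0` it has the value
`-p(0)`, which is its limit as `r → 0+` for `p` continuous at `0`. -/
def pressurePotential (p : ℝ → ℝ) (r : ℝ) : ℝ :=
  if r = 0 then - p 0 else r * ∫ s in (1 : ℝ)..r, p s / s ^ 2

/-- The local energy equality
`∂_t (½ρ|u|² + P(ρ)) + σ : ∇u + div [(½ρ|u|² + p(ρ) + P(ρ)) u - σ u] = 0`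
in the sense of distributions on `(0,T) × 𝕋^d`, with `G = ∇u`. -/
def LocalEnergyEquality {d : ℕ} (T : ℝ) (p : ℝ → ℝ) (ρ : SpaceTime d → ℝ)
    (u : SpaceTime d → Space d) (G σ : SpaceTime d → Matrix (Fin d) (Fin d) ℝ) : Prop :=
  DistribBalance T
    (fun z => 1 / 2 * ρ z * ‖u z‖ ^ 2 + pressurePotential p (ρ z))
    (fun z => (1 / 2 * ρ z * ‖u z‖ ^ 2 + p (ρ z) + pressurePotential p (ρ z)) • u z
      - WithLp.toLp 2 (fun i => ∑ j, σ z i j * u z j))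
    (fun z => ∑ i, ∑ j, σ z i j * G z i j)

end

/-! Formally the energy equality comes from testing the momentum equation with `φ u`, the continuity
equation with `φ |u|²/2`, and the continuity equation again with `φ P'(ρ)`. The fields are too rough
for this, so the equations are mollified in space-time at scale `ε`. The mollified fields are
smooth, but mollification does not commute with products: the momentum flux becomes `(m u)^ε`
instead of `m^ε u^ε`, where `m = (ρ, ρ u)` is the space-time mass flux, and the continuity equation
contains `(ρ u)^ε` instead of `ρ^ε u^ε`.

These commutators are controlled as by Constantin, E and Titi. A commutator of fields of Besov
orders `s₁` and `s₂` is `O(ε^(s₁+s₂))` in `L^{3/2}` (`eLpNorm_convCommutator_le`), while the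
gradient of a mollified field of order `s₃` is `O(ε^(s₃-1))` in `L³` (`exists_eLpNorm_pd_comp_le`).
Their product is small in `L¹` once `s₁ + s₂ + s₃ > 1` (`lpTendsto_convCommutator_mul`). The kinetic
balance pairs orders `β, α` with `∂u^ε` and needs `2α + β > 1`; the renormalized continuity equation
pairs `β, α` with `∂h'(ρ^ε)` and needs `α + 2β > 1`. Together these are the assumption on `β`. All
other terms converge by Hölder's inequality, the viscous ones as products of two `L²` factors.

Since `p` is only continuous and vacuum is allowed, `P'` is too irregular to enter a test function.
The continuity equation is therefore first renormalized with smooth `h`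
(`isWindowNull_renormalized`), and then `h → P` and `r h' - h → p` uniformly on the range of `ρ`
(`exists_potential_approx`). The kinetic balance (`isWindowNull_kinetic`) contains `p(ρ) div u` and
the potential balance contains its negative, so the sum is the claim.

Both viscosities are instances of one statement for a symmetric square-integrable stress
(`localEnergyEquality_of_isDistribSolution`). -/

noncomputable section

/-! ### Functions on `ℝ × 𝕋^d` -/

instance (d : ℕ) : (volume : Measure (SpaceTime d)).IsAddHaarMeasure :=
  inferInstanceAs ((volume : Measure ℝ).prod (volume : Measure (Space d))).IsAddHaarMeasure

/-- The lattice `{0} × ℤ^d` of periods. -/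
def periodLattice (d : ℕ) : AddSubgroup (SpaceTime d) where
  carrier := range fun k : Fin d → ℤ => ((0 : ℝ), intVec k)
  zero_mem' := ⟨0, by ext <;> simp [intVec]⟩
  add_mem' := by
    rintro _ _ ⟨k, rfl⟩ ⟨l, rfl⟩
    exact ⟨k + l, by ext <;> simp [intVec]⟩
  neg_mem' := by
    rintro _ ⟨k, rfl⟩
    exact ⟨-k, by ext <;> simp [intVec]⟩

instance (d : ℕ) : Countable (periodLattice d) :=
  (countable_range fun k : Fin d → ℤ => ((0 : ℝ), intVec k)).to_subtype

/-- The strip `ℝ × (c + [0,1)^d)`. -/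
def shiftStrip {d : ℕ} (c : Space d) : Set (SpaceTime d) := {z | z.2 - c ∈ torusCell d}

theorem measurableSet_torusCell (d : ℕ) : MeasurableSet (torusCell d) := by
  have : torusCell d = ⋂ i, (fun x : Space d => x i) ⁻¹' Ico (0 : ℝ) 1 := by
    ext x; simp [torusCell]
  rw [this]
  exact MeasurableSet.iInter fun i => (by fun_prop : Measurable fun x : Space d => x i)
    measurableSet_Ico

theorem measurableSet_shiftStrip {d : ℕ} (c : Space d) : MeasurableSet (shiftStrip c) :=
  (by fun_prop : Measurable fun z : SpaceTime d => z.2 - c) (measurableSet_torusCell d)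

/-- All translates of the cell are fundamental domains for the same lattice. Integrals,
measurability and null sets of periodic functions can therefore be transferred from one cell to
another. -/
theorem isAddFundamentalDomain_shiftStrip {d : ℕ} (c : Space d) :
    IsAddFundamentalDomain (periodLattice d) (shiftStrip c) (volume : Measure (SpaceTime d)) := by
  refine IsAddFundamentalDomain.mk' (measurableSet_shiftStrip c).nullMeasurableSet fun x => ?_
  refine ⟨⟨(0, intVec fun i => -⌊x.2 i - c i⌋), ⟨_, rfl⟩⟩, ?_, ?_⟩
  · intro i
    have h1 := Int.floor_le (x.2 i - c i)
    have h2 := Int.lt_floor_add_one (x.2 i - c i)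
    simp only [AddSubgroup.mk_vadd, vadd_eq_add, Prod.snd_add, intVec,
      PiLp.sub_apply, PiLp.add_apply, Int.cast_neg]
    constructor <;> linarith
  · rintro ⟨_, k, rfl⟩ hk
    have : k = fun i => -⌊x.2 i - c i⌋ := by
      funext i
      have := hk i
      simp only [AddSubgroup.mk_vadd, vadd_eq_add, Prod.snd_add, intVec,
        PiLp.sub_apply, PiLp.add_apply] at this
      rw [eq_comm, neg_eq_iff_eq_neg, Int.floor_eq_iff]
      push_cast
      constructor <;> linarith [this.1, this.2]
    subst this
    rfl

/-- Lebesgue measure on `ℝ × 𝕋^d`. -/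
def stripMeasure (d : ℕ) : Measure (SpaceTime d) := volume.restrict (shiftStrip 0)

theorem IsSpacePeriodic.vadd_eq {d : ℕ} {F : Type*} {f : SpaceTime d → F}
    (hf : IsSpacePeriodic f) (g : periodLattice d) (z : SpaceTime d) : f (g +ᵥ z) = f z := by
  obtain ⟨_, k, rfl⟩ := g
  refine Eq.trans (congrArg f ?_) (hf z.1 k z.2)
  change ((0 : ℝ), intVec k) + z = (z.1, z.2 + intVec k)
  ext <;> simp [add_comm]

theorem IsSpacePeriodic.comp_add {d : ℕ} {F : Type*} {f : SpaceTime d → F}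
    (hf : IsSpacePeriodic f) (w : SpaceTime d) : IsSpacePeriodic fun z => f (z + w) := by
  intro t k x
  refine Eq.trans (congrArg f ?_) (hf (t + w.1) k (x + w.2))
  change (t + w.1, x + intVec k + w.2) = (t + w.1, x + w.2 + intVec k)
  rw [add_right_comm]

theorem IsSpacePeriodic.comp_sub {d : ℕ} {F : Type*} {f : SpaceTime d → F}
    (hf : IsSpacePeriodic f) (w : SpaceTime d) : IsSpacePeriodic fun z => f (z - w) := by
  simpa only [sub_eq_add_neg] using hf.comp_add (-w)

theorem IsSpacePeriodic.map {d : ℕ} {F F' : Type*} {f : SpaceTime d → F}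
    (hf : IsSpacePeriodic f) (g : F → F') : IsSpacePeriodic fun z => g (f z) :=
  fun t k x => congrArg g (hf t k x)

theorem IsSpacePeriodic.map₂ {d : ℕ} {F F' F'' : Type*} {f : SpaceTime d → F}
    {f' : SpaceTime d → F'} (hf : IsSpacePeriodic f) (hf' : IsSpacePeriodic f')
    (g : F → F' → F'') : IsSpacePeriodic fun z => g (f z) (f' z) :=
  fun t k x => congrArg₂ g (hf t k x) (hf' t k x)

theorem measurePreserving_add_strip {d : ℕ} (w : SpaceTime d) :
    MeasurePreserving (fun z : SpaceTime d => z + w) (stripMeasure d)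
      (volume.restrict (shiftStrip w.2)) := by
  have h := (measurePreserving_add_right (volume : Measure (SpaceTime d)) w).restrict_preimage
    (measurableSet_shiftStrip w.2)
  have e : (fun z : SpaceTime d => z + w) ⁻¹' shiftStrip w.2 = shiftStrip 0 := by
    ext z; simp [shiftStrip]
  rwa [e] at h

/-- A translation carries the strip to another fundamental domain, on which a periodic function has
the same integral. The time axis is all of `ℝ`, so time shifts cause no loss. -/
theorem IsSpacePeriodic.lintegral_comp_add {d : ℕ} {f : SpaceTime d → ℝ≥0∞}
    (hf : IsSpacePeriodic f) (w : SpaceTime d) :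
    ∫⁻ z, f (z + w) ∂(stripMeasure d) = ∫⁻ z, f z ∂(stripMeasure d) := by
  rw [(measurePreserving_add_strip w).lintegral_comp_emb (measurableEmbedding_addRight w)]
  exact (isAddFundamentalDomain_shiftStrip _).setLIntegral_eq
    (isAddFundamentalDomain_shiftStrip _) f fun g x => hf.vadd_eq g x

theorem IsSpacePeriodic.integral_comp_add {d : ℕ} {f : SpaceTime d → ℝ}
    (hf : IsSpacePeriodic f) (w : SpaceTime d) :
    ∫ z, f (z + w) ∂(stripMeasure d) = ∫ z, f z ∂(stripMeasure d) := by
  rw [(measurePreserving_add_strip w).integral_comp (measurableEmbedding_addRight w)]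
  exact (isAddFundamentalDomain_shiftStrip _).setIntegral_eq
    (isAddFundamentalDomain_shiftStrip _) fun g x => hf.vadd_eq g x

theorem IsSpacePeriodic.aestronglyMeasurable_comp_add {d : ℕ} {f : SpaceTime d → ℝ}
    (hf : IsSpacePeriodic f) (hm : AEStronglyMeasurable f (stripMeasure d)) (w : SpaceTime d) :
    AEStronglyMeasurable (fun z => f (z + w)) (stripMeasure d) :=
  (((isAddFundamentalDomain_shiftStrip _).aestronglyMeasurable_on_iff
    (isAddFundamentalDomain_shiftStrip w.2) fun g x => hf.vadd_eq g x).1 hm).comp_measurePreserving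
    (measurePreserving_add_strip w)

theorem IsSpacePeriodic.eLpNorm_comp_add {d : ℕ} {f : SpaceTime d → ℝ} {p : ℝ≥0∞}
    (hp0 : p ≠ 0) (hp : p ≠ ⊤) (hf : IsSpacePeriodic f) (w : SpaceTime d) :
    eLpNorm (fun z => f (z + w)) p (stripMeasure d) = eLpNorm f p (stripMeasure d) := by
  rw [eLpNorm_eq_lintegral_rpow_enorm_toReal hp0 hp, eLpNorm_eq_lintegral_rpow_enorm_toReal hp0 hp,
    (hf.map fun r => ‖r‖ₑ ^ p.toReal).lintegral_comp_add w]

theorem IsSpacePeriodic.memLp_comp_add {d : ℕ} {f : SpaceTime d → ℝ} {p : ℝ≥0∞}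
    (hp0 : p ≠ 0) (hp : p ≠ ⊤) (hf : IsSpacePeriodic f) (hm : MemLp f p (stripMeasure d))
    (w : SpaceTime d) : MemLp (fun z => f (z + w)) p (stripMeasure d) :=
  ⟨hf.aestronglyMeasurable_comp_add hm.1 w, by rw [hf.eLpNorm_comp_add hp0 hp]; exact hm.2⟩

theorem IsSpacePeriodic.integrable_comp_add {d : ℕ} {f : SpaceTime d → ℝ}
    (hf : IsSpacePeriodic f) (hm : Integrable f (stripMeasure d)) (w : SpaceTime d) :
    Integrable (fun z => f (z + w)) (stripMeasure d) :=
  memLp_one_iff_integrable.1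
    (hf.memLp_comp_add one_ne_zero ENNReal.one_ne_top (memLp_one_iff_integrable.2 hm) w)

/-- The half-open cell is not a neighbourhood of its boundary points. Centring a cell at the given
point makes integrability on one cell give local integrability everywhere. -/
theorem shiftStrip_mem_nhds {d : ℕ} (z : SpaceTime d) :
    shiftStrip (z.2 - WithLp.toLp 2 fun _ => (1 / 2 : ℝ)) ∈ nhds z := by
  have : (⋂ i : Fin d, {y : SpaceTime d | y.2 i ∈ Ioo (z.2 i - 1 / 2) (z.2 i + 1 / 2)}) ∈ nhds z :=
    Filter.iInter_mem.2 fun i => (IsOpen.mem_nhds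
      (isOpen_Ioo.preimage (by fun_prop : Continuous fun y : SpaceTime d => y.2 i))
      (by simp))
  refine Filter.mem_of_superset this fun y hy i => ?_
  have := mem_iInter.1 hy i
  simp only [mem_ofPred_eq, mem_Ioo, PiLp.sub_apply, mem_Ico] at this ⊢
  constructor <;> linarith [this.1, this.2]

theorem IsSpacePeriodic.locallyIntegrable {d : ℕ} {f : SpaceTime d → ℝ}
    (hf : IsSpacePeriodic f) (hm : Integrable f (stripMeasure d)) :
    LocallyIntegrable f (volume : Measure (SpaceTime d)) := fun z =>
  ⟨_, shiftStrip_mem_nhds z, ((isAddFundamentalDomain_shiftStrip 0).integrableOn_iff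
    (isAddFundamentalDomain_shiftStrip _) fun g x => hf.vadd_eq g x).1 hm⟩

theorem IsSpacePeriodic.aestronglyMeasurable {d : ℕ} {f : SpaceTime d → ℝ}
    (hf : IsSpacePeriodic f) (hm : AEStronglyMeasurable f (stripMeasure d)) :
    AEStronglyMeasurable f (volume : Measure (SpaceTime d)) := by
  rw [← (isAddFundamentalDomain_shiftStrip (0 : Space d)).sum_restrict,
    aestronglyMeasurable_sum_measure_iff]
  intro g
  have h := (isAddFundamentalDomain_shiftStrip (0 : Space d)).aestronglyMeasurable_on_iff
    ((isAddFundamentalDomain_shiftStrip (0 : Space d)).vadd_of_comm g) fun g x => hf.vadd_eq g x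
  exact h.1 hm

theorem IsSpacePeriodic.memLp_isCompact {d : ℕ} {f : SpaceTime d → ℝ} {p : ℝ≥0∞}
    (hp0 : p ≠ 0) (hp : p ≠ ⊤) (hf : IsSpacePeriodic f) (hm : MemLp f p (stripMeasure d))
    {K : Set (SpaceTime d)} (hK : IsCompact K) : MemLp f p (volume.restrict K) := by
  rw [← integrable_norm_rpow_iff (hf.aestronglyMeasurable hm.1).restrict hp0 hp]
  exact ((hf.map fun r => ‖r‖ ^ p.toReal).locallyIntegrable
    (hm.integrable_norm_rpow hp0 hp)).integrableOn_isCompact hK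

/-- Minkowski's inequality for an integral against a kernel. -/
theorem eLpNorm_kernel_integral_le {Z W : Type*} [MeasurableSpace Z] [MeasurableSpace W]
    {μ : Measure Z} {ν : Measure W} [SFinite μ] [SFinite ν] {p : ℝ≥0∞} (hp1 : 1 ≤ p)
    (hp : p ≠ ⊤) {k : W → ℝ} (hk : Integrable k ν) {F : Z → W → ℝ}
    (hF : AEStronglyMeasurable (Function.uncurry F) (μ.prod ν)) {C : ℝ≥0∞}
    (hC : ∀ w, k w ≠ 0 → eLpNorm (fun z => F z w) p μ ≤ C) :
    eLpNorm (fun z => ∫ w, k w * F z w ∂ν) p μ ≤ (∫⁻ w, ‖k w‖ₑ ∂ν) * C := by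
  have hp0 : p ≠ 0 := (zero_lt_one.trans_le hp1).ne'
  set r := p.toReal with hr
  have hr1 : 1 ≤ r := by
    rw [hr, ← ENNReal.toReal_one]; exact ENNReal.toReal_mono hp hp1
  have hr0 : 0 < r := by linarith
  set A := ∫⁻ w, ‖k w‖ₑ ∂ν with hA
  have hkm : AEMeasurable (fun w => ‖k w‖ₑ) ν := hk.1.enorm
  have hAfin : A ≠ ⊤ := hk.2.ne
  -- Jensen's inequality for the weight `|k|`, of total mass `A`, gives `|∫ k F|^r ≤ A^(r-1) ∫ |F|^r
  -- |k|`; Tonelli's theorem then exchanges the two integrals.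
  set κ := ν.withDensity fun w => ‖k w‖ₑ with hκ
  have hκac : κ ≪ ν := withDensity_absolutelyContinuous _ _
  have hκA : κ univ = A := by rw [hκ, withDensity_apply _ MeasurableSet.univ, setLIntegral_univ]
  have : IsFiniteMeasure κ := ⟨by rw [hκA]; exact hAfin.lt_top⟩
  have hF' : AEStronglyMeasurable (Function.uncurry F) (μ.prod κ) :=
    hF.mono_ac (Measure.AbsolutelyContinuous.rfl.prod hκac)
  have hpt : ∀ᵐ z ∂μ, ‖∫ w, k w * F z w ∂ν‖ₑ ^ r
      ≤ A ^ (r - 1) * ∫⁻ w, ‖F z w‖ₑ ^ r ∂κ := by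
    filter_upwards [hF.prodMk_left] with z hz
    have hz' : AEStronglyMeasurable (fun w => F z w) κ := hz.mono_ac hκac
    have h1 : ‖∫ w, k w * F z w ∂ν‖ₑ ≤ ∫⁻ w, ‖F z w‖ₑ ∂κ := by
      refine (enorm_integral_le_lintegral_enorm _).trans (le_of_eq ?_)
      have hz2 : AEMeasurable (fun w => ‖F z w‖ₑ) ν := AEStronglyMeasurable.enorm hz
      rw [hκ, lintegral_withDensity_eq_lintegral_mul₀ hkm hz2]
      simp [enorm_mul]
    have h2 := eLpNorm'_le_eLpNorm'_mul_rpow_measure_univ (zero_lt_one' ℝ) hr1 hz'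
    simp only [eLpNorm', ENNReal.rpow_one, div_one, hκA] at h2
    calc _ ≤ (∫⁻ w, ‖F z w‖ₑ ∂κ) ^ r := ENNReal.rpow_le_rpow h1 hr0.le
      _ ≤ _ := ENNReal.rpow_le_rpow h2 hr0.le
      _ = _ := by
        rw [ENNReal.mul_rpow_of_nonneg _ _ hr0.le, ← ENNReal.rpow_mul, ← ENNReal.rpow_mul,
          one_div, inv_mul_cancel₀ hr0.ne', ENNReal.rpow_one, mul_comm, sub_mul, one_mul,
          inv_mul_cancel₀ hr0.ne']
  rw [eLpNorm_eq_lintegral_rpow_enorm_toReal hp0 hp, ← hr, one_div,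
    ENNReal.rpow_inv_le_iff hr0]
  calc ∫⁻ z, ‖∫ w, k w * F z w ∂ν‖ₑ ^ r ∂μ
      ≤ ∫⁻ z, A ^ (r - 1) * ∫⁻ w, ‖F z w‖ₑ ^ r ∂κ ∂μ := lintegral_mono_ae hpt
    _ = A ^ (r - 1) * ∫⁻ z, ∫⁻ w, ‖F z w‖ₑ ^ r ∂κ ∂μ :=
        lintegral_const_mul' _ _ (ENNReal.rpow_ne_top_of_nonneg (by linarith) hAfin)
    _ = A ^ (r - 1) * ∫⁻ w, ∫⁻ z, ‖F z w‖ₑ ^ r ∂μ ∂κ := by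
        rw [lintegral_lintegral_swap (hF'.enorm.pow_const r)]
    _ ≤ A ^ (r - 1) * (A * C ^ r) := by
        gcongr
        have hm : AEMeasurable (fun w => ∫⁻ z, ‖F z w‖ₑ ^ r ∂μ) κ :=
          (hF'.enorm.pow_const r).prod_swap.lintegral_prod_right'
        rw [hκ, lintegral_withDensity_eq_lintegral_mul₀' hkm hm, hA, ← lintegral_mul_const'' _ hkm]
        refine lintegral_mono fun w => ?_
        by_cases hw : k w = 0
        · simp [hw]
        · have := hC w hw
          rw [eLpNorm_eq_lintegral_rpow_enorm_toReal hp0 hp, ← hr, one_div,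
            ENNReal.rpow_inv_le_iff hr0] at this
          simpa using mul_le_mul_right this _
    _ = (A * C) ^ r := by
        rw [ENNReal.mul_rpow_of_nonneg _ _ hr0.le, ← mul_assoc]
        congr 1
        nth_rewrite 2 [← ENNReal.rpow_one A]
        rw [← ENNReal.rpow_add_of_nonneg _ _ (by linarith) zero_le_one]
        simp

/-! ### Smoothing kernels -/

/-- `k` is a smooth probability density on the ball of radius `ε`, with gradient of mass `≤ C/ε`. -/
structure IsSmoothingKernel {d : ℕ} (C ε : ℝ) (k : SpaceTime d → ℝ) : Prop where
  contDiff : ContDiff ℝ ∞ k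
  nonneg : ∀ w, 0 ≤ k w
  support : ∀ w, k w ≠ 0 → ‖w‖ ≤ ε
  integral_eq_one : ∫ w, k w = 1
  integral_fderiv_le : ∫ w, ‖fderiv ℝ k w‖ ≤ C / ε

theorem exists_isSmoothingKernel (d : ℕ) : ∃ C : ℝ, 0 ≤ C ∧ ∀ ε > 0, ∃ k : SpaceTime d → ℝ,
    IsSmoothingKernel C ε k := by
  let b : ContDiffBump (0 : SpaceTime d) := ⟨1 / 2, 1, by norm_num, by norm_num⟩
  set κ : SpaceTime d → ℝ := b.normed volume with hκ
  have hκd : ContDiff ℝ ∞ κ := b.contDiff_normed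
  set n := Module.finrank ℝ (SpaceTime d) with hn
  -- The constant is the gradient mass of the unit-scale bump. Rescaling by `ε` multiplies the
  -- gradient mass by exactly `1/ε`.
  refine ⟨∫ w, ‖fderiv ℝ κ w‖, by positivity, fun ε hε => ?_⟩
  have hsm : ContDiff ℝ ∞ fun w : SpaceTime d => ε⁻¹ • w := by fun_prop
  refine ⟨fun w => (ε⁻¹) ^ n * κ (ε⁻¹ • w), contDiff_const.mul (hκd.comp hsm), fun w =>
    mul_nonneg (by positivity) (b.nonneg_normed _), fun w hw => ?_, ?_, ?_⟩
  · have h1 : ε⁻¹ • w ∈ Function.support κ := right_ne_zero_of_mul hw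
    rw [hκ, b.support_normed_eq, mem_ball_zero_iff, norm_smul, norm_inv, Real.norm_eq_abs,
      abs_of_pos hε, inv_mul_lt_iff₀ hε] at h1
    exact h1.le.trans (mul_one ε).le
  · rw [integral_const_mul, Measure.integral_comp_inv_smul, b.integral_normed, ← hn, abs_of_pos
      (pow_pos hε n), smul_eq_mul, mul_one, ← mul_pow, inv_mul_cancel₀ hε.ne', one_pow]
  · have hfd : ∀ w, fderiv ℝ (fun w => (ε⁻¹) ^ n * κ (ε⁻¹ • w)) w
        = ((ε⁻¹) ^ n * ε⁻¹) • fderiv ℝ κ (ε⁻¹ • w) := by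
      intro w
      have h1 : HasFDerivAt (fun w => κ (ε⁻¹ • w))
          ((fderiv ℝ κ (ε⁻¹ • w)).comp (ε⁻¹ • ContinuousLinearMap.id ℝ (SpaceTime d))) w :=
        ((hκd.differentiable (by simp)) _).hasFDerivAt.comp w
          ((hasFDerivAt_id w).const_smul ε⁻¹)
      rw [(h1.const_mul _).fderiv]
      ext <;> simp [mul_assoc]
    simp_rw [hfd, norm_smul]
    rw [integral_const_mul, Measure.integral_comp_inv_smul (volume : Measure (SpaceTime d))
      (fun w => ‖fderiv ℝ κ w‖), ← hn, abs_of_pos (pow_pos hε n), smul_eq_mul,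
      Real.norm_of_nonneg (by positivity), mul_comm _ ε⁻¹, mul_assoc, ← mul_assoc (ε⁻¹ ^ n),
      ← mul_pow, inv_mul_cancel₀ hε.ne', one_pow, one_mul, div_eq_inv_mul]

/-- The convolution `∫ k(w) f(z - w) dw`. -/
def kernelConv {d : ℕ} (k f : SpaceTime d → ℝ) (z : SpaceTime d) : ℝ := ∫ w, k w * f (z - w)

theorem kernelConv_eq {d : ℕ} (k f : SpaceTime d → ℝ) :
    kernelConv k f = convolution k f (ContinuousLinearMap.mul ℝ ℝ) volume := rfl

theorem integrable_kernel_mul {d : ℕ} {k f : SpaceTime d → ℝ} (hk : Continuous k)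
    (hkc : HasCompactSupport k) (hf : LocallyIntegrable f) (z : SpaceTime d) :
    Integrable fun w => k w * f (z - w) :=
  (hkc.convolutionExists_left (ContinuousLinearMap.mul ℝ ℝ) hk hf z).integrable

theorem contDiff_kernelConv {d : ℕ} {k f : SpaceTime d → ℝ} (hk : ContDiff ℝ ∞ k)
    (hkc : HasCompactSupport k) (hf : LocallyIntegrable f) : ContDiff ℝ ∞ (kernelConv k f) :=
  hkc.contDiff_convolution_left (ContinuousLinearMap.mul ℝ ℝ) hk hf

theorem fderiv_kernelConv {d : ℕ} {k f : SpaceTime d → ℝ} (hk : ContDiff ℝ ∞ k)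
    (hkc : HasCompactSupport k) (hf : LocallyIntegrable f) (z v : SpaceTime d) :
    fderiv ℝ (kernelConv k f) z v = ∫ w, fderiv ℝ k w v * f (z - w) := by
  have hk1 : ContDiff ℝ 1 k := hk.of_le (by simp)
  have h := hkc.hasFDerivAt_convolution_left (ContinuousLinearMap.mul ℝ ℝ) hk1 hf z
  rw [kernelConv_eq, h.fderiv, convolution, ContinuousLinearMap.integral_apply]
  · simp [ContinuousLinearMap.precompL_apply]
  · exact ((hkc.fderiv ℝ).convolutionExists_left _ (hk1.continuous_fderiv one_ne_zero) hf z).integrable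

/-- The integral is the derivative of the convolution of `k` with the constant `1`, and that
convolution is constant. -/
theorem integral_fderiv_kernel {d : ℕ} {k : SpaceTime d → ℝ} (hk : ContDiff ℝ ∞ k)
    (hkc : HasCompactSupport k) (v : SpaceTime d) : ∫ w, fderiv ℝ k w v = 0 := by
  have h := fderiv_kernelConv hk hkc (locallyIntegrable_const (1 : ℝ)) 0 v
  simp only [mul_one] at h
  rw [← h]
  have : kernelConv k (fun _ => 1) = fun _ => ∫ w, k w := by
    funext z; simp [kernelConv]
  rw [this]
  simp

theorem IsSpacePeriodic.kernelConv {d : ℕ} {f : SpaceTime d → ℝ} (hf : IsSpacePeriodic f)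
    (k : SpaceTime d → ℝ) : IsSpacePeriodic (kernelConv k f) := by
  intro t n x
  simp only [_root_.kernelConv]
  exact integral_congr_ae (Eventually.of_forall fun w => by
    simpa using congrArg (k w * ·) (hf.comp_sub w t n x))

namespace IsSmoothingKernel

variable {d : ℕ} {C ε : ℝ} {k : SpaceTime d → ℝ}

theorem hasCompactSupport (hk : IsSmoothingKernel C ε k) : HasCompactSupport k :=
  HasCompactSupport.intro (isCompact_closedBall 0 ε) fun w hw => by
    by_contra h
    exact hw (mem_closedBall_zero_iff.2 (hk.support w h))

theorem integrable (hk : IsSmoothingKernel C ε k) : Integrable k :=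
  hk.contDiff.continuous.integrable_of_hasCompactSupport hk.hasCompactSupport

theorem lintegral_enorm (hk : IsSmoothingKernel C ε k) : ∫⁻ w, ‖k w‖ₑ = 1 := by
  rw [← ofReal_integral_norm_eq_lintegral_enorm hk.integrable]
  simp only [Real.norm_of_nonneg (hk.nonneg _), hk.integral_eq_one, ENNReal.ofReal_one]

theorem continuous_fderiv (hk : IsSmoothingKernel C ε k) (v : SpaceTime d) :
    Continuous fun w => fderiv ℝ k w v :=
  (hk.contDiff.continuous_fderiv (by simp)).clm_apply continuous_const

theorem hasCompactSupport_fderiv (hk : IsSmoothingKernel C ε k) (v : SpaceTime d) :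
    HasCompactSupport fun w => fderiv ℝ k w v :=
  hk.hasCompactSupport.fderiv_apply ℝ v

theorem integrable_fderiv (hk : IsSmoothingKernel C ε k) (v : SpaceTime d) :
    Integrable fun w => fderiv ℝ k w v :=
  (hk.continuous_fderiv v).integrable_of_hasCompactSupport (hk.hasCompactSupport_fderiv v)

theorem lintegral_enorm_fderiv_le (hk : IsSmoothingKernel C ε k) {v : SpaceTime d}
    (hv : ‖v‖ ≤ 1) : ∫⁻ w, ‖fderiv ℝ k w v‖ₑ ≤ ENNReal.ofReal (C / ε) := by
  rw [← ofReal_integral_norm_eq_lintegral_enorm (hk.integrable_fderiv v)]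
  refine ENNReal.ofReal_le_ofReal ((integral_mono (hk.integrable_fderiv v).norm ?_ fun w => ?_).trans
    hk.integral_fderiv_le)
  · exact ((hk.contDiff.continuous_fderiv (by simp)).integrable_of_hasCompactSupport
      (hk.hasCompactSupport.fderiv ℝ)).norm
  · exact ContinuousLinearMap.unit_le_opNorm _ _ hv

theorem norm_le_of_fderiv_ne_zero (hk : IsSmoothingKernel C ε k) {v w : SpaceTime d}
    (hw : fderiv ℝ k w v ≠ 0) : ‖w‖ ≤ ε := by
  have h1 : w ∈ tsupport k := by
    refine support_fderiv_subset ℝ (f := k) ?_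
    intro h
    exact hw (by rw [h]; rfl)
  have h2 : tsupport k ⊆ Metric.closedBall 0 ε :=
    closure_minimal (fun w hw => mem_closedBall_zero_iff.2 (hk.support w hw))
      Metric.isClosed_closedBall
  exact mem_closedBall_zero_iff.1 (h2 h1)

end IsSmoothingKernel

/-! ### Mollification on a time window -/

/-- Lebesgue measure on `[a,b] × 𝕋^d`. -/
def windowMeasure (d : ℕ) (a b : ℝ) : Measure (SpaceTime d) :=
  volume.restrict (Icc a b ×ˢ torusCell d)

theorem windowMeasure_ac (d : ℕ) (a b : ℝ) :
    windowMeasure d a b ≪ (volume : Measure (SpaceTime d)) :=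
  Measure.absolutelyContinuous_of_le Measure.restrict_le_self

/-- The half-open window is not compact. This supplies a compact set that also absorbs every shift
of length at most one. -/
theorem exists_isCompact_window (d : ℕ) (a b : ℝ) : ∃ K : Set (SpaceTime d), IsCompact K ∧
    ∀ z ∈ Icc a b ×ˢ torusCell d, ∀ w : SpaceTime d, ‖w‖ ≤ 1 → z - w ∈ K := by
  have hb : Bornology.IsBounded (torusCell d) := by
    rw [isBounded_iff_forall_norm_le]
    refine ⟨Real.sqrt (∑ _i : Fin d, 1), fun x hx => ?_⟩
    rw [EuclideanSpace.norm_eq]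
    refine Real.sqrt_le_sqrt (Finset.sum_le_sum fun i _ => ?_)
    rw [Real.norm_of_nonneg (hx i).1]
    exact pow_le_one₀ (hx i).1 (hx i).2.le
  obtain ⟨R, hR⟩ := isBounded_iff_forall_norm_le.1
    ((Metric.isBounded_Icc a b).prod hb)
  refine ⟨Metric.closedBall 0 (R + 1), isCompact_closedBall _ _, fun z hz w hw => ?_⟩
  rw [mem_closedBall_zero_iff]
  exact (norm_sub_le _ _).trans (add_le_add (hR z hz) hw)

instance (d : ℕ) (a b : ℝ) : IsFiniteMeasure (windowMeasure d a b) := by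
  obtain ⟨K, hK, h⟩ := exists_isCompact_window d a b
  refine ⟨?_⟩
  rw [windowMeasure, Measure.restrict_apply_univ]
  exact (measure_mono fun z hz => by simpa using h z hz 0 (by simp)).trans_lt hK.measure_lt_top

/-- `f` is locally in `L^p`. -/
def LocMemLp {d : ℕ} (p : ℝ≥0∞) (f : SpaceTime d → ℝ) : Prop :=
  ∀ K : Set (SpaceTime d), IsCompact K → MemLp f p (volume.restrict K)

theorem LocMemLp.window {d : ℕ} {p : ℝ≥0∞} {f : SpaceTime d → ℝ} (hf : LocMemLp p f) (a b : ℝ) :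
    MemLp f p (windowMeasure d a b) := by
  obtain ⟨K, hK, h⟩ := exists_isCompact_window d a b
  exact (hf K hK).mono_measure
    (Measure.restrict_mono (fun z hz => by simpa using h z hz 0 (by simp)) le_rfl)

theorem LocMemLp.locallyIntegrable {d : ℕ} {p : ℝ≥0∞} (hp : 1 ≤ p) {f : SpaceTime d → ℝ}
    (hf : LocMemLp p f) : LocallyIntegrable f := by
  rw [locallyIntegrable_iff]
  intro K hK
  have : IsFiniteMeasure (volume.restrict K) := ⟨by simpa using hK.measure_lt_top⟩
  exact (hf K hK).integrable hp

/-- Continuity of translations in `L^p`, applied to the truncation of `f` to a compact set. On the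
window, and for shifts of norm at most one, the truncation changes neither `f z` nor `f (z - w)`. -/
theorem tendsto_eLpNorm_translate_sub {d : ℕ} {p : ℝ≥0∞} (hp1 : 1 ≤ p) (hp : p ≠ ⊤)
    {f : SpaceTime d → ℝ} (hf : LocMemLp p f) (a b : ℝ) :
    Tendsto (fun w : SpaceTime d => eLpNorm (fun z => f (z - w) - f z) p (windowMeasure d a b))
      (nhds 0) (nhds 0) := by
  obtain ⟨K, hK, hKm⟩ := exists_isCompact_window d a b
  have : Fact (1 ≤ p) := ⟨hp1⟩
  set g := K.indicator f with hg
  have hgL : MemLp g p := (memLp_indicator_iff_restrict hK.measurableSet).2 (hf K hK)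
  let τ : SpaceTime d → C(SpaceTime d, SpaceTime d) := fun w => ⟨fun z => z - w, by fun_prop⟩
  have hτ : ∀ w, MeasurePreserving (τ w) volume volume := fun w => measurePreserving_sub_right _ w
  have hcont : Continuous τ := ContinuousMap.continuous_of_continuous_uncurry _ (by
    simp only [τ, Function.uncurry_def, ContinuousMap.coe_mk]; fun_prop)
  have h1 := (Tendsto.compMeasurePreservingLp (μ := volume) (ν := volume) (p := p)
    (f := fun _ : SpaceTime d => hgL.toLp g) tendsto_const_nhds (hcont.tendsto 0) hτ (hτ 0) hp)
  have h2 := (tendsto_iff_edist_tendsto_0.1 h1)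
  have hev : ∀ᶠ w : SpaceTime d in nhds 0, ‖w‖ ≤ 1 := by
    filter_upwards [Metric.closedBall_mem_nhds (0 : SpaceTime d) one_pos] with w hw
    simpa using hw
  refine tendsto_of_tendsto_of_tendsto_of_le_of_le' tendsto_const_nhds h2
    (Eventually.of_forall fun _ => zero_le) ?_
  filter_upwards [hev] with w hw
  rw [Lp.edist_def]
  calc eLpNorm (fun z => f (z - w) - f z) p (windowMeasure d a b)
      = eLpNorm (fun z => g (z - w) - g z) p (windowMeasure d a b) := by
        refine eLpNorm_congr_ae ?_
        filter_upwards [ae_restrict_mem₀ (measurableSet_Icc.prod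
          (measurableSet_torusCell d)).nullMeasurableSet] with z hz
        rw [hg, indicator_of_mem (hKm z hz w hw),
          indicator_of_mem (by simpa using hKm z hz 0 (by simp))]
    _ ≤ eLpNorm (fun z => g (z - w) - g z) p volume :=
        eLpNorm_mono_measure _ Measure.restrict_le_self
    _ = _ := by
        refine eLpNorm_congr_ae ?_
        have e1 := Lp.coeFn_compMeasurePreserving (hgL.toLp g) (hτ w)
        have e2 := Lp.coeFn_compMeasurePreserving (hgL.toLp g) (hτ 0)
        have e3 := (hτ w).quasiMeasurePreserving.ae_eq_comp hgL.coeFn_toLp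
        have e4 := (hτ 0).quasiMeasurePreserving.ae_eq_comp hgL.coeFn_toLp
        filter_upwards [e1, e2, e3, e4] with z h1 h2 h3 h4
        rw [Pi.sub_apply, h1, h2, h3, h4]
        simp [τ]

theorem aestronglyMeasurable_translate {d : ℕ} {f : SpaceTime d → ℝ} (hf : AEStronglyMeasurable f)
    {μ : Measure (SpaceTime d)} (hμ : μ ≪ volume) :
    AEStronglyMeasurable (Function.uncurry fun z w => f (z - w))
      (μ.prod (volume : Measure (SpaceTime d))) := by
  have h := hf.comp_quasiMeasurePreserving (quasiMeasurePreserving_sub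
    (volume : Measure (SpaceTime d)) (volume : Measure (SpaceTime d)))
  exact h.mono_ac (hμ.prod Measure.AbsolutelyContinuous.rfl)

theorem aestronglyMeasurable_translate_sub {d : ℕ} {f : SpaceTime d → ℝ}
    (hf : AEStronglyMeasurable f) {μ : Measure (SpaceTime d)} [SFinite μ] (hμ : μ ≪ volume) :
    AEStronglyMeasurable (Function.uncurry fun z w => f (z - w) - f z)
      (μ.prod (volume : Measure (SpaceTime d))) :=
  (aestronglyMeasurable_translate hf hμ).sub (hf.mono_ac hμ).comp_fst

/-- As `k` has integral one, `f^ε - f` is the `k`-average of the differences `f(· - w) - f`, and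
Minkowski's inequality applies. -/
theorem eLpNorm_kernelConv_sub_le {d : ℕ} {C ε : ℝ} {k f : SpaceTime d → ℝ}
    (hk : IsSmoothingKernel C ε k) (hf : LocallyIntegrable f) {p : ℝ≥0∞} (hp1 : 1 ≤ p)
    (hp : p ≠ ⊤) {μ : Measure (SpaceTime d)} [SFinite μ] (hμ : μ ≪ volume) {A : ℝ≥0∞}
    (hA : ∀ w, ‖w‖ ≤ ε → eLpNorm (fun z => f (z - w) - f z) p μ ≤ A) :
    eLpNorm (fun z => kernelConv k f z - f z) p μ ≤ A := by
  have h := eLpNorm_kernel_integral_le hp1 hp hk.integrable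
    (aestronglyMeasurable_translate_sub hf.aestronglyMeasurable hμ) fun w hw => hA w (hk.support w hw)
  rw [hk.lintegral_enorm, one_mul] at h
  convert h using 3 with z
  simp only [mul_sub]
  rw [integral_sub (integrable_kernel_mul hk.contDiff.continuous hk.hasCompactSupport hf z)
    (hk.integrable.mul_const _), integral_mul_const, hk.integral_eq_one, one_mul]
  rfl

/-- As `∂k` has integral zero, `f z` may be subtracted under the integral. The gradient then costs
the factor `C/ε` but still gains the size of the increments of `f`. -/
theorem eLpNorm_fderiv_kernelConv_le {d : ℕ} {C ε : ℝ} {k f : SpaceTime d → ℝ}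
    (hk : IsSmoothingKernel C ε k) (hf : LocallyIntegrable f) {p : ℝ≥0∞} (hp1 : 1 ≤ p)
    (hp : p ≠ ⊤) {μ : Measure (SpaceTime d)} [SFinite μ] (hμ : μ ≪ volume) {A : ℝ≥0∞}
    (hA : ∀ w, ‖w‖ ≤ ε → eLpNorm (fun z => f (z - w) - f z) p μ ≤ A) {v : SpaceTime d}
    (hv : ‖v‖ ≤ 1) :
    eLpNorm (fun z => fderiv ℝ (kernelConv k f) z v) p μ ≤ ENNReal.ofReal (C / ε) * A := by
  have h := eLpNorm_kernel_integral_le hp1 hp (hk.integrable_fderiv v)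
    (aestronglyMeasurable_translate_sub hf.aestronglyMeasurable hμ)
    fun w hw => hA w (hk.norm_le_of_fderiv_ne_zero hw)
  refine le_trans (le_of_eq ?_) (h.trans (mul_le_mul_left (hk.lintegral_enorm_fderiv_le hv) _))
  congr 1
  funext z
  rw [fderiv_kernelConv hk.contDiff hk.hasCompactSupport hf]
  simp only [mul_sub]
  rw [integral_sub (integrable_kernel_mul (hk.continuous_fderiv v) (hk.hasCompactSupport_fderiv v)
    hf z) ((hk.integrable_fderiv v).mul_const _), integral_mul_const,
    integral_fderiv_kernel hk.contDiff hk.hasCompactSupport, zero_mul, sub_zero]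

/-- The commutator `(fg)^ε - f^ε g^ε`. -/
def convCommutator {d : ℕ} (k f g : SpaceTime d → ℝ) (z : SpaceTime d) : ℝ :=
  kernelConv k (fun y => f y * g y) z - kernelConv k f z * kernelConv k g z

/-- The Constantin–E–Titi identity `(fg)^ε - f^ε g^ε = ∫ k(w) δ_w f δ_w g dw - (f^ε - f)(g^ε - g)`,
with `δ_w f = f(· - w) - f`, makes the commutator quadratic in increments. Each of the two terms is
at most `A * B` by Hölder's inequality, hence the factor `2`. -/
theorem eLpNorm_convCommutator_le {d : ℕ} {C ε : ℝ} {k f g : SpaceTime d → ℝ}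
    (hk : IsSmoothingKernel C ε k) (hf : LocallyIntegrable f) (hg : LocallyIntegrable g)
    (hfg : LocallyIntegrable fun y => f y * g y) {p q r : ℝ≥0∞} [ENNReal.HolderTriple p q r]
    (hp1 : 1 ≤ p) (hp : p ≠ ⊤) (hq1 : 1 ≤ q) (hq : q ≠ ⊤) (hr1 : 1 ≤ r) (hr : r ≠ ⊤)
    {μ : Measure (SpaceTime d)} [SFinite μ] (hμ : μ ≪ volume) {A B : ℝ≥0∞}
    (hA : ∀ w, ‖w‖ ≤ ε → eLpNorm (fun z => f (z - w) - f z) p μ ≤ A)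
    (hB : ∀ w, ‖w‖ ≤ ε → eLpNorm (fun z => g (z - w) - g z) q μ ≤ B) :
    eLpNorm (convCommutator k f g) r μ ≤ 2 * (A * B) := by
  have hfm := aestronglyMeasurable_translate_sub hf.aestronglyMeasurable hμ
  have hgm := aestronglyMeasurable_translate_sub hg.aestronglyMeasurable hμ
  have hcf := (contDiff_kernelConv hk.contDiff hk.hasCompactSupport hf).continuous
  have hcg := (contDiff_kernelConv hk.contDiff hk.hasCompactSupport hg).continuous
  have hτ : ∀ {h : SpaceTime d → ℝ}, LocallyIntegrable h → ∀ w,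
      AEStronglyMeasurable (fun z => h (z - w) - h z) μ := fun {h} hh w =>
    ((hh.aestronglyMeasurable.comp_quasiMeasurePreserving
      (measurePreserving_sub_right volume w).quasiMeasurePreserving).sub
      hh.aestronglyMeasurable).mono_ac hμ
  have h1 : eLpNorm (fun z => ∫ w, k w * ((f (z - w) - f z) * (g (z - w) - g z))) r μ
      ≤ A * B := by
    have h := eLpNorm_kernel_integral_le (k := k) (F := fun z w => (f (z - w) - f z) *
      (g (z - w) - g z)) (C := A * B) hr1 hr hk.integrable (hfm.mul hgm) fun w hw =>
        (eLpNorm_smul_le_mul_eLpNorm (p := p) (q := q) (hτ hg w) (hτ hf w)).trans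
          (mul_le_mul' (hA w (hk.support w hw)) (hB w (hk.support w hw)))
    rwa [hk.lintegral_enorm, one_mul] at h
  have h2 : eLpNorm (fun z => (kernelConv k f z - f z) * (kernelConv k g z - g z)) r μ
      ≤ A * B :=
    (eLpNorm_smul_le_mul_eLpNorm (p := p) (q := q)
      (hcg.aestronglyMeasurable.sub (hg.aestronglyMeasurable.mono_ac hμ))
      (hcf.aestronglyMeasurable.sub (hf.aestronglyMeasurable.mono_ac hμ))).trans
      (mul_le_mul' (eLpNorm_kernelConv_sub_le hk hf hp1 hp hμ hA)
        (eLpNorm_kernelConv_sub_le hk hg hq1 hq hμ hB))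
  have hk' := hk.contDiff.continuous
  have hkc := hk.hasCompactSupport
  have hI : ∀ z, ∫ w, k w * ((f (z - w) - f z) * (g (z - w) - g z))
      = kernelConv k (fun y => f y * g y) z - g z * kernelConv k f z - f z * kernelConv k g z
        + f z * g z := by
    intro z
    have i1 := integrable_kernel_mul hk' hkc hfg z
    have i2 := (integrable_kernel_mul hk' hkc hf z).const_mul (g z)
    have i3 := (integrable_kernel_mul hk' hkc hg z).const_mul (f z)
    have i4 := hk.integrable.mul_const (f z * g z)
    have e : ∀ w, k w * ((f (z - w) - f z) * (g (z - w) - g z)) = k w * (f (z - w) * g (z - w))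
        - g z * (k w * f (z - w)) - f z * (k w * g (z - w)) + k w * (f z * g z) := fun w => by ring
    simp only [e]
    have i12 : Integrable fun w => k w * (f (z - w) * g (z - w)) - g z * (k w * f (z - w)) :=
      i1.sub i2
    have i123 : Integrable fun w => k w * (f (z - w) * g (z - w)) - g z * (k w * f (z - w))
        - f z * (k w * g (z - w)) := i12.sub i3
    rw [integral_add i123 i4, integral_sub i12 i3, integral_sub i1 i2,
      integral_const_mul, integral_const_mul, integral_mul_const, hk.integral_eq_one, one_mul]
    rfl
  have hm1 : AEStronglyMeasurable
      (fun z => ∫ w, k w * ((f (z - w) - f z) * (g (z - w) - g z))) μ := by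
    simp only [hI]
    have hcfg := (contDiff_kernelConv hk.contDiff hk.hasCompactSupport hfg).continuous
    have hf' := hf.aestronglyMeasurable.mono_ac hμ
    have hg' := hg.aestronglyMeasurable.mono_ac hμ
    exact ((hcfg.aestronglyMeasurable.sub (hg'.mul hcf.aestronglyMeasurable)).sub
      (hf'.mul hcg.aestronglyMeasurable)).add (hf'.mul hg')
  have e : convCommutator k f g = (fun z => ∫ w, k w * ((f (z - w) - f z) * (g (z - w) - g z)))
      - fun z => (kernelConv k f z - f z) * (kernelConv k g z - g z) := by
    funext z
    rw [Pi.sub_apply, hI]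
    simp only [convCommutator]
    ring
  rw [e, two_mul]
  exact (eLpNorm_sub_le hm1 ((hcf.aestronglyMeasurable.sub (hf.aestronglyMeasurable.mono_ac hμ)).mul
    (hcg.aestronglyMeasurable.sub (hg.aestronglyMeasurable.mono_ac hμ))) hr1).trans
    (add_le_add h1 h2)

theorem tendsto_eLpNorm_kernelConv_sub {d : ℕ} {C : ℝ} {η : ℝ → SpaceTime d → ℝ}
    (hη : ∀ ε > 0, IsSmoothingKernel C ε (η ε)) {p : ℝ≥0∞} (hp1 : 1 ≤ p) (hp : p ≠ ⊤)
    {f : SpaceTime d → ℝ} (hf : LocMemLp p f) (a b : ℝ) :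
    Tendsto (fun ε => eLpNorm (fun z => kernelConv (η ε) f z - f z) p (windowMeasure d a b))
      (nhdsWithin 0 (Ioi 0)) (nhds 0) := by
  rw [ENNReal.tendsto_nhds_zero]
  intro δ hδ
  have h := (ENNReal.tendsto_nhds_zero.1 (tendsto_eLpNorm_translate_sub hp1 hp hf a b)) δ hδ
  obtain ⟨r, hr, hball⟩ := Metric.eventually_nhds_iff.1 h
  filter_upwards [Ioo_mem_nhdsGT hr] with ε hε
  exact eLpNorm_kernelConv_sub_le (hη ε hε.1) (hf.locallyIntegrable hp1) hp1 hp
    (windowMeasure_ac d a b) fun w hw => hball (by simpa using hw.trans_lt hε.2)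

/-! ### Weak balance laws in divergence form -/

/-- The coordinate directions of space-time: `none` is time, `some j` the `j`-th space direction. -/
def dirVec {d : ℕ} : Option (Fin d) → SpaceTime d
  | none => (1, 0)
  | some j => (0, EuclideanSpace.single j 1)

theorem norm_dirVec_le {d : ℕ} (o : Option (Fin d)) : ‖dirVec o‖ ≤ 1 := by
  cases o <;> simp [dirVec, Prod.norm_def]

/-- The partial derivative in the direction `o`. -/
def pd {d : ℕ} (o : Option (Fin d)) (f : SpaceTime d → ℝ) (z : SpaceTime d) : ℝ :=
  fderiv ℝ f z (dirVec o)

/-- Smooth functions on `ℝ × 𝕋^d`. -/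
structure IsSmoothPeriodic {d : ℕ} (f : SpaceTime d → ℝ) : Prop where
  smooth : ContDiff ℝ ∞ f
  periodic : IsSpacePeriodic f

/-- Continuous functions on `ℝ × 𝕋^d` vanishing for times outside `[a,b]`. -/
structure IsWindowed {d : ℕ} (a b : ℝ) (f : SpaceTime d → ℝ) : Prop where
  continuous : Continuous f
  periodic : IsSpacePeriodic f
  support : ∀ t x, t ∉ Icc a b → f (t, x) = 0

/-- Smooth functions on `ℝ × 𝕋^d` vanishing for times outside `[a,b]`. -/
structure IsTestIn {d : ℕ} (a b : ℝ) (f : SpaceTime d → ℝ) : Prop extends IsSmoothPeriodic f where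
  support : ∀ t x, t ∉ Icc a b → f (t, x) = 0

variable {d : ℕ} {a b : ℝ} {f g φ : SpaceTime d → ℝ}

namespace IsSmoothPeriodic

theorem differentiable (hf : IsSmoothPeriodic f) : Differentiable ℝ f :=
  hf.smooth.differentiable (by simp)

theorem continuous (hf : IsSmoothPeriodic f) : Continuous f := hf.smooth.continuous

theorem continuous_pd (hf : IsSmoothPeriodic f) (o : Option (Fin d)) : Continuous (pd o f) :=
  (hf.smooth.continuous_fderiv (by simp)).clm_apply continuous_const

theorem periodic_pd (hf : IsSmoothPeriodic f) (o : Option (Fin d)) : IsSpacePeriodic (pd o f) := by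
  intro t k x
  have h : (fun z : SpaceTime d => f (z + (0, intVec k))) = f := by
    funext z
    refine Eq.trans (congrArg f ?_) (hf.periodic z.1 k z.2)
    ext <;> simp
  have h2 := fderiv_comp_add_right (𝕜 := ℝ) (f := f) (x := (t, x)) ((0 : ℝ), intVec k)
  rw [h] at h2
  simp only [pd, h2, Prod.mk_add_mk, add_zero]

theorem mul (hf : IsSmoothPeriodic f) (hg : IsSmoothPeriodic g) :
    IsSmoothPeriodic fun z => f z * g z :=
  ⟨hf.smooth.mul hg.smooth, hf.periodic.map₂ hg.periodic _⟩

theorem sum {ι : Type*} (s : Finset ι) {F : ι → SpaceTime d → ℝ}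
    (hF : ∀ i, IsSmoothPeriodic (F i)) : IsSmoothPeriodic fun z => ∑ i ∈ s, F i z :=
  ⟨ContDiff.sum fun i _ => (hF i).smooth,
    fun t k x => Finset.sum_congr rfl fun i _ => (hF i).periodic t k x⟩

theorem comp (hf : IsSmoothPeriodic f) {h : ℝ → ℝ} (hh : ContDiff ℝ ∞ h) :
    IsSmoothPeriodic fun z => h (f z) :=
  ⟨hh.comp hf.smooth, hf.periodic.map h⟩

end IsSmoothPeriodic

theorem pd_mul (hf : IsSmoothPeriodic f) (hg : IsSmoothPeriodic g) (o : Option (Fin d))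
    (z : SpaceTime d) : pd o (fun y => f y * g y) z = f z * pd o g z + g z * pd o f z := by
  simp only [pd]
  rw [fderiv_fun_mul (hf.differentiable z) (hg.differentiable z)]
  simp

theorem pd_comp (hf : IsSmoothPeriodic f) {h : ℝ → ℝ} (hh : ContDiff ℝ ∞ h) (o : Option (Fin d))
    (z : SpaceTime d) : pd o (fun y => h (f y)) z = deriv h (f z) * pd o f z := by
  simp only [pd]
  have h1 := (hh.differentiable (by simp) (f z)).hasDerivAt.comp_hasFDerivAt z
    (hf.differentiable z).hasFDerivAt
  have h2 : fderiv ℝ (fun y => h (f y)) z = deriv h (f z) • fderiv ℝ f z := h1.fderiv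
  rw [h2]
  simp

theorem pd_sum {ι : Type*} (s : Finset ι) {F : ι → SpaceTime d → ℝ}
    (hF : ∀ i, IsSmoothPeriodic (F i)) (o : Option (Fin d)) (z : SpaceTime d) :
    pd o (fun y => ∑ i ∈ s, F i y) z = ∑ i ∈ s, pd o (F i) z := by
  simp only [pd]
  rw [fderiv_fun_sum fun i _ => (hF i).differentiable z]
  simp

/-! ### Functions supported in a compact time window -/

theorem exists_torusCell_translate (x : Space d) : ∃ k : Fin d → ℤ, x + intVec k ∈ torusCell d := by
  refine ⟨fun i => -⌊x i⌋, fun i => ?_⟩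
  have h1 := Int.floor_le (x i)
  have h2 := Int.lt_floor_add_one (x i)
  simp only [intVec, PiLp.add_apply, Int.cast_neg, mem_Ico]
  constructor <;> linarith

instance (d : ℕ) : SFinite (stripMeasure d) :=
  inferInstanceAs (SFinite (volume.restrict (shiftStrip 0)))

theorem measurableSet_timeWindow (d : ℕ) {I : Set ℝ} (hI : MeasurableSet I) :
    MeasurableSet {z : SpaceTime d | z.1 ∈ I} := measurable_fst hI

theorem windowMeasure_eq_restrict (d : ℕ) (a b : ℝ) :
    windowMeasure d a b = (stripMeasure d).restrict {z : SpaceTime d | z.1 ∈ Icc a b} := by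
  rw [stripMeasure, Measure.restrict_restrict (measurableSet_timeWindow d measurableSet_Icc),
    windowMeasure]
  congr 1
  ext z
  simp [shiftStrip]

theorem integral_strip_eq_window (hf : ∀ t x, t ∉ Icc a b → f (t, x) = 0) :
    ∫ z, f z ∂(stripMeasure d) = ∫ z, f z ∂(windowMeasure d a b) := by
  rw [windowMeasure_eq_restrict, setIntegral_eq_integral_of_forall_compl_eq_zero]
  rintro ⟨t, x⟩ hz
  exact hf t x hz

namespace IsWindowed

theorem exists_bound (hf : IsWindowed a b f) : ∃ B : ℝ, 0 ≤ B ∧ ∀ z, |f z| ≤ B := by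
  obtain ⟨K, hK, hKm⟩ := exists_isCompact_window d a b
  obtain ⟨B, hB⟩ := hK.exists_bound_of_continuousOn hf.continuous.continuousOn
  refine ⟨max B 0, le_max_right _ _, fun z => ?_⟩
  by_cases hz : z.1 ∈ Icc a b
  · obtain ⟨k, hk⟩ := exists_torusCell_translate z.2
    have h1 : f (z.1, z.2 + intVec k) = f z := hf.periodic z.1 k z.2
    rw [← h1]
    exact (hB _ (by simpa using hKm (z.1, z.2 + intVec k) ⟨hz, hk⟩ 0 (by simp))).trans
      (le_max_left _ _)
  · have : f z = 0 := hf.support z.1 z.2 hz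
    simp [this]

theorem smooth_mul (hf : IsWindowed a b f) (hg : Continuous g) (hgp : IsSpacePeriodic g) :
    IsWindowed a b fun z => g z * f z :=
  ⟨hg.mul hf.continuous, hgp.map₂ hf.periodic _, fun t x h => by rw [hf.support t x h, mul_zero]⟩

theorem sub (hf : IsWindowed a b f) (hg : IsWindowed a b g) : IsWindowed a b fun z => f z - g z :=
  ⟨hf.continuous.sub hg.continuous, hf.periodic.map₂ hg.periodic _, fun t x h => by
    rw [hf.support t x h, hg.support t x h, sub_zero]⟩

theorem sum {ι : Type*} (s : Finset ι) {F : ι → SpaceTime d → ℝ}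
    (hF : ∀ i, IsWindowed a b (F i)) : IsWindowed a b fun z => ∑ i ∈ s, F i z :=
  ⟨continuous_finsetSum _ fun i _ => (hF i).continuous,
    fun t k x => Finset.sum_congr rfl fun i _ => (hF i).periodic t k x,
    fun t x h => Finset.sum_eq_zero fun i _ => (hF i).support t x h⟩

theorem comp_add (hf : IsWindowed a b f) {ε : ℝ} {w : SpaceTime d} (hw : ‖w‖ ≤ ε) :
    IsWindowed (a - ε) (b + ε) fun z => f (z + w) := by
  refine ⟨hf.continuous.comp (by fun_prop), hf.periodic.comp_add w, fun t x h => ?_⟩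
  refine hf.support (t + w.1) (x + w.2) fun h' => h ?_
  have := abs_le.1 ((norm_fst_le w).trans hw)
  exact ⟨by linarith [h'.1, this.2], by linarith [h'.2, this.1]⟩

theorem integrable (hf : IsWindowed a b f) : Integrable f (stripMeasure d) := by
  obtain ⟨B, -, hB⟩ := hf.exists_bound
  have h1 : Integrable f (windowMeasure d a b) :=
    Integrable.of_bound hf.continuous.aestronglyMeasurable B (Eventually.of_forall hB)
  rw [windowMeasure_eq_restrict] at h1
  refine IntegrableOn.integrable_of_forall_notMem_eq_zero h1 ?_
  rintro ⟨t, x⟩ hz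
  exact hf.support t x hz

end IsWindowed

namespace IsTestIn

theorem isWindowed (hf : IsTestIn a b f) : IsWindowed a b f :=
  ⟨hf.continuous, hf.periodic, hf.support⟩

theorem pd_windowed (hf : IsTestIn a b f) (o : Option (Fin d)) : IsWindowed a b (pd o f) := by
  refine ⟨hf.continuous_pd o, hf.periodic_pd o, fun t x h => ?_⟩
  have : f =ᶠ[nhds (t, x)] fun _ => 0 := by
    filter_upwards [(isClosed_Icc.isOpen_compl.preimage continuous_fst).mem_nhds
      (show (t, x) ∈ Prod.fst ⁻¹' (Icc a b)ᶜ from h)] with z hz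
    exact hf.support z.1 z.2 hz
  simp [pd, this.fderiv_eq]

theorem mul_smooth (hf : IsTestIn a b f) (hg : IsSmoothPeriodic g) :
    IsTestIn a b fun z => f z * g z :=
  ⟨hf.toIsSmoothPeriodic.mul hg, fun t x h => by rw [hf.support t x h, zero_mul]⟩

theorem comp_add (hf : IsTestIn a b f) {ε : ℝ} {w : SpaceTime d} (hw : ‖w‖ ≤ ε) :
    IsTestIn (a - ε) (b + ε) fun z => f (z + w) :=
  ⟨⟨hf.smooth.comp (by fun_prop), hf.periodic.comp_add w⟩, (hf.isWindowed.comp_add hw).support⟩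

end IsTestIn

theorem pd_comp_add (o : Option (Fin d)) (f : SpaceTime d → ℝ) (w z : SpaceTime d) :
    pd o (fun y => f (y + w)) z = pd o f (z + w) := by
  simp only [pd]
  rw [fderiv_comp_add_right]

/-- `f` is integrable on `ℝ × 𝕋^d` with vanishing integral. -/
def IsNull (f : SpaceTime d → ℝ) : Prop :=
  Integrable f (stripMeasure d) ∧ ∫ z, f z ∂(stripMeasure d) = 0

theorem IsNull.add (hf : IsNull f) (hg : IsNull g) : IsNull fun z => f z + g z :=
  ⟨hf.1.add hg.1, by rw [integral_add hf.1 hg.1, hf.2, hg.2, add_zero]⟩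

theorem IsNull.sub (hf : IsNull f) (hg : IsNull g) : IsNull fun z => f z - g z :=
  ⟨hf.1.sub hg.1, by rw [integral_sub hf.1 hg.1, hf.2, hg.2, sub_zero]⟩

theorem IsNull.sum {ι : Type*} (s : Finset ι) {F : ι → SpaceTime d → ℝ}
    (hF : ∀ i, IsNull (F i)) : IsNull fun z => ∑ i ∈ s, F i z :=
  ⟨integrable_finsetSum _ fun i _ => (hF i).1, by
    rw [integral_finsetSum _ fun i _ => (hF i).1, Finset.sum_eq_zero fun i _ => (hF i).2]⟩

/-- Integration by parts without boundary terms: the integral of `f(· + s e)` does not depend on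
`s`, so its derivative at `s = 0`, taken under the integral sign, vanishes. -/
theorem IsTestIn.isNull_pd (hf : IsTestIn a b f) (o : Option (Fin d)) : IsNull (pd o f) := by
  refine ⟨(hf.pd_windowed o).integrable, ?_⟩
  obtain ⟨B, hB0, hB⟩ := (hf.pd_windowed o).exists_bound
  have hder : ∀ z : SpaceTime d, ∀ s : ℝ,
      HasDerivAt (fun s : ℝ => f (z + s • dirVec o)) (pd o f (z + s • dirVec o)) s := by
    intro z s
    have h1 : HasDerivAt (fun s : ℝ => z + s • dirVec o) (dirVec o) s := by
      simpa using ((hasDerivAt_id s).smul_const (dirVec o)).const_add z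
    exact (hf.differentiable _).hasFDerivAt.comp_hasDerivAt s h1
  -- For `|s| < 1` a shift moves time by at most one, so the enlarged window contains the supports
  -- of all shifted derivatives.
  set bound : SpaceTime d → ℝ := {z : SpaceTime d | z.1 ∈ Icc (a - 1) (b + 1)}.indicator fun _ => B
    with hbound
  have hbi : Integrable bound (stripMeasure d) := by
    rw [hbound, integrable_indicator_iff (measurableSet_timeWindow d measurableSet_Icc),
      IntegrableOn, ← windowMeasure_eq_restrict]
    exact integrable_const B
  have hshift : ∀ s : ℝ, |s| ≤ 1 → ‖s • (dirVec o : SpaceTime d)‖ ≤ 1 := fun s hs => by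
    rw [norm_smul]
    exact mul_le_one₀ hs (norm_nonneg _) (norm_dirVec_le o)
  have hmeas : ∀ (h : SpaceTime d → ℝ) (s : ℝ), Continuous h →
      AEStronglyMeasurable (fun z => h (z + s • dirVec o)) (stripMeasure d) := fun h s hh =>
    (hh.comp (by fun_prop)).aestronglyMeasurable
  have key := hasDerivAt_integral_of_dominated_loc_of_deriv_le (μ := stripMeasure d)
    (F := fun s z => f (z + s • dirVec o)) (F' := fun s z => pd o f (z + s • dirVec o))
    (x₀ := (0 : ℝ)) (bound := bound) (Metric.ball_mem_nhds 0 one_pos)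
    (Eventually.of_forall fun s => hmeas f s hf.continuous)
    (by simpa using hf.isWindowed.integrable) (hmeas _ 0 (hf.continuous_pd o))
    (Eventually.of_forall fun z s hs => by
      have hs' : |s| ≤ 1 := by simpa using (mem_ball_zero_iff.1 hs).le
      have hw := (hf.pd_windowed o).comp_add (hshift s hs')
      by_cases hz : z.1 ∈ Icc (a - 1) (b + 1)
      · rw [hbound, indicator_of_mem (by exact hz)]
        exact hB _
      · rw [hbound, indicator_of_notMem (by exact hz)]
        simpa using hw.support z.1 z.2 hz)
    hbi (Eventually.of_forall fun z s _ => hder z s)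
  have hconst : (fun s : ℝ => ∫ z, f (z + s • dirVec o) ∂(stripMeasure d))
      = fun _ => ∫ z, f z ∂(stripMeasure d) := by
    funext s
    exact hf.periodic.integral_comp_add _
  have h2 := key.2
  rw [hconst] at h2
  have := h2.unique (hasDerivAt_const (0 : ℝ) _)
  simpa using this

/-- `∑_o ∂_o F_o + R = 0` weakly on `(a,b) × 𝕋^d`. -/
def WeakDiv (a b : ℝ) (F : Option (Fin d) → SpaceTime d → ℝ) (R : SpaceTime d → ℝ) : Prop :=
  ∀ φ, IsTestIn a b φ →
    ∫ z, (∑ o, F o z * pd o φ z - R z * φ z) ∂(stripMeasure d) = 0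

/-! ### Duality between mollification and test functions -/

theorem integrable_prod_kernel {k : SpaceTime d → ℝ} (hk : Integrable k) (hf : IsSpacePeriodic f)
    (hfi : Integrable f (stripMeasure d)) :
    Integrable (Function.uncurry fun z w => k w * f (z - w))
      ((stripMeasure d).prod (volume : Measure (SpaceTime d))) := by
  have hm : AEStronglyMeasurable (Function.uncurry fun z w => k w * f (z - w))
      ((stripMeasure d).prod (volume : Measure (SpaceTime d))) :=
    hk.1.comp_snd.mul (aestronglyMeasurable_translate (hf.locallyIntegrable hfi).aestronglyMeasurable
      (Measure.absolutelyContinuous_of_le Measure.restrict_le_self))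
  rw [integrable_prod_iff' hm]
  refine ⟨Eventually.of_forall fun w => ?_, ?_⟩
  · simpa [sub_eq_add_neg] using (hf.integrable_comp_add hfi (-w)).const_mul (k w)
  · have : (fun w => ∫ z, ‖Function.uncurry (fun z w => k w * f (z - w)) (z, w)‖ ∂(stripMeasure d))
        = fun w => ‖k w‖ * ∫ z, ‖f z‖ ∂(stripMeasure d) := by
      funext w
      simp only [Function.uncurry_apply_pair, norm_mul, integral_const_mul]
      congr 1
      simpa [sub_eq_add_neg] using (hf.map fun r => ‖r‖).integral_comp_add (-w)
    rw [this]
    exact hk.norm.mul_const _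

theorem integrable_prod_kernel_mul {k ψ : SpaceTime d → ℝ} (hk : Integrable k)
    (hf : IsSpacePeriodic f) (hfi : Integrable f (stripMeasure d)) (hψ : IsWindowed a b ψ) :
    Integrable (fun y : SpaceTime d × SpaceTime d => k y.2 * f (y.1 - y.2) * ψ y.1)
      ((stripMeasure d).prod (volume : Measure (SpaceTime d))) := by
  obtain ⟨B, -, hB⟩ := hψ.exists_bound
  exact (integrable_prod_kernel hk hf hfi).mul_bdd (c := B)
    (hψ.continuous.comp continuous_fst).aestronglyMeasurable
    (Eventually.of_forall fun y => hB y.1)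

theorem integrable_kernelConv_mul {k ψ : SpaceTime d → ℝ} (hk : Integrable k)
    (hf : IsSpacePeriodic f) (hfi : Integrable f (stripMeasure d)) (hψ : IsWindowed a b ψ) :
    Integrable (fun z => kernelConv k f z * ψ z) (stripMeasure d) := by
  have h := (integrable_prod_kernel_mul hk hf hfi hψ).integral_prod_left
  simpa only [integral_mul_const, kernelConv] using h

/-- Fubini's theorem followed by the change of variables `z ↦ z + w` moves the mollification from
`f` to translates of the test function. -/
theorem integral_kernelConv_mul {k ψ : SpaceTime d → ℝ} (hk : Integrable k)
    (hf : IsSpacePeriodic f) (hfi : Integrable f (stripMeasure d)) (hψ : IsWindowed a b ψ) :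
    ∫ z, kernelConv k f z * ψ z ∂(stripMeasure d)
      = ∫ w, k w * ∫ z, f z * ψ (z + w) ∂(stripMeasure d) := by
  have h := integral_integral_swap (f := fun z w => k w * f (z - w) * ψ z)
    (integrable_prod_kernel_mul hk hf hfi hψ)
  simp only [integral_mul_const] at h
  refine h.trans (integral_congr_ae (Eventually.of_forall fun w => ?_))
  simp only [mul_assoc, integral_const_mul]
  congr 1
  rw [← ((hf.comp_sub w).map₂ hψ.periodic fun r s => r * s).integral_comp_add w]
  simp

theorem integrable_kernel_mul_pairing {k ψ : SpaceTime d → ℝ} (hk : Integrable k)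
    (hf : IsSpacePeriodic f) (hfi : Integrable f (stripMeasure d)) (hψ : IsWindowed a b ψ) :
    Integrable fun w => k w * ∫ z, f z * ψ (z + w) ∂(stripMeasure d) := by
  have h := (integrable_prod_kernel_mul hk hf hfi hψ).integral_prod_right
  refine h.congr (Eventually.of_forall fun w => ?_)
  simp only [mul_assoc, integral_const_mul]
  congr 1
  rw [← ((hf.comp_sub w).map₂ hψ.periodic fun r s => r * s).integral_comp_add w]
  simp

theorem IsWindowed.integrable_mul (hψ : IsWindowed a b g)
    (hfi : Integrable f (stripMeasure d)) : Integrable (fun z => f z * g z) (stripMeasure d) := by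
  obtain ⟨B, -, hB⟩ := hψ.exists_bound
  exact hfi.mul_bdd (c := B) hψ.continuous.aestronglyMeasurable (Eventually.of_forall hB)

/-- Mollification preserves weak balance laws. -/
theorem WeakDiv.kernelConv {C ε : ℝ} {k : SpaceTime d → ℝ} (hk : IsSmoothingKernel C ε k)
    {F : Option (Fin d) → SpaceTime d → ℝ} {R : SpaceTime d → ℝ}
    (hF : ∀ o, IsSpacePeriodic (F o)) (hFi : ∀ o, Integrable (F o) (stripMeasure d))
    (hR : IsSpacePeriodic R) (hRi : Integrable R (stripMeasure d))
    (h : WeakDiv (a - ε) (b + ε) F R) :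
    WeakDiv a b (fun o => kernelConv k (F o)) (kernelConv k R) := by
  intro φ hφ
  have hki := hk.integrable
  rw [integral_sub (integrable_finsetSum _ fun o _ =>
      integrable_kernelConv_mul hki (hF o) (hFi o) (hφ.pd_windowed o))
    (integrable_kernelConv_mul hki hR hRi hφ.isWindowed),
    integral_finsetSum _ fun o _ =>
      integrable_kernelConv_mul hki (hF o) (hFi o) (hφ.pd_windowed o),
    integral_kernelConv_mul hki hR hRi hφ.isWindowed]
  simp_rw [fun o => integral_kernelConv_mul hki (hF o) (hFi o) (hφ.pd_windowed o)]
  rw [← integral_finsetSum _ fun o _ =>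
      integrable_kernel_mul_pairing hki (hF o) (hFi o) (hφ.pd_windowed o),
    ← integral_sub (integrable_finsetSum _ fun o _ =>
      integrable_kernel_mul_pairing hki (hF o) (hFi o) (hφ.pd_windowed o))
    (integrable_kernel_mul_pairing hki hR hRi hφ.isWindowed)]
  -- Where `k w ≠ 0`, the translate `φ(· + w)` is a test function on the enlarged window, so the
  -- weak law makes the integrand vanish for every `w`.
  refine integral_eq_zero_of_ae (Eventually.of_forall fun w => ?_)
  by_cases hw : k w = 0
  · simp [hw]
  · have hw' := hk.support w hw
    have hφw := hφ.comp_add hw'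
    have h1 := h _ hφw
    simp_rw [pd_comp_add] at h1
    rw [integral_sub (integrable_finsetSum _ fun o _ =>
        ((hφ.pd_windowed o).comp_add hw').integrable_mul (hFi o))
      ((hφ.isWindowed.comp_add hw').integrable_mul hRi),
      integral_finsetSum _ fun o _ =>
        ((hφ.pd_windowed o).comp_add hw').integrable_mul (hFi o)] at h1
    simp only [← Finset.mul_sum, ← mul_sub, Pi.zero_apply]
    rw [h1, mul_zero]

/-! ### Exact identities for smooth fields -/

section Identities

variable {d : ℕ} {a b : ℝ} {φ : SpaceTime d → ℝ}

theorem WeakDiv.isNull {F : Option (Fin d) → SpaceTime d → ℝ} {R : SpaceTime d → ℝ}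
    (h : WeakDiv a b F R) (hF : ∀ o, IsSmoothPeriodic (F o)) (hR : IsSmoothPeriodic R)
    (hφ : IsTestIn a b φ) : IsNull fun z => ∑ o, F o z * pd o φ z - R z * φ z :=
  ⟨((IsWindowed.sum _ fun o => (hφ.pd_windowed o).smooth_mul (hF o).continuous
    (hF o).periodic).sub (hφ.isWindowed.smooth_mul hR.continuous hR.periodic)).integrable, h φ hφ⟩

/-- `G = ∂_j U` weakly on `(a,b) × 𝕋^d`. -/
def WeakPartial (a b : ℝ) (j : Fin d) (U G : SpaceTime d → ℝ) : Prop :=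
  WeakDiv a b (fun o z => if o = some j then U z else 0) (fun z => -G z)

theorem isSmoothPeriodic_const (c : ℝ) : IsSmoothPeriodic fun _ : SpaceTime d => c :=
  ⟨contDiff_const, fun _ _ _ => rfl⟩

theorem WeakPartial.isNull {j : Fin d} {U G : SpaceTime d → ℝ} (h : WeakPartial a b j U G)
    (hU : IsSmoothPeriodic U) (hG : IsSmoothPeriodic G) (hφ : IsTestIn a b φ) :
    IsNull fun z => U z * pd (some j) φ z + G z * φ z := by
  have h1 := WeakDiv.isNull h (fun o => by
    by_cases ho : o = some j
    · simpa [ho] using hU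
    · simpa [ho] using isSmoothPeriodic_const 0) ⟨hG.smooth.neg, hG.periodic.map _⟩ hφ
  simpa [Fintype.sum_option, ite_mul] using h1

/-- The total derivative `∂_j(φ U)` has integral zero, and subtracting the weak identity leaves this
term. Only the integrated form of `∂_j U = G` is needed later. -/
theorem WeakPartial.isNull_sub {j : Fin d} {U G : SpaceTime d → ℝ} (h : WeakPartial a b j U G)
    (hU : IsSmoothPeriodic U) (hG : IsSmoothPeriodic G) (hφ : IsTestIn a b φ) :
    IsNull fun z => φ z * (pd (some j) U z - G z) := by
  have h1 := ((hφ.mul_smooth hU).isNull_pd (some j)).sub (h.isNull hU hG hφ)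
  convert h1 using 2 with z
  rw [pd_mul hφ.toIsSmoothPeriodic hU]
  ring

/-- The pointwise bookkeeping behind the kinetic energy balance, with `Dφ` and `DU` standing for
derivatives. The left side is the energy integrand plus the defect `Q - M ⊗ U` paired with `∂(φU)`.
The right side consists of four expressions with vanishing integral: momentum tested with `φ U_i`,
continuity tested with `φ |U|²/2`, and two corrections replacing `∂_j U_i` by `G i j`. -/
theorem kinetic_algebra {d : ℕ} (M Dφ : Option (Fin d) → ℝ) (U : Fin d → ℝ)
    (Q DU : Fin d → Option (Fin d) → ℝ) (S G : Fin d → Fin d → ℝ) (P φ : ℝ) :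
    (∑ o, M o * (1 / 2 * ∑ i, U i * U i) * Dφ o + ∑ j, P * U j * Dφ (some j)
        + ∑ j, P * G j j * φ - ∑ i, ∑ j, S i j * U i * Dφ (some j) - ∑ i, ∑ j, S i j * G i j * φ)
      + ∑ i, ∑ o, (Q i o - M o * U i) * (φ * DU i o + U i * Dφ o)
    = ∑ i, ∑ o, (Q i o + o.elim 0 fun j => (if j = i then P else 0) - S i j)
          * (φ * DU i o + U i * Dφ o)
      - ∑ o, M o * (φ * (∑ i, U i * DU i o) + (1 / 2 * ∑ i, U i * U i) * Dφ o)
      - ∑ j, φ * P * (DU j (some j) - G j j) + ∑ i, ∑ j, φ * S i j * (DU i (some j) - G i j) := by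
  have h1 : ∑ i, ∑ o, (Q i o + o.elim 0 fun j => (if j = i then P else 0) - S i j)
      * (φ * DU i o + U i * Dφ o) = ∑ i, ∑ o, (Q i o - M o * U i) * (φ * DU i o + U i * Dφ o)
      + ∑ o, ∑ i, M o * U i * (φ * DU i o + U i * Dφ o)
      + ∑ j, P * (φ * DU j (some j) + U j * Dφ (some j))
      - ∑ i, ∑ j, S i j * (φ * DU i (some j) + U i * Dφ (some j)) := by
    rw [Finset.sum_comm (s := Finset.univ (α := Option (Fin d))), ← Finset.sum_add_distrib,
      ← Finset.sum_add_distrib, ← Finset.sum_sub_distrib]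
    refine Finset.sum_congr rfl fun i _ => ?_
    simp only [Fintype.sum_option, Option.elim, add_mul, sub_mul, Finset.sum_add_distrib,
      Finset.sum_sub_distrib, ite_mul, zero_mul, Finset.sum_ite_eq', Finset.mem_univ, if_true]
    ring
  have h2 : ∑ o, ∑ i, M o * U i * (φ * DU i o + U i * Dφ o)
      = ∑ o, M o * (φ * (∑ i, U i * DU i o) + (1 / 2 * ∑ i, U i * U i) * Dφ o)
      + ∑ o, M o * (1 / 2 * ∑ i, U i * U i) * Dφ o := by
    rw [← Finset.sum_add_distrib]
    refine Finset.sum_congr rfl fun o _ => ?_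
    have e : ∑ i, M o * U i * (φ * DU i o + U i * Dφ o)
        = M o * (φ * ∑ i, U i * DU i o) + M o * ((∑ i, U i * U i) * Dφ o) := by
      simp only [Finset.mul_sum, Finset.sum_mul, ← Finset.sum_add_distrib]
      exact Finset.sum_congr rfl fun i _ => by ring
    rw [e]; ring
  have h3 : ∑ j, P * (φ * DU j (some j) + U j * Dφ (some j))
      = ∑ j, φ * P * (DU j (some j) - G j j) + ∑ j, P * U j * Dφ (some j)
        + ∑ j, P * G j j * φ := by
    simp only [← Finset.sum_add_distrib]
    exact Finset.sum_congr rfl fun i _ => by ring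
  have h4 : ∑ i, ∑ j, S i j * (φ * DU i (some j) + U i * Dφ (some j))
      = ∑ i, ∑ j, φ * S i j * (DU i (some j) - G i j) + ∑ i, ∑ j, S i j * U i * Dφ (some j)
        + ∑ i, ∑ j, S i j * G i j * φ := by
    simp only [← Finset.sum_add_distrib]
    exact Finset.sum_congr rfl fun i _ => Finset.sum_congr rfl fun j _ => by ring
  rw [h1, h2, h3, h4]
  ring

/-- The balance of kinetic energy for smooth fields which satisfy the momentum balance with the
momentum flux `Q` in place of `M ⊗ U`. -/
theorem isNull_kinetic {M : Option (Fin d) → SpaceTime d → ℝ} {U : Fin d → SpaceTime d → ℝ}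
    {Q : Fin d → Option (Fin d) → SpaceTime d → ℝ} {S G : Fin d → Fin d → SpaceTime d → ℝ}
    {P : SpaceTime d → ℝ} (hM : ∀ o, IsSmoothPeriodic (M o)) (hU : ∀ i, IsSmoothPeriodic (U i))
    (hQ : ∀ i o, IsSmoothPeriodic (Q i o)) (hS : ∀ i j, IsSmoothPeriodic (S i j))
    (hG : ∀ i j, IsSmoothPeriodic (G i j)) (hP : IsSmoothPeriodic P)
    (hcont : WeakDiv a b M fun _ => 0)
    (hmom : ∀ i, WeakDiv a b (fun o z => Q i o z + o.elim 0
      fun j => (if j = i then P z else 0) - S i j z) fun _ => 0)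
    (hgrad : ∀ i j, WeakPartial a b j (U i) (G i j)) (hφ : IsTestIn a b φ) :
    IsNull fun z => (∑ o, M o z * (1 / 2 * ∑ i, U i z * U i z) * pd o φ z
        + ∑ j, P z * U j z * pd (some j) φ z + ∑ j, P z * G j j z * φ z
        - ∑ i, ∑ j, S i j z * U i z * pd (some j) φ z - ∑ i, ∑ j, S i j z * G i j z * φ z)
      + ∑ i, ∑ o, (Q i o z - M o z * U i z) * pd o (fun y => φ y * U i y) z := by
  have hE : IsSmoothPeriodic fun z => 1 / 2 * ∑ i, U i z * U i z :=
    (isSmoothPeriodic_const _).mul (IsSmoothPeriodic.sum _ fun i => (hU i).mul (hU i))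
  have hfl : ∀ i o, IsSmoothPeriodic fun z => Q i o z + (o.elim 0
      fun j => (if j = i then P z else 0) - S i j z : ℝ) := by
    rintro i (_ | j)
    · simpa using hQ i none
    · by_cases hij : j = i
      · simpa [hij] using ⟨(hQ i (some i)).smooth.add (hP.smooth.sub (hS i i).smooth),
          (hQ i (some i)).periodic.map₂ (hP.periodic.map₂ (hS i i).periodic fun r s => r - s)
            fun r s => r + s⟩
      · simpa [hij] using ⟨(hQ i (some j)).smooth.sub (hS i j).smooth,
          (hQ i (some j)).periodic.map₂ (hS i j).periodic fun r s => r - s⟩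
  have n1 := IsNull.sum Finset.univ fun i => (hmom i).isNull (hfl i) (isSmoothPeriodic_const 0)
    (hφ.mul_smooth (hU i))
  have n2 := hcont.isNull hM (isSmoothPeriodic_const 0) (hφ.mul_smooth hE)
  have n3 := IsNull.sum Finset.univ fun j => (hgrad j j).isNull_sub (hU j) (hG j j)
    (hφ.mul_smooth hP)
  have n4 := IsNull.sum Finset.univ fun i => IsNull.sum Finset.univ fun j =>
    (hgrad i j).isNull_sub (hU i) (hG i j) (hφ.mul_smooth (hS i j))
  convert ((n1.sub n2).sub n3).add n4 using 2 with z
  simp only [zero_mul, sub_zero]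
  have hpE : ∀ o, pd o (fun y => φ y * (1 / 2 * ∑ i, U i y * U i y)) z
      = φ z * (∑ i, U i z * pd o (U i) z) + (1 / 2 * ∑ i, U i z * U i z) * pd o φ z := by
    intro o
    rw [pd_mul hφ.toIsSmoothPeriodic hE, pd_mul (isSmoothPeriodic_const _)
      (IsSmoothPeriodic.sum _ fun i => (hU i).mul (hU i)), pd_sum _ fun i => (hU i).mul (hU i)]
    have : pd o (fun _ : SpaceTime d => (1 / 2 : ℝ)) z = 0 := by simp [pd]
    rw [this, mul_zero, add_zero]
    congr 2
    rw [Finset.mul_sum]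
    refine Finset.sum_congr rfl fun i _ => ?_
    rw [pd_mul (hU i) (hU i)]
    ring
  simp only [hpE, pd_mul hφ.toIsSmoothPeriodic (hU _)]
  exact kinetic_algebra (fun o => M o z) (fun o => pd o φ z) (fun i => U i z)
    (fun i o => Q i o z) (fun i o => pd o (U i) z) (fun i j => S i j z) (fun i j => G i j z) (P z)
    (φ z)

/-- Renormalization of the continuity equation for smooth fields, the mass flux being `M`. -/
theorem isNull_renormalized {M : Option (Fin d) → SpaceTime d → ℝ} {U : Fin d → SpaceTime d → ℝ}
    {G : Fin d → Fin d → SpaceTime d → ℝ} (hM : ∀ o, IsSmoothPeriodic (M o))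
    (hU : ∀ i, IsSmoothPeriodic (U i)) (hG : ∀ i j, IsSmoothPeriodic (G i j))
    (hcont : WeakDiv a b M fun _ => 0) (hgrad : ∀ i j, WeakPartial a b j (U i) (G i j))
    (hφ : IsTestIn a b φ) {h : ℝ → ℝ} (hh : ContDiff ℝ ∞ h) :
    IsNull fun z => (h (M none z) * pd none φ z + ∑ j, h (M none z) * U j z * pd (some j) φ z
        - ∑ j, (M none z * deriv h (M none z) - h (M none z)) * G j j z * φ z)
      + ∑ j, (M (some j) z - M none z * U j z)
          * pd (some j) (fun y => φ y * deriv h (M none y)) z := by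
  have hh' : ContDiff ℝ ∞ (deriv h) := hh.iterate_deriv 1
  have hq : ContDiff ℝ ∞ fun r => r * deriv h r - h r := (contDiff_id.mul hh').sub hh
  have hDq : ∀ r, deriv (fun r => r * deriv h r - h r) r = r * deriv (deriv h) r := by
    intro r
    have h1 := ((hasDerivAt_id r).mul (hh'.differentiable (by simp) r).hasDerivAt).sub
      (hh.differentiable (by simp) r).hasDerivAt
    refine h1.deriv.trans ?_
    simp
  have hMq := (hM none).comp hq
  have hMd := (hM none).comp hh'
  -- The test functions are `φ h'(ρ)` in the continuity equation and `φ q(ρ)` in `∂_j U_j = G j j`,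
  -- where `q(r) = r h'(r) - h(r)`. As `q'(r) = r h''(r)`, subtracting the total derivatives of `φ
  -- q(ρ)` cancels all terms with `∂ρ`, except those in the defect.
  have n1 := hcont.isNull hM (isSmoothPeriodic_const 0) (hφ.mul_smooth hMd)
  have n2 := (hφ.mul_smooth hMq).isNull_pd none
  have n3 := IsNull.sum Finset.univ fun j => (hgrad j j).isNull (hU j) (hG j j)
    (hφ.mul_smooth hMq)
  convert (n1.sub n2).sub n3 using 2 with z
  have e1 : ∀ o, pd o (fun y => φ y * (M none y * deriv h (M none y) - h (M none y))) z
      = φ z * (M none z * deriv (deriv h) (M none z) * pd o (M none) z)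
        + (M none z * deriv h (M none z) - h (M none z)) * pd o φ z := fun o => by
    rw [pd_mul hφ.toIsSmoothPeriodic hMq, pd_comp (hM none) hq, hDq]
  have e2 : ∀ o, pd o (fun y => φ y * deriv h (M none y)) z
      = φ z * (deriv (deriv h) (M none z) * pd o (M none) z)
        + deriv h (M none z) * pd o φ z := fun o => by
    rw [pd_mul hφ.toIsSmoothPeriodic hMd, pd_comp (hM none) hh']
  simp only [e1, e2, Fintype.sum_option, zero_mul, sub_zero]
  rw [add_sub_assoc, ← Finset.sum_sub_distrib, add_assoc, ← Finset.sum_add_distrib, add_sub_right_comm,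
    add_sub_assoc, ← Finset.sum_sub_distrib]
  congr 1
  · ring
  · exact Finset.sum_congr rfl fun j _ => by ring

end Identities

/-! ### Convergence in `L^p` -/

theorem eLpNorm_mul_le {α : Type*} [MeasurableSpace α] {μ : Measure α} {p q r : ℝ≥0∞}
    [ENNReal.HolderTriple p q r] {f g : α → ℝ} (hf : AEStronglyMeasurable f μ)
    (hg : AEStronglyMeasurable g μ) :
    eLpNorm (fun z => f z * g z) r μ ≤ eLpNorm f p μ * eLpNorm g q μ := by
  have h := eLpNorm_smul_le_mul_eLpNorm (p := p) (q := q) (r := r) hg hf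
  exact h

/-- `F i → f` in `L^p(μ)` along `l`. -/
structure LpTendsto {α ι : Type*} [MeasurableSpace α] (μ : Measure α) (p : ℝ≥0∞) (l : Filter ι)
    (F : ι → α → ℝ) (f : α → ℝ) : Prop where
  memLp_approx : ∀ᶠ i in l, MemLp (F i) p μ
  memLp : MemLp f p μ
  tendsto : Tendsto (fun i => eLpNorm (fun z => F i z - f z) p μ) l (nhds 0)

namespace LpTendsto

variable {α ι : Type*} [MeasurableSpace α] {μ : Measure α} {p q r : ℝ≥0∞} {l : Filter ι}
  {F G : ι → α → ℝ} {f g : α → ℝ}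

theorem const (hf : MemLp f p μ) : LpTendsto μ p l (fun _ => f) f :=
  ⟨Eventually.of_forall fun _ => hf, hf, by simpa using tendsto_const_nhds⟩

theorem add (hp : 1 ≤ p) (hF : LpTendsto μ p l F f) (hG : LpTendsto μ p l G g) :
    LpTendsto μ p l (fun i z => F i z + G i z) fun z => f z + g z := by
  refine ⟨?_, hF.memLp.add hG.memLp, ?_⟩
  · filter_upwards [hF.memLp_approx, hG.memLp_approx] with i h1 h2 using h1.add h2
  · have h := hF.tendsto.add hG.tendsto
    rw [add_zero] at h
    refine tendsto_of_tendsto_of_tendsto_of_le_of_le' tendsto_const_nhds h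
      (Eventually.of_forall fun _ => zero_le) ?_
    filter_upwards [hF.memLp_approx, hG.memLp_approx] with i h1 h2
    refine le_trans (le_of_eq ?_) (eLpNorm_add_le (h1.sub hF.memLp).1 (h2.sub hG.memLp).1 hp)
    congr 1
    funext z
    simp only [Pi.add_apply]
    ring

theorem neg (hF : LpTendsto μ p l F f) : LpTendsto μ p l (fun i z => -F i z) fun z => -f z := by
  refine ⟨hF.memLp_approx.mono fun i h => h.neg, hF.memLp.neg, ?_⟩
  refine hF.tendsto.congr fun i => ?_
  rw [← eLpNorm_neg]
  congr 1
  funext z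
  simp only [Pi.neg_apply]
  ring

theorem sub (hp : 1 ≤ p) (hF : LpTendsto μ p l F f) (hG : LpTendsto μ p l G g) :
    LpTendsto μ p l (fun i z => F i z - G i z) fun z => f z - g z := by
  simpa only [sub_eq_add_neg] using hF.add hp hG.neg

theorem sum (hp : 1 ≤ p) {κ : Type*} (s : Finset κ) {F : κ → ι → α → ℝ} {f : κ → α → ℝ}
    (hF : ∀ k, LpTendsto μ p l (F k) (f k)) :
    LpTendsto μ p l (fun i z => ∑ k ∈ s, F k i z) fun z => ∑ k ∈ s, f k z := by
  classical
  induction s using Finset.induction_on with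
  | empty => exact const MemLp.zero
  | insert k s hk ih =>
    simp only [Finset.sum_insert hk]
    exact (hF k).add hp ih

theorem mul [ENNReal.HolderTriple p q r] (hq : 1 ≤ q) (hr : 1 ≤ r)
    (hF : LpTendsto μ p l F f) (hG : LpTendsto μ q l G g) :
    LpTendsto μ r l (fun i z => F i z * G i z) fun z => f z * g z := by
  refine ⟨?_, hG.memLp.mul' hF.memLp, ?_⟩
  · filter_upwards [hF.memLp_approx, hG.memLp_approx] with i h1 h2 using h2.mul' h1
  · have t1 : Tendsto (fun i => eLpNorm (fun z => F i z - f z) p μ *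
        (eLpNorm (fun z => G i z - g z) q μ + eLpNorm g q μ)) l (nhds 0) := by
      have := ENNReal.Tendsto.mul hF.tendsto (Or.inr (by simpa using hG.memLp.2.ne))
        (hG.tendsto.add_const (eLpNorm g q μ)) (Or.inr ENNReal.zero_ne_top)
      simpa using this
    have t2 : Tendsto (fun i => eLpNorm f p μ * eLpNorm (fun z => G i z - g z) q μ) l
        (nhds 0) := by
      have := ENNReal.Tendsto.const_mul hG.tendsto (Or.inr hF.memLp.2.ne)
      simpa using this
    have t3 := t1.add t2
    rw [add_zero] at t3
    refine tendsto_of_tendsto_of_tendsto_of_le_of_le' tendsto_const_nhds t3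
      (Eventually.of_forall fun _ => zero_le) ?_
    filter_upwards [hF.memLp_approx, hG.memLp_approx] with i h1 h2
    have e : (fun z => F i z * G i z - f z * g z)
        = (fun z => (F i z - f z) * G i z) + fun z => f z * (G i z - g z) := by
      funext z; simp only [Pi.add_apply]; ring
    have d1 := (h1.sub hF.memLp).1
    have d2 := (h2.sub hG.memLp).1
    rw [e]
    refine (eLpNorm_add_le (d1.mul h2.1) (hF.memLp.1.mul d2) hr).trans (add_le_add ?_ ?_)
    · refine (eLpNorm_mul_le (p := p) (q := q) d1 h2.1).trans ?_
      refine mul_le_mul_right ?_ _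
      refine le_trans (le_of_eq ?_) (eLpNorm_add_le d2 hG.memLp.1 hq)
      congr 1
      funext z
      simp
    · exact eLpNorm_mul_le (p := p) (q := q) hF.memLp.1 d2

theorem mul_bounded {ψ : α → ℝ} {B : ℝ} (hψ : AEStronglyMeasurable ψ μ) (hB : ∀ z, |ψ z| ≤ B)
    (hF : LpTendsto μ p l F f) : LpTendsto μ p l (fun i z => F i z * ψ z) fun z => f z * ψ z := by
  have hmem : ∀ {h : α → ℝ}, MemLp h p μ → MemLp (fun z => h z * ψ z) p μ := fun {h} hh =>
    MemLp.of_le_mul (c := B) hh (hh.1.mul hψ) (Eventually.of_forall fun z => by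
      rw [norm_mul, mul_comm]
      exact mul_le_mul_of_nonneg_right (hB z) (norm_nonneg _))
  refine ⟨hF.memLp_approx.mono fun i h => hmem h, hmem hF.memLp, ?_⟩
  have t := ENNReal.Tendsto.const_mul (a := ENNReal.ofReal B) hF.tendsto
    (Or.inr ENNReal.ofReal_ne_top)
  rw [mul_zero] at t
  refine tendsto_of_tendsto_of_tendsto_of_le_of_le tendsto_const_nhds t (fun _ => zero_le)
    fun i => ?_
  refine eLpNorm_le_mul_eLpNorm_of_ae_le_mul (Eventually.of_forall fun z => ?_) p
  rw [← sub_mul, norm_mul, mul_comm]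
  exact mul_le_mul_of_nonneg_right (hB z) (norm_nonneg _)

theorem mono_exponent [IsFiniteMeasure μ] (hpq : p ≤ q) (hF : LpTendsto μ q l F f) :
    LpTendsto μ p l F f := by
  refine ⟨hF.memLp_approx.mono fun i h => h.mono_exponent hpq, hF.memLp.mono_exponent hpq, ?_⟩
  set A := μ univ ^ (1 / p.toReal - 1 / q.toReal) with hA
  by_cases hp0 : p = 0
  · simpa [hp0] using tendsto_const_nhds
  have hAtop : A ≠ ⊤ := by
    refine ENNReal.rpow_ne_top_of_nonneg ?_ (measure_ne_top μ univ)
    by_cases hq : q = ⊤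
    · simp [hq]
    · exact sub_nonneg.2 (one_div_le_one_div_of_le
        (ENNReal.toReal_pos hp0 (ne_top_of_le_ne_top hq hpq)) (ENNReal.toReal_mono hq hpq))
  have t := ENNReal.Tendsto.mul_const (b := A) hF.tendsto (Or.inr hAtop)
  rw [zero_mul] at t
  refine tendsto_of_tendsto_of_tendsto_of_le_of_le' tendsto_const_nhds t
    (Eventually.of_forall fun _ => zero_le) ?_
  filter_upwards [hF.memLp_approx] with i h
  exact eLpNorm_le_eLpNorm_mul_rpow_measure_univ hpq (h.sub hF.memLp).1

/-- Composition with a function that is `C^1` near the compact range of the sequence. -/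
theorem comp_contDiff [IsFiniteMeasure μ] {h : ℝ → ℝ} (hh : ContDiff ℝ 1 h) {m : ℝ}
    (hFm : ∀ᶠ i in l, ∀ z, F i z ∈ Icc 0 m) (hfm : ∀ᵐ z ∂μ, f z ∈ Icc 0 m)
    (hF : LpTendsto μ p l F f) : LpTendsto μ p l (fun i z => h (F i z)) fun z => h (f z) := by
  obtain ⟨B, hB⟩ := (isCompact_Icc (a := (0 : ℝ)) (b := m)).exists_bound_of_continuousOn
    hh.continuous.continuousOn
  obtain ⟨L, hL⟩ := (isCompact_Icc (a := (0 : ℝ)) (b := m)).exists_bound_of_continuousOn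
    (hh.continuous_deriv le_rfl).continuousOn
  refine ⟨?_, ?_, ?_⟩
  · filter_upwards [hFm, hF.memLp_approx] with i hi h'
    exact MemLp.of_bound (hh.continuous.comp_aestronglyMeasurable h'.1) B
      (Eventually.of_forall fun z => hB _ (hi z))
  · exact MemLp.of_bound (hh.continuous.comp_aestronglyMeasurable hF.memLp.1) B
      (hfm.mono fun z hz => hB _ hz)
  · have t := ENNReal.Tendsto.const_mul (a := ENNReal.ofReal L) hF.tendsto
      (Or.inr ENNReal.ofReal_ne_top)
    rw [mul_zero] at t
    refine tendsto_of_tendsto_of_tendsto_of_le_of_le' tendsto_const_nhds t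
      (Eventually.of_forall fun _ => zero_le) ?_
    filter_upwards [hFm] with i hi
    refine eLpNorm_le_mul_eLpNorm_of_ae_le_mul ?_ p
    filter_upwards [hfm] with z hz
    exact (convex_Icc 0 m).norm_image_sub_le_of_norm_deriv_le
      (fun x _ => hh.differentiable one_ne_zero x) hL hz (hi z)

theorem tendsto_integral (hF : LpTendsto μ 1 l F f) :
    Tendsto (fun i => ∫ z, F i z ∂μ) l (nhds (∫ z, f z ∂μ)) := by
  refine tendsto_integral_of_L1' f hF.memLp.1 ?_ hF.tendsto
  exact hF.memLp_approx.mono fun i h => memLp_one_iff_integrable.1 h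

end LpTendsto

instance : ENNReal.HolderTriple 3 3 (3 / 2) where
  inv_add_inv_eq_inv := by
    rw [ENNReal.inv_div (by simp) (by simp), ENNReal.div_eq_inv_mul, mul_two]

instance : ENNReal.HolderTriple (3 / 2) 3 1 where
  inv_add_inv_eq_inv := by
    rw [ENNReal.inv_div (by simp) (by simp), ENNReal.div_eq_inv_mul, inv_one, ← mul_add_one]
    norm_num
    exact ENNReal.inv_mul_cancel (by simp) (by simp)

/-! ### The commutators vanish in the limit -/

variable {d : ℕ}

/-- Besov regularity of order `s` on the time window `[a,b]`. -/
def ShiftBound (a b s : ℝ) (f : SpaceTime d → ℝ) : Prop :=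
  ∃ M : ℝ, ∃ ε₀ : ℝ, 0 ≤ M ∧ 0 < ε₀ ∧ ∀ ε, 0 < ε → ε ≤ ε₀ → ∀ w : SpaceTime d, ‖w‖ ≤ ε →
    eLpNorm (fun z => f (z - w) - f z) 3 (windowMeasure d a b) ≤ ENNReal.ofReal (M * ε ^ s)

theorem one_le_three_halves : (1 : ℝ≥0∞) ≤ 3 / 2 := by
  rw [ENNReal.le_div_iff_mul_le (by simp) (by simp)]
  norm_num

theorem lpTendsto_kernelConv {C : ℝ} {η : ℝ → SpaceTime d → ℝ}
    (hη : ∀ ε > 0, IsSmoothingKernel C ε (η ε)) {p : ℝ≥0∞} (hp1 : 1 ≤ p) (hp : p ≠ ⊤)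
    {f : SpaceTime d → ℝ} (hf : LocMemLp p f) (a b : ℝ) :
    LpTendsto (windowMeasure d a b) p (nhdsWithin 0 (Ioi 0)) (fun ε => kernelConv (η ε) f) f := by
  have ht := tendsto_eLpNorm_kernelConv_sub hη hp1 hp hf a b
  refine ⟨?_, hf.window a b, ht⟩
  filter_upwards [ht.eventually (gt_mem_nhds ENNReal.zero_lt_top), self_mem_nhdsWithin] with ε h1 h2
  have hc := (contDiff_kernelConv (hη ε h2).contDiff (hη ε h2).hasCompactSupport
    (hf.locallyIntegrable hp1)).continuous
  have h3 : MemLp (fun z => kernelConv (η ε) f z - f z) p (windowMeasure d a b) :=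
    ⟨hc.aestronglyMeasurable.sub (hf.window a b).1, h1⟩
  have h4 := h3.add (hf.window a b)
  refine h4.congr_norm hc.aestronglyMeasurable (Eventually.of_forall fun z => ?_)
  simp

theorem isSmoothPeriodic_kernelConv {C ε : ℝ} {k f : SpaceTime d → ℝ}
    (hk : IsSmoothingKernel C ε k) (hf : LocallyIntegrable f) (hfp : IsSpacePeriodic f) :
    IsSmoothPeriodic (kernelConv k f) :=
  ⟨contDiff_kernelConv hk.contDiff hk.hasCompactSupport hf, hfp.kernelConv k⟩

/-- The gradient of the test factor `φ H(h^ε)` loses only `ε^(s-1)`. Linear growth of `H` and a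
bounded derivative are required only along the values of `h^ε`; this covers `H = id`, for the
velocity, and `H = h'`, for the density. -/
theorem exists_eLpNorm_pd_comp_le {C a b s : ℝ} (hC : 0 ≤ C) (hs0 : 0 ≤ s) (hs1 : s ≤ 1)
    {η : ℝ → SpaceTime d → ℝ}
    (hη : ∀ ε > 0, IsSmoothingKernel C ε (η ε)) {h φ : SpaceTime d → ℝ} (hh : LocMemLp 3 h)
    (hhp : IsSpacePeriodic h) (hsb : ShiftBound a b s h) (hφ : IsTestIn a b φ) {H : ℝ → ℝ}
    (hH : ContDiff ℝ ∞ H) {B : ℝ} (hB : 0 ≤ B)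
    (hHB : ∀ ε > 0, ∀ z, |H (kernelConv (η ε) h z)| ≤ B * (1 + |kernelConv (η ε) h z|) ∧
      |deriv H (kernelConv (η ε) h z)| ≤ B) (o : Option (Fin d)) :
    ∃ K : ℝ, 0 ≤ K ∧ ∀ᶠ ε in nhdsWithin (0 : ℝ) (Ioi 0),
      MemLp (pd o fun y => φ y * H (kernelConv (η ε) h y)) 3 (windowMeasure d a b) ∧
      eLpNorm (pd o fun y => φ y * H (kernelConv (η ε) h y)) 3 (windowMeasure d a b)
        ≤ ENNReal.ofReal (K * ε ^ (s - 1)) := by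
  obtain ⟨B1, hB10, hB1⟩ := hφ.isWindowed.exists_bound
  obtain ⟨B2, hB20, hB2⟩ := (hφ.pd_windowed o).exists_bound
  obtain ⟨M, ε₀, hM, hε₀, hshift⟩ := hsb
  set μ := windowMeasure d a b with hμ
  set N := (eLpNorm h 3 μ).toReal with hN
  set V := (eLpNorm (fun _ : SpaceTime d => (1 : ℝ)) 3 μ).toReal with hV
  have hNe : eLpNorm h 3 μ = ENNReal.ofReal N := (ENNReal.ofReal_toReal (hh.window a b).2.ne).symm
  have hVe : eLpNorm (fun _ : SpaceTime d => (1 : ℝ)) 3 μ = ENNReal.ofReal V :=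
    (ENNReal.ofReal_toReal (memLp_const 1).2.ne).symm
  have hloc := hh.locallyIntegrable (by norm_num)
  -- `V`, `M + N` and `C * M * ε^(s-1)` bound the `L³` norms of `1`, `h^ε` and `∂h^ε`; the
  -- zero-order terms are absorbed because `ε^(s-1) ≥ 1` for `ε ≤ 1`.
  refine ⟨(B1 + B2) * B * (V + (M + N) + C * M), by positivity, ?_⟩
  filter_upwards [Ioo_mem_nhdsGT (lt_min hε₀ one_pos)] with ε hε
  obtain ⟨hε0, hε1⟩ := hε
  have hk := hη ε hε0
  have hε1' : ε ≤ 1 := (hε1.trans_le (min_le_right _ _)).le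
  have hA := hshift ε hε0 (hε1.trans_le (min_le_left _ _)).le
  have hc := isSmoothPeriodic_kernelConv hk hloc hhp
  have hcH := hc.comp hH
  set he := kernelConv (η ε) h with hhe
  have n1 : eLpNorm he 3 μ ≤ ENNReal.ofReal (M + N) := by
    have h1 := eLpNorm_kernelConv_sub_le hk hloc (by norm_num) (by norm_num)
      (windowMeasure_ac d a b) hA
    have h2 := eLpNorm_add_le (hc.continuous.aestronglyMeasurable.sub (hh.window a b).1)
      (hh.window a b).1 (p := 3) (by norm_num)
    have e : he - h + h = he := by simp
    rw [e] at h2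
    refine h2.trans ?_
    rw [ENNReal.ofReal_add hM (by positivity), ← hNe]
    refine add_le_add (h1.trans (ENNReal.ofReal_le_ofReal ?_)) le_rfl
    exact mul_le_of_le_one_right hM (Real.rpow_le_one hε0.le hε1' hs0)
  have n2 : eLpNorm (pd o he) 3 μ ≤ ENNReal.ofReal (C * M * ε ^ (s - 1)) := by
    refine (eLpNorm_fderiv_kernelConv_le hk hloc (by norm_num) (by norm_num)
      (windowMeasure_ac d a b) hA (norm_dirVec_le o)).trans (le_of_eq ?_)
    rw [← ENNReal.ofReal_mul (by positivity), Real.rpow_sub_one hε0.ne']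
    congr 1
    ring
  have hpt : ∀ z, ‖pd o (fun y => φ y * H (he y)) z‖
      ≤ ((B1 + B2) * B) * ‖1 + |he z| + |pd o he z|‖ := by
    intro z
    rw [pd_mul hφ.toIsSmoothPeriodic hcH, pd_comp hc hH]
    obtain ⟨b1, b2⟩ := hHB ε hε0 z
    rw [Real.norm_of_nonneg (by positivity : 0 ≤ 1 + |he z| + |pd o he z|)]
    calc ‖φ z * (deriv H (he z) * pd o he z) + H (he z) * pd o φ z‖
        ≤ |φ z| * (|deriv H (he z)| * |pd o he z|) + |H (he z)| * |pd o φ z| := by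
          refine (norm_add_le _ _).trans (le_of_eq ?_)
          simp only [norm_mul, Real.norm_eq_abs]
      _ ≤ B1 * (B * |pd o he z|) + (B * (1 + |he z|)) * B2 := by
          gcongr
          · exact hB1 z
          · exact hB2 z
      _ ≤ _ := by
          have t1 : 0 ≤ B2 * B * |pd o he z| := by positivity
          have t2 : 0 ≤ B1 * B * (1 + |he z|) := by positivity
          nlinarith
  have hcont : Continuous (pd o fun y => φ y * H (he y)) :=
    (hφ.toIsSmoothPeriodic.mul hcH).continuous_pd o
  have hpow : (1 : ℝ) ≤ ε ^ (s - 1) := Real.one_le_rpow_of_pos_of_le_one_of_nonpos hε0 hε1'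
    (by linarith)
  have hle : eLpNorm (pd o fun y => φ y * H (he y)) 3 μ
      ≤ ENNReal.ofReal ((B1 + B2) * B * (V + (M + N) + C * M) * ε ^ (s - 1)) := by
    have hm1 : AEStronglyMeasurable (fun z => |he z|) μ := hc.continuous.abs.aestronglyMeasurable
    have hm2 : AEStronglyMeasurable (fun z => |pd o he z|) μ :=
      (hc.continuous_pd o).abs.aestronglyMeasurable
    calc _ ≤ ENNReal.ofReal ((B1 + B2) * B) *
          eLpNorm (fun z => 1 + |he z| + |pd o he z|) 3 μ :=
          eLpNorm_le_mul_eLpNorm_of_ae_le_mul (Eventually.of_forall hpt) 3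
      _ ≤ ENNReal.ofReal ((B1 + B2) * B) * (ENNReal.ofReal V + ENNReal.ofReal (M + N)
          + ENNReal.ofReal (C * M * ε ^ (s - 1))) := by
          refine mul_le_mul_right ?_ _
          refine (eLpNorm_add_le (aestronglyMeasurable_const.add hm1) hm2 (by norm_num)).trans
            (add_le_add ((eLpNorm_add_le aestronglyMeasurable_const hm1 (by norm_num)).trans
              (add_le_add hVe.le ?_)) ?_)
          · simpa only [← Real.norm_eq_abs, eLpNorm_norm] using n1
          · simpa only [← Real.norm_eq_abs, eLpNorm_norm] using n2
      _ ≤ _ := by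
          have hV0 : 0 ≤ V := ENNReal.toReal_nonneg
          have hN0 : 0 ≤ N := ENNReal.toReal_nonneg
          rw [← ENNReal.ofReal_add hV0 (by positivity), ← ENNReal.ofReal_add (by positivity)
            (by positivity), ← ENNReal.ofReal_mul (by positivity)]
          refine ENNReal.ofReal_le_ofReal ?_
          rw [mul_assoc _ (V + (M + N) + C * M)]
          refine mul_le_mul_of_nonneg_left ?_ (by positivity)
          have : V + (M + N) ≤ (V + (M + N)) * ε ^ (s - 1) :=
            le_mul_of_one_le_right (by positivity) hpow
          linarith
  exact ⟨⟨hcont.aestronglyMeasurable, hle.trans_lt ENNReal.ofReal_lt_top⟩, hle⟩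

/-- The step where the Besov exponents enter: Hölder's inequality gives `L¹` size `ε^(s₁+s₂) ·
ε^(s₃-1)`, whose exponent is positive. -/
theorem lpTendsto_convCommutator_mul {C a b s₁ s₂ s₃ K : ℝ} (hs : 1 < s₁ + s₂ + s₃)
    {η : ℝ → SpaceTime d → ℝ}
    (hη : ∀ ε > 0, IsSmoothingKernel C ε (η ε)) {f g : SpaceTime d → ℝ} (hf : LocMemLp 3 f)
    (hg : LocMemLp 3 g) (hfg : LocallyIntegrable fun y => f y * g y)
    (hfs : ShiftBound a b s₁ f) (hgs : ShiftBound a b s₂ g) {Z : ℝ → SpaceTime d → ℝ}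
    (hZ : ∀ᶠ ε in nhdsWithin (0 : ℝ) (Ioi 0), MemLp (Z ε) 3 (windowMeasure d a b) ∧
      eLpNorm (Z ε) 3 (windowMeasure d a b) ≤ ENNReal.ofReal (K * ε ^ (s₃ - 1))) :
    LpTendsto (windowMeasure d a b) 1 (nhdsWithin (0 : ℝ) (Ioi 0))
      (fun ε z => convCommutator (η ε) f g z * Z ε z) fun _ => 0 := by
  obtain ⟨M₁, ε₁, hM₁, hε₁, hf'⟩ := hfs
  obtain ⟨M₂, ε₂, hM₂, hε₂, hg'⟩ := hgs
  have hfl := hf.locallyIntegrable (by norm_num)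
  have hgl := hg.locallyIntegrable (by norm_num)
  have hcomm : ∀ᶠ ε in nhdsWithin (0 : ℝ) (Ioi 0),
      MemLp (convCommutator (η ε) f g) (3 / 2) (windowMeasure d a b) ∧
      eLpNorm (convCommutator (η ε) f g) (3 / 2) (windowMeasure d a b)
        ≤ ENNReal.ofReal (2 * (M₁ * M₂) * ε ^ (s₁ + s₂)) := by
    filter_upwards [Ioo_mem_nhdsGT (lt_min hε₁ hε₂)] with ε hε
    have hk := hη ε hε.1
    have h1 := eLpNorm_convCommutator_le (p := 3) (q := 3) (r := 3 / 2) hk hfl hgl hfg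
      (by norm_num) (by norm_num) (by norm_num) (by norm_num) one_le_three_halves
      (ENNReal.div_ne_top (by norm_num) (by norm_num)) (windowMeasure_ac d a b)
      (hf' ε hε.1 (hε.2.trans_le (min_le_left _ _)).le)
      (hg' ε hε.1 (hε.2.trans_le (min_le_right _ _)).le)
    have hpos := hε.1
    have e : (2 : ℝ≥0∞) * (ENNReal.ofReal (M₁ * ε ^ s₁) * ENNReal.ofReal (M₂ * ε ^ s₂))
        = ENNReal.ofReal (2 * (M₁ * M₂) * ε ^ (s₁ + s₂)) := by
      rw [← ENNReal.ofReal_mul (by positivity), ← ENNReal.ofReal_ofNat 2,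
        ← ENNReal.ofReal_mul (by positivity), Real.rpow_add hpos]
      congr 1; ring
    rw [e] at h1
    have hm : Continuous (convCommutator (η ε) f g) :=
      (contDiff_kernelConv hk.contDiff hk.hasCompactSupport hfg).continuous.sub
        ((contDiff_kernelConv hk.contDiff hk.hasCompactSupport hfl).continuous.mul
          (contDiff_kernelConv hk.contDiff hk.hasCompactSupport hgl).continuous)
    exact ⟨⟨hm.aestronglyMeasurable, h1.trans_lt ENNReal.ofReal_lt_top⟩, h1⟩
  refine ⟨?_, MemLp.zero, ?_⟩
  · filter_upwards [hcomm, hZ] with ε h1 h2 using h2.1.mul' h1.1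
  · have hlim : Tendsto (fun ε : ℝ => ENNReal.ofReal (2 * (M₁ * M₂) * K * ε ^ (s₁ + s₂ + s₃ - 1)))
        (nhdsWithin 0 (Ioi 0)) (nhds 0) := by
      have h0 : 0 < s₁ + s₂ + s₃ - 1 := by linarith
      have h1 : Tendsto (fun ε : ℝ => ε ^ (s₁ + s₂ + s₃ - 1)) (nhdsWithin 0 (Ioi 0)) (nhds 0) := by
        have := (Real.continuousAt_rpow_const 0 (s₁ + s₂ + s₃ - 1) (Or.inr h0.le)).tendsto
        rw [Real.zero_rpow h0.ne'] at this
        exact this.mono_left nhdsWithin_le_nhds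
      have h2 := ENNReal.tendsto_ofReal (h1.const_mul (2 * (M₁ * M₂) * K))
      simpa using h2
    refine tendsto_of_tendsto_of_tendsto_of_le_of_le' tendsto_const_nhds hlim
      (Eventually.of_forall fun _ => zero_le) ?_
    filter_upwards [hcomm, hZ, self_mem_nhdsWithin] with ε h1 h2 hε
    simp only [sub_zero]
    refine (eLpNorm_mul_le (p := 3 / 2) (q := 3) h1.1.1 h2.1.1).trans
      ((mul_le_mul' h1.2 h2.2).trans (le_of_eq ?_))
    have hε' : (0 : ℝ) < ε := hε
    rw [← ENNReal.ofReal_mul (by positivity)]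
    congr 1
    have : ε ^ (s₁ + s₂ + s₃ - 1) = ε ^ (s₁ + s₂) * ε ^ (s₃ - 1) := by
      rw [← Real.rpow_add hε']; congr 1; ring
    rw [this]; ring

/-! ### Passage to the limit -/

/-- Integrable functions on `ℝ × 𝕋^d` which belong to `L^p`. -/
structure PerMemLp {d : ℕ} (p : ℝ≥0∞) (f : SpaceTime d → ℝ) : Prop where
  periodic : IsSpacePeriodic f
  memLp : MemLp f p (stripMeasure d)
  integrable : Integrable f (stripMeasure d)

section Limits

variable {d : ℕ} {a b a' b' : ℝ} {φ : SpaceTime d → ℝ}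

/-- `f` is integrable on `[a,b] × 𝕋^d` with vanishing integral. -/
def IsWindowNull (a b : ℝ) (f : SpaceTime d → ℝ) : Prop :=
  Integrable f (windowMeasure d a b) ∧ ∫ z, f z ∂(windowMeasure d a b) = 0

theorem PerMemLp.locMemLp {p : ℝ≥0∞} {f : SpaceTime d → ℝ} (hf : PerMemLp p f) (hp0 : p ≠ 0)
    (hp : p ≠ ⊤) : LocMemLp p f := fun _ hK => hf.periodic.memLp_isCompact hp0 hp hf.memLp hK

theorem PerMemLp.locallyIntegrable {p : ℝ≥0∞} {f : SpaceTime d → ℝ} (hf : PerMemLp p f) :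
    LocallyIntegrable f := hf.periodic.locallyIntegrable hf.integrable

theorem IsTestIn.mono {f : SpaceTime d → ℝ} (hf : IsTestIn a b f) (ha : a' ≤ a) (hb : b ≤ b') :
    IsTestIn a' b' f :=
  ⟨hf.toIsSmoothPeriodic, fun t x h => hf.support t x fun h' => h ⟨ha.trans h'.1, h'.2.trans hb⟩⟩

theorem WeakDiv.mono {F : Option (Fin d) → SpaceTime d → ℝ} {R : SpaceTime d → ℝ}
    (h : WeakDiv a' b' F R) (ha : a' ≤ a) (hb : b ≤ b') : WeakDiv a b F R :=
  fun φ hφ => h φ (hφ.mono ha hb)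

theorem kernelConv_zero (k : SpaceTime d → ℝ) : kernelConv k (fun _ => 0) = fun _ => 0 := by
  funext z; simp [kernelConv]

theorem kernelConv_neg (k f : SpaceTime d → ℝ) :
    kernelConv k (fun z => -f z) = fun z => -kernelConv k f z := by
  funext z; simp [kernelConv, integral_neg]

theorem kernelConv_add {C ε : ℝ} {k f g : SpaceTime d → ℝ} (hk : IsSmoothingKernel C ε k)
    (hf : LocallyIntegrable f) (hg : LocallyIntegrable g) :
    kernelConv k (fun z => f z + g z) = fun z => kernelConv k f z + kernelConv k g z := by
  funext z
  simp only [kernelConv, mul_add]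
  exact integral_add (integrable_kernel_mul hk.contDiff.continuous hk.hasCompactSupport hf z)
    (integrable_kernel_mul hk.contDiff.continuous hk.hasCompactSupport hg z)

theorem kernelConv_sub {C ε : ℝ} {k f g : SpaceTime d → ℝ} (hk : IsSmoothingKernel C ε k)
    (hf : LocallyIntegrable f) (hg : LocallyIntegrable g) :
    kernelConv k (fun z => f z - g z) = fun z => kernelConv k f z - kernelConv k g z := by
  funext z
  simp only [kernelConv, mul_sub]
  exact integral_sub (integrable_kernel_mul hk.contDiff.continuous hk.hasCompactSupport hf z)
    (integrable_kernel_mul hk.contDiff.continuous hk.hasCompactSupport hg z)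

theorem WeakPartial.kernelConv {C ε : ℝ} {k U G : SpaceTime d → ℝ} {j : Fin d}
    (hk : IsSmoothingKernel C ε k) (hU : IsSpacePeriodic U) (hUi : Integrable U (stripMeasure d))
    (hG : IsSpacePeriodic G) (hGi : Integrable G (stripMeasure d))
    (h : WeakPartial (a - ε) (b + ε) j U G) :
    WeakPartial a b j (kernelConv k U) (kernelConv k G) := by
  have h1 := WeakDiv.kernelConv (k := k) (C := C) hk (fun o => by
      by_cases ho : o = some j
      · simpa [ho] using hU
      · simpa [ho] using (isSmoothPeriodic_const (d := d) 0).periodic) (fun o => by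
      by_cases ho : o = some j
      · simpa [ho] using hUi
      · simp [ho]) (hG.map fun r => -r) hGi.neg h
  have e : (fun o : Option (Fin d) => _root_.kernelConv k fun z => if o = some j then U z else 0)
      = fun o z => if o = some j then _root_.kernelConv k U z else 0 := by
    funext o
    by_cases ho : o = some j
    · simp [ho]
    · simp [ho, kernelConv_zero]
  rw [e, kernelConv_neg] at h1
  exact h1

theorem WeakDiv.kernelConv_homogeneous {C ε : ℝ} {k : SpaceTime d → ℝ}
    (hk : IsSmoothingKernel C ε k) {F : Option (Fin d) → SpaceTime d → ℝ}
    (hF : ∀ o, IsSpacePeriodic (F o)) (hFi : ∀ o, Integrable (F o) (stripMeasure d))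
    (h : WeakDiv (a - ε) (b + ε) F fun _ => 0) :
    WeakDiv a b (fun o => _root_.kernelConv k (F o)) fun _ => 0 := by
  have h1 := WeakDiv.kernelConv hk hF hFi (isSmoothPeriodic_const 0).periodic
    (show Integrable (fun _ : SpaceTime d => (0 : ℝ)) (stripMeasure d) from integrable_zero _ _ _) h
  rwa [kernelConv_zero] at h1

/-- Linearity separates the mollified convective flux, pressure and stress, as the identity for
smooth fields requires. Only the convective part is a product whose factors are to be mollified
separately. -/
theorem WeakDiv.kernelConv_momentum {C ε : ℝ} {k : SpaceTime d → ℝ} (hk : IsSmoothingKernel C ε k)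
    {F : Option (Fin d) → SpaceTime d → ℝ} {P : SpaceTime d → ℝ} {S : Fin d → SpaceTime d → ℝ}
    {i : Fin d} (hF : ∀ o, IsSpacePeriodic (F o)) (hFi : ∀ o, Integrable (F o) (stripMeasure d))
    (hP : IsSpacePeriodic P) (hPi : Integrable P (stripMeasure d))
    (hS : ∀ j, IsSpacePeriodic (S j)) (hSi : ∀ j, Integrable (S j) (stripMeasure d))
    (h : WeakDiv (a - ε) (b + ε) (fun o z => F o z + o.elim 0
      fun j => (if j = i then P z else 0) - S j z) fun _ => 0) :
    WeakDiv a b (fun o z => _root_.kernelConv k (F o) z + o.elim 0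
      fun j => (if j = i then _root_.kernelConv k P z else 0) - _root_.kernelConv k (S j) z) fun _ => 0 := by
  have hl : ∀ o, LocallyIntegrable (F o) := fun o => (hF o).locallyIntegrable (hFi o)
  have hPl := hP.locallyIntegrable hPi
  have hSl : ∀ j, LocallyIntegrable (S j) := fun j => (hS j).locallyIntegrable (hSi j)
  have key := WeakDiv.kernelConv_homogeneous hk
    (F := fun o z => F o z + o.elim 0 fun j => (if j = i then P z else 0) - S j z)
    (fun o => by
      rcases o with _ | j
      · simpa using hF none
      · by_cases hj : j = i
        · simpa [hj] using (hF (some i)).map₂ (hP.map₂ (hS i) fun r s => r - s) fun r s => r + s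
        · simpa [hj] using (hF (some j)).map₂ ((hS j).map fun r => -r) fun r s => r + s)
    (fun o => by
      rcases o with _ | j
      · simpa using hFi none
      · by_cases hj : j = i
        · subst hj
          simpa only [Option.elim, if_true] using! (hFi (some j)).add (hPi.sub (hSi j))
        · simpa only [Option.elim, hj, if_false, zero_sub] using! (hFi (some j)).add (hSi j).neg) h
  convert key using 2 with o
  rcases o with _ | j
  · simp
  · by_cases hj : j = i
    · subst hj
      simp only [Option.elim, if_true]
      rw [kernelConv_add (g := fun z => P z - S j z) hk (hl _) (hPl.sub (hSl j)),
        kernelConv_sub hk hPl (hSl j)]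
    · simp only [Option.elim, hj, if_false, zero_sub]
      rw [kernelConv_add (g := fun z => -S j z) hk (hl _) (hSl j).neg, kernelConv_neg]

theorem LpTendsto.const_mul {α ι : Type*} [MeasurableSpace α] {μ : Measure α} {p : ℝ≥0∞}
    {l : Filter ι} {F : ι → α → ℝ} {f : α → ℝ} (c : ℝ) (hF : LpTendsto μ p l F f) :
    LpTendsto μ p l (fun i z => c * F i z) fun z => c * f z := by
  simpa only [mul_comm c] using hF.mul_bounded (ψ := fun _ => c) (B := |c|)
    aestronglyMeasurable_const fun _ => le_rfl

instance : ENNReal.HolderTriple 3 (3 / 2) 1 := ENNReal.HolderTriple.symm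

theorem LpTendsto.mul_windowed {ι : Type*} {p : ℝ≥0∞} {l : Filter ι} {μ : Measure (SpaceTime d)}
    {F : ι → SpaceTime d → ℝ} {f ψ : SpaceTime d → ℝ} (hF : LpTendsto μ p l F f)
    (hψ : IsWindowed a b ψ) : LpTendsto μ p l (fun i z => F i z * ψ z) fun z => f z * ψ z := by
  obtain ⟨B, -, hB⟩ := hψ.exists_bound
  exact hF.mul_bounded hψ.continuous.aestronglyMeasurable hB

/-- The kinetic energy balance for rough fields. -/
theorem isWindowNull_kinetic {α β : ℝ} (hα : α ∈ Icc (0 : ℝ) 1) (hαβ : 1 < 2 * α + β)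
    (ha : a' < a) (hb : b < b') {M : Option (Fin d) → SpaceTime d → ℝ}
    {U : Fin d → SpaceTime d → ℝ} {S G : Fin d → Fin d → SpaceTime d → ℝ} {P : SpaceTime d → ℝ}
    (hM : ∀ o, PerMemLp 3 (M o)) (hMs : ∀ o, ShiftBound a b β (M o))
    (hU : ∀ i, PerMemLp 3 (U i)) (hUs : ∀ i, ShiftBound a b α (U i)) (hP : PerMemLp 2 P)
    (hS : ∀ i j, PerMemLp 2 (S i j)) (hG : ∀ i j, PerMemLp 2 (G i j))
    (hMU : ∀ i o, Integrable (fun z => M o z * U i z) (stripMeasure d))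
    (hcont : WeakDiv a' b' M fun _ => 0)
    (hmom : ∀ i, WeakDiv a' b' (fun o z => M o z * U i z + o.elim 0
      fun j => (if j = i then P z else 0) - S i j z) fun _ => 0)
    (hgrad : ∀ i j, WeakPartial a' b' j (U i) (G i j)) (hφ : IsTestIn a b φ) :
    IsWindowNull a b fun z => ∑ o, M o z * (1 / 2 * ∑ i, U i z * U i z) * pd o φ z
        + ∑ j, P z * U j z * pd (some j) φ z + ∑ j, P z * G j j z * φ z
        - ∑ i, ∑ j, S i j z * U i z * pd (some j) φ z - ∑ i, ∑ j, S i j z * G i j z * φ z := by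
  obtain ⟨C, hC, hex⟩ := exists_isSmoothingKernel d
  choose! η hη using hex
  have hMl : ∀ o, LocMemLp 3 (M o) := fun o => (hM o).locMemLp (by norm_num) (by norm_num)
  have hUl : ∀ i, LocMemLp 3 (U i) := fun i => (hU i).locMemLp (by norm_num) (by norm_num)
  have hMUl : ∀ i o, LocallyIntegrable fun z => M o z * U i z := fun i o =>
    ((hM o).periodic.map₂ (hU i).periodic fun r s => r * s).locallyIntegrable (hMU i o)
  have h22 : (2 : ℝ≥0∞) ≤ 3 := by norm_num
  have lM := fun o => lpTendsto_kernelConv hη (by norm_num) (by norm_num) (hMl o) a b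
  have lU := fun i => lpTendsto_kernelConv hη (by norm_num) (by norm_num) (hUl i) a b
  have lU2 := fun i => (lU i).mono_exponent h22
  have l2 : ∀ {f}, PerMemLp 2 f → LpTendsto (windowMeasure d a b) 2 (nhdsWithin 0 (Ioi 0))
      (fun ε => kernelConv (η ε) f) f := fun {f} hf => lpTendsto_kernelConv hη (by norm_num)
        (by norm_num) (hf.locMemLp (by norm_num) (by norm_num)) a b
  -- The cubic term `M |U|²` converges as `L³` times `L^{3/2}`; the pressure and stress terms below
  -- converge as products of two `L²` factors.
  have t1 := LpTendsto.sum le_rfl Finset.univ fun o =>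
    ((lM o).mul (r := 1) one_le_three_halves le_rfl ((LpTendsto.sum (p := 3 / 2)
      one_le_three_halves Finset.univ fun i => (lU i).mul (q := 3) (by norm_num) one_le_three_halves
        (lU i)).const_mul (1 / 2))).mul_windowed (hφ.pd_windowed o)
  have t2 := LpTendsto.sum le_rfl Finset.univ fun j =>
    ((l2 hP).mul (r := 1) (by norm_num) le_rfl (lU2 j)).mul_windowed (hφ.pd_windowed (some j))
  have t3 := LpTendsto.sum le_rfl Finset.univ fun j =>
    ((l2 hP).mul (r := 1) (by norm_num) le_rfl (l2 (hG j j))).mul_windowed hφ.isWindowed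
  have t4 := LpTendsto.sum le_rfl Finset.univ fun i => LpTendsto.sum le_rfl Finset.univ fun j =>
    ((l2 (hS i j)).mul (r := 1) (by norm_num) le_rfl (lU2 i)).mul_windowed
      (hφ.pd_windowed (some j))
  have t5 := LpTendsto.sum le_rfl Finset.univ fun i => LpTendsto.sum le_rfl Finset.univ fun j =>
    ((l2 (hS i j)).mul (r := 1) (by norm_num) le_rfl (l2 (hG i j))).mul_windowed hφ.isWindowed
  -- The commutator of `M o` and `U i` is paired with `∂(φ U_i^ε)`: orders `β`, `α`, `α`.
  have t6 := LpTendsto.sum le_rfl Finset.univ fun i => LpTendsto.sum le_rfl Finset.univ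
    fun o => by
      obtain ⟨K, hK, hKe⟩ := exists_eLpNorm_pd_comp_le hC hα.1 hα.2 hη (hUl i) (hU i).periodic
        (hUs i) hφ contDiff_id zero_le_one (fun ε _ z => ⟨by simp, by simp⟩) o
      exact lpTendsto_convCommutator_mul (by linarith) hη (hMl o) (hUl i) (hMUl i o) (hMs o)
        (hUs i) hKe
  have L := (((((t1.add le_rfl t2).add le_rfl t3).sub le_rfl t4).sub le_rfl t5).add le_rfl
    t6)
  simp only [Finset.sum_const_zero, add_zero] at L
  refine ⟨memLp_one_iff_integrable.1 L.memLp, ?_⟩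
  have lim := L.tendsto_integral
  refine tendsto_nhds_unique lim (Tendsto.congr' ?_ tendsto_const_nhds)
  -- Below both margins the equations hold on `[a - ε, b + ε]`, so the mollified ones hold on `[a,
  -- b]` and the approximating integral is exactly zero.
  filter_upwards [Ioo_mem_nhdsGT (lt_min (sub_pos.2 ha) (sub_pos.2 hb))] with ε hε
  have hk := hη ε hε.1
  have ha' : a' ≤ a - ε := by linarith [hε.2.trans_le (min_le_left _ _)]
  have hb' : b + ε ≤ b' := by linarith [hε.2.trans_le (min_le_right _ _)]
  have sm : ∀ {f : SpaceTime d → ℝ}, LocallyIntegrable f → IsSpacePeriodic f →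
      IsSmoothPeriodic (kernelConv (η ε) f) := fun hf hp => isSmoothPeriodic_kernelConv hk hf hp
  have hMUp : ∀ i o, IsSpacePeriodic fun z => M o z * U i z := fun i o =>
    (hM o).periodic.map₂ (hU i).periodic fun r s => r * s
  have sU := fun i => sm (hU i).locallyIntegrable (hU i).periodic
  have c1 := WeakDiv.kernelConv_homogeneous hk (fun o => (hM o).periodic)
    (fun o => (hM o).integrable) (hcont.mono ha' hb')
  have null := isNull_kinetic (fun o => sm (hM o).locallyIntegrable (hM o).periodic)
    sU (fun i o => sm (hMUl i o) (hMUp i o))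
    (fun i j => sm (hS i j).locallyIntegrable (hS i j).periodic)
    (fun i j => sm (hG i j).locallyIntegrable (hG i j).periodic)
    (sm hP.locallyIntegrable hP.periodic) c1
    (fun i => WeakDiv.kernelConv_momentum hk (hMUp i) (hMU i) hP.periodic hP.integrable
      (fun j => (hS i j).periodic) (fun j => (hS i j).integrable) ((hmom i).mono ha' hb'))
    (fun i j => WeakPartial.kernelConv hk (hU i).periodic (hU i).integrable (hG i j).periodic
      (hG i j).integrable (WeakDiv.mono (hgrad i j) ha' hb')) hφ
  rw [← null.2, integral_strip_eq_window (a := a) (b := b)]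
  · rfl
  · intro t x h
    simp [hφ.support t x h, (hφ.pd_windowed _).support t x h,
      ((hφ.mul_smooth (sU _)).pd_windowed _).support t x h]

/-- Averages against a probability density stay in the interval. Hence bounds for `h` and its
derivatives are needed on `[0, m]` only. -/
theorem kernelConv_mem_Icc {C ε m : ℝ} {k f : SpaceTime d → ℝ} (hk : IsSmoothingKernel C ε k)
    (hf : LocallyIntegrable f) (hfm : ∀ᵐ z, f z ∈ Icc 0 m) (z : SpaceTime d) :
    kernelConv k f z ∈ Icc 0 m := by
  have hi := integrable_kernel_mul hk.contDiff.continuous hk.hasCompactSupport hf z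
  have hae : ∀ᵐ w, f (z - w) ∈ Icc 0 m :=
    (Measure.measurePreserving_sub_left (volume : Measure (SpaceTime d)) z).quasiMeasurePreserving.ae hfm
  refine ⟨integral_nonneg_of_ae (hae.mono fun w hw => mul_nonneg (hk.nonneg w) hw.1), ?_⟩
  calc kernelConv k f z ≤ ∫ w, k w * m := integral_mono_ae hi (hk.integrable.mul_const m)
        (hae.mono fun w hw => mul_le_mul_of_nonneg_left hw.2 (hk.nonneg w))
    _ = m := by rw [integral_mul_const, hk.integral_eq_one, one_mul]

/-- Renormalization of the continuity equation for rough fields. -/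
theorem isWindowNull_renormalized {α β m : ℝ} (hβ : β ∈ Icc (0 : ℝ) 1)
    (hαβ : 1 < α + 2 * β) (ha : a' < a) (hb : b < b')
    {M : Option (Fin d) → SpaceTime d → ℝ} {U : Fin d → SpaceTime d → ℝ}
    {G : Fin d → Fin d → SpaceTime d → ℝ}
    (hM : ∀ o, PerMemLp 3 (M o)) (hMs : ShiftBound a b β (M none))
    (hMm : ∀ᵐ z, M none z ∈ Icc 0 m) (hMU : ∀ j, M (some j) = fun z => M none z * U j z)
    (hU : ∀ i, PerMemLp 3 (U i)) (hUs : ∀ i, ShiftBound a b α (U i))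
    (hG : ∀ i j, PerMemLp 2 (G i j)) (hcont : WeakDiv a' b' M fun _ => 0)
    (hgrad : ∀ i j, WeakPartial a' b' j (U i) (G i j)) (hφ : IsTestIn a b φ) {h : ℝ → ℝ}
    (hh : ContDiff ℝ ∞ h) :
    IsWindowNull a b fun z => h (M none z) * pd none φ z
        + ∑ j, h (M none z) * U j z * pd (some j) φ z
        - ∑ j, (M none z * deriv h (M none z) - h (M none z)) * G j j z * φ z := by
  obtain ⟨C, hC, hex⟩ := exists_isSmoothingKernel d
  choose! η hη using hex
  have hMl : ∀ o, LocMemLp 3 (M o) := fun o => (hM o).locMemLp (by norm_num) (by norm_num)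
  have hUl : ∀ i, LocMemLp 3 (U i) := fun i => (hU i).locMemLp (by norm_num) (by norm_num)
  have hh' : ContDiff ℝ ∞ (deriv h) := hh.iterate_deriv 1
  have hq : ContDiff ℝ ∞ fun r => r * deriv h r - h r := (contDiff_id.mul hh').sub hh
  have h22 : (2 : ℝ≥0∞) ≤ 3 := by norm_num
  have lM := (lpTendsto_kernelConv hη (by norm_num) (by norm_num) (hMl none) a b).mono_exponent h22
  have lU2 := fun i => (lpTendsto_kernelConv hη (by norm_num) (by norm_num) (hUl i) a
    b).mono_exponent h22
  have lG : ∀ i j, LpTendsto (windowMeasure d a b) 2 (nhdsWithin 0 (Ioi 0))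
      (fun ε => kernelConv (η ε) (G i j)) (G i j) := fun i j => lpTendsto_kernelConv hη
        (by norm_num) (by norm_num) ((hG i j).locMemLp (by norm_num) (by norm_num)) a b
  have hrange : ∀ ε > 0, ∀ z, kernelConv (η ε) (M none) z ∈ Icc 0 m := fun ε hε z =>
    kernelConv_mem_Icc (hη ε hε) (hM none).locallyIntegrable hMm z
  have hrange' : ∀ᶠ ε in nhdsWithin (0 : ℝ) (Ioi 0), ∀ z,
      kernelConv (η ε) (M none) z ∈ Icc 0 m := by
    filter_upwards [self_mem_nhdsWithin] with ε hε using hrange ε hε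
  have hMm' : ∀ᵐ z ∂(windowMeasure d a b), M none z ∈ Icc 0 m := (windowMeasure_ac d a b).ae_le hMm
  have lh := lM.comp_contDiff (hh.of_le (by simp)) hrange' hMm'
  have lq := lM.comp_contDiff (hq.of_le (by simp)) hrange' hMm'
  obtain ⟨B, hB0, hB1, hB2⟩ : ∃ B : ℝ, 0 ≤ B ∧ (∀ r ∈ Icc 0 m, |deriv h r| ≤ B) ∧
      ∀ r ∈ Icc 0 m, |deriv (deriv h) r| ≤ B := by
    obtain ⟨B1, hB1⟩ := (isCompact_Icc (a := (0 : ℝ)) (b := m)).exists_bound_of_continuousOn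
      hh'.continuous.continuousOn
    obtain ⟨B2, hB2⟩ := (isCompact_Icc (a := (0 : ℝ)) (b := m)).exists_bound_of_continuousOn
      (hh'.continuous_deriv (by simp)).continuousOn
    exact ⟨max 0 (max B1 B2), le_max_left _ _, fun r hr => (hB1 r hr).trans
      ((le_max_left _ _).trans (le_max_right _ _)), fun r hr => (hB2 r hr).trans
      ((le_max_right _ _).trans (le_max_right _ _))⟩
  have t1 := (lh.mono_exponent (p := 1) (by norm_num)).mul_windowed (hφ.pd_windowed none)
  have t2 := LpTendsto.sum le_rfl Finset.univ fun j =>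
    (lh.mul (r := 1) (by norm_num) le_rfl (lU2 j)).mul_windowed (hφ.pd_windowed (some j))
  have t3 := LpTendsto.sum le_rfl Finset.univ fun j =>
    (lq.mul (r := 1) (by norm_num) le_rfl (lG j j)).mul_windowed hφ.isWindowed
  have hMUl : ∀ j, LocallyIntegrable fun z => M none z * U j z := fun j => by
    rw [← hMU j]; exact (hM (some j)).locallyIntegrable
  -- The commutator of `ρ` and `u_j` is paired with `∂_j(φ h'(ρ^ε))`: orders `β`, `α`, `β`.
  have t4 := LpTendsto.sum le_rfl Finset.univ fun j => by
      obtain ⟨K, hK, hKe⟩ := exists_eLpNorm_pd_comp_le hC hβ.1 hβ.2 hη (hMl none)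
        (hM none).periodic hMs hφ hh' hB0 (fun ε hε z => ⟨(hB1 _ (hrange ε hε z)).trans
          (le_mul_of_one_le_right hB0 (by simp)), hB2 _ (hrange ε hε z)⟩) (some j)
      exact lpTendsto_convCommutator_mul (by linarith) hη (hMl none) (hUl j) (hMUl j) hMs
        (hUs j) hKe
  have L := (((t1.add le_rfl t2).sub le_rfl t3).add le_rfl t4)
  simp only [Finset.sum_const_zero, add_zero] at L
  refine ⟨memLp_one_iff_integrable.1 L.memLp, ?_⟩
  have lim := L.tendsto_integral
  refine tendsto_nhds_unique lim (Tendsto.congr' ?_ tendsto_const_nhds)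
  filter_upwards [Ioo_mem_nhdsGT (lt_min (sub_pos.2 ha) (sub_pos.2 hb))] with ε hε
  have hk := hη ε hε.1
  have ha' : a' ≤ a - ε := by linarith [hε.2.trans_le (min_le_left _ _)]
  have hb' : b + ε ≤ b' := by linarith [hε.2.trans_le (min_le_right _ _)]
  have sm : ∀ {f : SpaceTime d → ℝ}, LocallyIntegrable f → IsSpacePeriodic f →
      IsSmoothPeriodic (kernelConv (η ε) f) := fun hf hp => isSmoothPeriodic_kernelConv hk hf hp
  have sM := fun o => sm (hM o).locallyIntegrable (hM o).periodic
  have c1 := WeakDiv.kernelConv_homogeneous hk (fun o => (hM o).periodic)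
    (fun o => (hM o).integrable) (hcont.mono ha' hb')
  have null := isNull_renormalized sM
    (fun i => sm (hU i).locallyIntegrable (hU i).periodic)
    (fun i j => sm (hG i j).locallyIntegrable (hG i j).periodic) c1
    (fun i j => WeakPartial.kernelConv hk (hU i).periodic (hU i).integrable (hG i j).periodic
      (hG i j).integrable (WeakDiv.mono (hgrad i j) ha' hb')) hφ hh
  rw [← null.2, integral_strip_eq_window (a := a) (b := b)]
  · simp only [convCommutator, ← hMU]
  · intro t x h
    simp [hφ.support t x h, (hφ.pd_windowed _).support t x h,
      ((hφ.mul_smooth ((sM none).comp hh')).pd_windowed _).support t x h]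

end Limits

/-! ### Approximation of the pressure potential -/

/-- The operator `h ↦ r h' - h` multiplies `r^n` by `n - 1`. Even powers avoid the resonance `n =
1`, whose solution `r log r` is not smooth at the vacuum, so `r^(2k)` is the image of
`r^(2k)/(2k-1)`. -/
theorem exists_contDiff_mul_deriv_sub_eq (f : Polynomial ℝ) : ∃ h : ℝ → ℝ, ContDiff ℝ ∞ h ∧
    ∀ r, r * deriv h r - h r = f.eval (r ^ 2) := by
  induction f using Polynomial.induction_on' with
  | add f g hf hg =>
    obtain ⟨h₁, hs₁, he₁⟩ := hf
    obtain ⟨h₂, hs₂, he₂⟩ := hg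
    refine ⟨fun r => h₁ r + h₂ r, hs₁.add hs₂, fun r => ?_⟩
    rw [deriv_fun_add (hs₁.differentiable (by simp) r) (hs₂.differentiable (by simp) r),
      Polynomial.eval_add, ← he₁, ← he₂]
    ring
  | monomial k c =>
    have hk : (2 * (k : ℝ) - 1) ≠ 0 := by
      intro h
      have h2 : (2 * k : ℝ) = 1 := by linarith
      have : 2 * k = 1 := by exact_mod_cast h2
      omega
    refine ⟨fun r => c / (2 * k - 1) * r ^ (2 * k), by fun_prop, fun r => ?_⟩
    have hd : HasDerivAt (fun r : ℝ => c / (2 * k - 1) * r ^ (2 * k))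
        (c / (2 * k - 1) * (((2 * k : ℕ) : ℝ) * r ^ (2 * k - 1))) r :=
      (hasDerivAt_pow (2 * k) r).const_mul _
    rw [hd.deriv, Polynomial.eval_monomial, ← pow_mul]
    rcases Nat.eq_zero_or_pos k with rfl | hk0
    · simp [div_neg]
    · have hp : r ^ (2 * k) = r * r ^ (2 * k - 1) := by
        rw [← pow_succ']; congr 1; omega
      rw [hp]
      push_cast
      field_simp
      rw [hp]
      ring

/-- Approximating `p(√x)` by a polynomial makes `p` close to a polynomial in `r²`, for which `r h' -
h` can be inverted smoothly. The error survives the inversion: `(h/r)' = (r h' - h)/r²`, so with `h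
= P` at `ρmax` one has `|h - P| ≤ r ∫_r^{ρmax} δ/s² ds ≤ δ`, uniformly down to `r = 0`. -/
theorem exists_potential_approx {ρmin ρmax : ℝ} (hρmin : 0 ≤ ρmin) {p : ℝ → ℝ}
    (hp : ContinuousOn p (Icc ρmin ρmax))
    (hP : ∀ r ∈ Icc ρmin ρmax, 0 < r → IntervalIntegrable (fun s => p s / s ^ 2) volume 1 r)
    {δ : ℝ} (hδ : 0 < δ) : ∃ h : ℝ → ℝ, ContDiff ℝ ∞ h ∧ ∀ r ∈ Icc ρmin ρmax,
      |h r - pressurePotential p r| ≤ δ ∧ |r * deriv h r - h r - p r| ≤ δ := by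
  by_cases hle : ρmin ≤ ρmax
  swap
  · exact ⟨fun _ => 0, contDiff_const, fun r hr => absurd (hr.1.trans hr.2) hle⟩
  have hR0 : 0 ≤ ρmax := hρmin.trans hle
  have hsq : ContinuousOn (fun x => p (Real.sqrt x)) (Icc (ρmin ^ 2) (ρmax ^ 2)) :=
    hp.comp Real.continuous_sqrt.continuousOn fun x hx =>
      ⟨Real.le_sqrt_of_sq_le hx.1, Real.sqrt_le_iff.2 ⟨hR0, hx.2⟩⟩
  obtain ⟨f, hf⟩ := exists_polynomial_near_of_continuousOn _ _ _ hsq δ hδ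
  obtain ⟨h₀, hs₀, he₀⟩ := exists_contDiff_mul_deriv_sub_eq f
  have hq : ∀ r ∈ Icc ρmin ρmax, |f.eval (r ^ 2) - p r| ≤ δ := by
    intro r hr
    have hr0 := hρmin.trans hr.1
    have := hf (r ^ 2) ⟨pow_le_pow_left₀ hρmin hr.1 2, pow_le_pow_left₀ hr0 hr.2 2⟩
    rw [Real.sqrt_sq hr0] at this
    exact this.le
  -- The multiples of `r` are annihilated by `r h' - h`, so this slope can be chosen to match `P` at
  -- `ρmax`. If `ρmax = 0`, only `r = 0` occurs, and there the slope plays no role.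
  set c := (pressurePotential p ρmax - h₀ ρmax) / ρmax with hc
  set h : ℝ → ℝ := fun r => h₀ r + c * r with hh
  have hs : ContDiff ℝ ∞ h := hs₀.add (contDiff_const.mul contDiff_id)
  have he : ∀ r, r * deriv h r - h r = f.eval (r ^ 2) := by
    intro r
    have hd : HasDerivAt h (deriv h₀ r + c * 1) r :=
      (hs₀.differentiable (by simp) r).hasDerivAt.add ((hasDerivAt_id r).const_mul c)
    rw [hd.deriv, ← he₀]
    simp only [hh]
    ring
  refine ⟨h, hs, fun r hr => ⟨?_, by rw [he]; exact hq r hr⟩⟩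
  -- At the vacuum `r h' - h` reduces to `-h(0)`, and `P(0) = -p(0)`, so the estimate for `p` is
  -- already the one for `P`.
  rcases (hρmin.trans hr.1).eq_or_lt with rfl | hr0
  · have h1 := he 0
    have h2 := hq 0 hr
    rw [zero_mul, zero_sub] at h1
    rw [← h1] at h2
    rw [pressurePotential, if_pos rfl, abs_sub_comm]
    convert h2 using 2
    ring
  have hRpos : 0 < ρmax := hr0.trans_le hr.2
  have hpos : ∀ s ∈ uIcc r ρmax, 0 < s := fun s hs => by
    rw [uIcc_of_le hr.2] at hs; exact hr0.trans_le hs.1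
  have hhR : h ρmax = pressurePotential p ρmax := by
    simp only [hh, hc]; field_simp; ring
  have i1 : IntervalIntegrable (fun s => f.eval (s ^ 2) / s ^ 2) volume r ρmax :=
    ContinuousOn.intervalIntegrable (ContinuousOn.div (by fun_prop) (by fun_prop)
      fun s hs => (pow_pos (hpos s hs) 2).ne')
  have hPr := hP r hr hr0
  have hPR := hP ρmax ⟨hle, le_rfl⟩ hRpos
  have i2 : IntervalIntegrable (fun s => p s / s ^ 2) volume r ρmax := hPr.symm.trans hPR
  have e1 : ∫ s in r..ρmax, f.eval (s ^ 2) / s ^ 2 = h ρmax / ρmax - h r / r := by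
    refine intervalIntegral.integral_eq_sub_of_hasDerivAt (f := fun s => h s / s)
      (fun s hs' => ?_) i1
    have hd : HasDerivAt (fun s => h s / s) ((deriv h s * s - h s * 1) / s ^ 2) s :=
      (hs.differentiable (by simp) s).hasDerivAt.div (hasDerivAt_id s) (hpos s hs').ne'
    rwa [mul_one, mul_comm, he] at hd
  have e2 : ∫ s in r..ρmax, p s / s ^ 2
      = pressurePotential p ρmax / ρmax - pressurePotential p r / r := by
    rw [← intervalIntegral.integral_interval_sub_left hPR hPr, pressurePotential,
      pressurePotential, if_neg hRpos.ne', if_neg hr0.ne']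
    field_simp
  have e3 : ∫ s in r..ρmax, δ / s ^ 2 = δ / r - δ / ρmax := by
    have hd : ∀ s ∈ uIcc r ρmax, HasDerivAt (fun s => -(δ / s)) (δ / s ^ 2) s := fun s hs' => by
      have hd : HasDerivAt (fun s => -(δ / s)) (-((0 * s - δ * 1) / s ^ 2)) s :=
        ((hasDerivAt_const s δ).div (hasDerivAt_id s) (hpos s hs').ne').neg
      rwa [zero_mul, zero_sub, mul_one, neg_div, neg_neg] at hd
    rw [intervalIntegral.integral_eq_sub_of_hasDerivAt hd]
    · ring
    · exact ContinuousOn.intervalIntegrable (ContinuousOn.div (by fun_prop) (by fun_prop)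
        fun s hs => (pow_pos (hpos s hs) 2).ne')
  have key : ‖∫ s in r..ρmax, (f.eval (s ^ 2) / s ^ 2 - p s / s ^ 2)‖
      ≤ ∫ s in r..ρmax, δ / s ^ 2 := by
    refine intervalIntegral.norm_integral_le_of_norm_le hr.2 (Eventually.of_forall fun s hs' => ?_) ?_
    · rw [← sub_div, norm_div, Real.norm_of_nonneg (sq_nonneg s)]
      exact div_le_div_of_nonneg_right (hq s ⟨hr.1.trans hs'.1.le, hs'.2⟩) (sq_nonneg s)
    · exact ContinuousOn.intervalIntegrable (ContinuousOn.div (by fun_prop) (by fun_prop)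
        fun s hs => (pow_pos (hpos s hs) 2).ne')
  rw [intervalIntegral.integral_sub i1 i2, e1, e2, e3, hhR, Real.norm_eq_abs] at key
  have e4 : h r - pressurePotential p r = -(r * (pressurePotential p ρmax / ρmax - h r / r
      - (pressurePotential p ρmax / ρmax - pressurePotential p r / r))) := by
    field_simp; ring
  rw [e4, abs_neg, abs_mul, abs_of_pos hr0]
  calc _ ≤ r * (δ / r - δ / ρmax) := mul_le_mul_of_nonneg_left key hr0.le
    _ = δ - r * (δ / ρmax) := by field_simp
    _ ≤ δ := by have : 0 ≤ r * (δ / ρmax) := by positivity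
                linarith

/-! ### Extension by zero in time -/

variable {d : ℕ}

/-- Extension of `f` by zero for times outside `(0,T)`. -/
def timeCut (T : ℝ) (f : SpaceTime d → ℝ) : SpaceTime d → ℝ :=
  {z : SpaceTime d | z.1 ∈ Ioo 0 T}.indicator f

theorem timeCut_apply {T : ℝ} {f : SpaceTime d → ℝ} {z : SpaceTime d} (hz : z.1 ∈ Ioo 0 T) :
    timeCut T f z = f z := indicator_of_mem (by exact hz) f

theorem timeCut_of_notMem {T : ℝ} {f : SpaceTime d → ℝ} {z : SpaceTime d} (hz : z.1 ∉ Ioo 0 T) :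
    timeCut T f z = 0 := indicator_of_notMem (by exact hz) f

theorem slabMeasure_eq_restrict (d : ℕ) (T : ℝ) :
    slabMeasure d T = (stripMeasure d).restrict {z : SpaceTime d | z.1 ∈ Ioo 0 T} := by
  rw [stripMeasure, Measure.restrict_restrict (measurableSet_timeWindow d measurableSet_Ioo),
    slabMeasure]
  congr 1
  ext z
  simp [shiftStrip]

theorem windowMeasure_le_slabMeasure {a b T : ℝ} (ha : 0 < a) (hb : b < T) :
    windowMeasure d a b ≤ slabMeasure d T :=
  Measure.restrict_mono (Set.prod_mono (Icc_subset_Ioo ha hb) le_rfl) le_rfl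

instance (d : ℕ) (T : ℝ) : IsFiniteMeasure (slabMeasure d T) :=
  isFiniteMeasure_of_le (windowMeasure d 0 T)
    (Measure.restrict_mono (Set.prod_mono Ioo_subset_Icc_self le_rfl) le_rfl)

theorem integral_timeCut (T : ℝ) (f : SpaceTime d → ℝ) :
    ∫ z, timeCut T f z ∂(stripMeasure d) = ∫ z, f z ∂(slabMeasure d T) := by
  rw [slabMeasure_eq_restrict]
  exact integral_indicator (measurableSet_timeWindow d measurableSet_Ioo)

theorem isSpacePeriodic_timeCut {T : ℝ} {f : SpaceTime d → ℝ} (hf : IsSpacePeriodic f) :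
    IsSpacePeriodic (timeCut T f) := by
  intro t k x
  by_cases ht : t ∈ Ioo 0 T
  · simpa [timeCut_apply (z := (t, _)) ht] using hf t k x
  · simp [timeCut_of_notMem (z := (t, _)) ht]

theorem integrable_timeCut {T : ℝ} {f : SpaceTime d → ℝ} (hf : Integrable f (slabMeasure d T)) :
    Integrable (timeCut T f) (stripMeasure d) := by
  rw [slabMeasure_eq_restrict] at hf
  exact (integrable_indicator_iff (measurableSet_timeWindow d measurableSet_Ioo)).2 hf

theorem perMemLp_timeCut {T : ℝ} {p : ℝ≥0∞} (hp : 1 ≤ p) {f : SpaceTime d → ℝ}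
    (hfp : IsSpacePeriodic f) (hf : MemLp f p (slabMeasure d T)) : PerMemLp p (timeCut T f) := by
  refine ⟨isSpacePeriodic_timeCut hfp, ?_, integrable_timeCut (hf.integrable hp)⟩
  rw [slabMeasure_eq_restrict] at hf
  exact (memLp_indicator_iff_restrict (measurableSet_timeWindow d measurableSet_Ioo)).2 hf

/-- The exceptional set is invariant under the lattice and null in one cell, hence null. The
interval starts at `0` so that it also contains the values of the extension by zero. -/
theorem ae_timeCut_mem_Icc {T m : ℝ} (hm : 0 ≤ m) {f : SpaceTime d → ℝ} (hfp : IsSpacePeriodic f)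
    (hf : ∀ᵐ z ∂(slabMeasure d T), f z ∈ Icc 0 m) :
    ∀ᵐ z : SpaceTime d, timeCut T f z ∈ Icc 0 m := by
  refine (isAddFundamentalDomain_shiftStrip (0 : Space d)).measure_zero_of_invariant
    {z | timeCut T f z ∈ Icc 0 m}ᶜ (fun g => ?_) ?_
  · ext z
    rw [mem_vadd_set_iff_neg_vadd_mem]
    simp only [mem_compl_iff, mem_ofPred_eq, (isSpacePeriodic_timeCut hfp).vadd_eq]
  · rw [slabMeasure_eq_restrict, ae_restrict_iff' (measurableSet_timeWindow d
      measurableSet_Ioo)] at hf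
    have h2 : ∀ᵐ z ∂(stripMeasure d), timeCut T f z ∈ Icc 0 m := by
      filter_upwards [hf] with z hz
      by_cases ht : z.1 ∈ Ioo 0 T
      · rw [timeCut_apply ht]; exact hz ht
      · rw [timeCut_of_notMem ht]; exact ⟨le_rfl, hm⟩
    rw [← Measure.restrict_apply' (measurableSet_shiftStrip 0)]
    exact h2

theorem MemBesov.shiftBound_timeCut {F : Type*} [NormedAddCommGroup F] {T s a b : ℝ}
    {f : SpaceTime d → F} (hs : 0 ≤ s) (hf : MemBesov 3 s T f) (ha : 0 < a) (hb : b < T)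
    {c : F → ℝ} (hc : ∀ x y, |c x - c y| ≤ ‖x - y‖) :
    ShiftBound a b s (timeCut T fun z => c (f z)) := by
  obtain ⟨C, hC⟩ := hf.shift_bound
  -- Shifts this small keep times from `[a, b]` inside `(0, T)`, so the cut-off is not seen. The
  -- factor `2^s` compares the Euclidean length of the shift with the maximum norm on the product.
  refine ⟨C * 2 ^ s, min a (T - b) / 2, by positivity,
    half_pos (lt_min ha (sub_pos.2 hb)), fun ε hε hε₀ w hw => ?_⟩
  have hw1 := abs_le.1 ((norm_fst_le w).trans hw)
  have hε1 : ε < a := by linarith [min_le_left a (T - b)]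
  have hε2 : ε < T - b := by linarith [min_le_right a (T - b), lt_min ha (sub_pos.2 hb)]
  have hin : ∀ z ∈ Icc a b ×ˢ torusCell d, z.1 ∈ Ioo 0 T ∧ z.1 - w.1 ∈ Ioo 0 T := by
    intro z hz
    obtain ⟨h1, h2⟩ := hz.1
    exact ⟨⟨by linarith, by linarith⟩, ⟨by linarith [hw1.2], by linarith [hw1.1]⟩⟩
  set S : Set (SpaceTime d) :=
    {z | z.1 ∈ Ioo 0 T ∧ z.1 + (-w.1) ∈ Ioo 0 T ∧ z.2 ∈ torusCell d} with hS
  calc eLpNorm (fun z => timeCut T (fun z => c (f z)) (z - w) - timeCut T (fun z => c (f z)) z) 3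
        (windowMeasure d a b)
      ≤ eLpNorm (fun z : SpaceTime d => f (z.1 + (-w.1), z.2 + (-w.2)) - f z) 3
        (windowMeasure d a b) := by
        refine eLpNorm_mono_ae ?_
        filter_upwards [ae_restrict_mem (measurableSet_Icc.prod
          (measurableSet_torusCell d))] with z hz
        obtain ⟨h1, h2⟩ := hin z hz
        rw [timeCut_apply h1, timeCut_apply (z := z - w) h2]
        have e : z - w = (z.1 + (-w.1), z.2 + (-w.2)) := by ext <;> simp [sub_eq_add_neg]
        rw [← e]
        exact hc _ _
    _ ≤ eLpNorm (fun z : SpaceTime d => f (z.1 + (-w.1), z.2 + (-w.2)) - f z) 3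
        (volume.restrict S) := by
        refine eLpNorm_mono_measure _ (Measure.restrict_mono (fun z hz => ?_) le_rfl)
        exact ⟨(hin z hz).1, by simpa [sub_eq_add_neg] using (hin z hz).2, hz.2⟩
    _ ≤ C * ENNReal.ofReal (Real.sqrt ((-w.1) ^ 2 + ‖-w.2‖ ^ 2) ^ s) := hC _ _
    _ ≤ ENNReal.ofReal (C * 2 ^ s * ε ^ s) := by
        rw [mul_assoc, ENNReal.ofReal_mul (NNReal.coe_nonneg C), ENNReal.ofReal_coe_nnreal]
        gcongr
        rw [← Real.mul_rpow (by norm_num) hε.le]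
        refine Real.rpow_le_rpow (Real.sqrt_nonneg _) ?_ hs
        refine Real.sqrt_le_iff.2 ⟨by positivity, ?_⟩
        have h1 : (-w.1) ^ 2 ≤ ε ^ 2 := sq_le_sq' (by linarith [hw1.2]) (by linarith [hw1.1])
        have h2 : ‖-w.2‖ ^ 2 ≤ ε ^ 2 := by
          rw [norm_neg]
          exact pow_le_pow_left₀ (norm_nonneg _) ((norm_snd_le w).trans hw) 2
        nlinarith

/-! ### From the distributional formulation to balance laws in divergence form -/

theorem IsTestIn.isTestFunction {a b T : ℝ} {φ : SpaceTime d → ℝ} (hφ : IsTestIn a b φ)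
    (ha : 0 < a) (hb : b < T) : IsTestFunction T φ :=
  ⟨hφ.smooth, hφ.periodic, a, b, ha, hb, hφ.support⟩

theorem fderiv_space_eq_sum (φ : SpaceTime d → ℝ) (z : SpaceTime d) (v : Space d) :
    fderiv ℝ φ z (0, v) = ∑ j, v j * pd (some j) φ z := by
  have hv : ((0 : ℝ), v) = ∑ j, v j • (dirVec (some j) : SpaceTime d) := by
    refine Prod.ext ?_ ?_
    · simp [dirVec, Prod.fst_sum]
    · ext i
      simp [dirVec, Prod.snd_sum, Pi.single_apply]
  rw [hv, map_sum]
  simp [pd]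

theorem DistribBalance.weakDiv {T a b : ℝ} {A R : SpaceTime d → ℝ} {F : SpaceTime d → Space d}
    (h : DistribBalance T A F R) (ha : 0 < a) (hb : b < T) :
    WeakDiv a b (fun o => o.elim (timeCut T A) fun j => timeCut T fun z => F z j)
      (timeCut T R) := by
  intro φ hφ
  rw [← h.balance φ (hφ.isTestFunction ha hb), ← integral_timeCut]
  congr 1
  funext z
  by_cases hz : z.1 ∈ Ioo 0 T
  · simp only [timeCut_apply hz, Fintype.sum_option, Option.elim, fderiv_space_eq_sum]
    rfl
  · simp [timeCut_of_notMem hz, Fintype.sum_option]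

theorem slabMeasure_eq_prod (d : ℕ) (T : ℝ) : slabMeasure d T
    = (volume.restrict (Ioo 0 T)).prod (volume.restrict (torusCell d)) :=
  (Measure.prod_restrict _ _).symm

/-- By Fubini's theorem, the slicewise weak gradient is tested with `φ(t, ·)` and integrated in
time. No time derivative occurs, so the cut-off in time is harmless on any window. -/
theorem MemL2H1.weakPartial {T a b : ℝ} {u : SpaceTime d → Space d}
    {G : SpaceTime d → Matrix (Fin d) (Fin d) ℝ} (hG : MemL2H1 T u G)
    (i j : Fin d) :
    WeakPartial a b j (timeCut T fun z => u z i) (timeCut T fun z => G z i j) := by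
  intro φ hφ
  have hui : MemLp (fun z => u z i) 2 (slabMeasure d T) :=
    MemLp.of_le hG.memLp (((EuclideanSpace.proj (𝕜 := ℝ) i).continuous).comp_aestronglyMeasurable
      hG.memLp.1) (Eventually.of_forall fun z => PiLp.norm_apply_le (u z) i)
  have bd : ∀ {ψ f : SpaceTime d → ℝ}, IsWindowed a b ψ → MemLp f 2 (slabMeasure d T) →
      Integrable (fun z => f z * ψ z) (slabMeasure d T) := fun hψ hf => by
    obtain ⟨B, -, hB⟩ := hψ.exists_bound
    exact (hf.integrable (by norm_num)).mul_bdd (c := B) hψ.continuous.aestronglyMeasurable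
      (Eventually.of_forall hB)
  have i1 := bd (hφ.pd_windowed (some j)) hui
  have i2 := bd hφ.isWindowed (hG.grad_memLp i j)
  have e : (fun z => ∑ o, (if o = some j then timeCut T (fun z => u z i) z else 0) * pd o φ z
      - -timeCut T (fun z => G z i j) z * φ z)
      = timeCut T fun z => u z i * pd (some j) φ z + G z i j * φ z := by
    funext z
    by_cases hz : z.1 ∈ Ioo 0 T
    · simp [timeCut_apply hz]
    · simp [timeCut_of_notMem hz]
  rw [e, integral_timeCut, integral_add i1 i2]
  rw [slabMeasure_eq_prod] at i1 i2 ⊢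
  rw [integral_prod _ i1, integral_prod _ i2, ← eq_neg_iff_add_eq_zero, ← integral_neg]
  refine integral_congr_ae ?_
  filter_upwards [hG.weakGradient] with t ht
  have hsl : ContDiff ℝ ∞ fun x => φ (t, x) := hφ.smooth.comp (by fun_prop)
  have h1 := ht (fun x => φ (t, x)) hsl (hφ.periodic t) i j
  rw [← h1]
  congr 1
  funext x
  congr 1
  have hc : HasFDerivAt (fun x : Space d => φ (t, x))
      ((fderiv ℝ φ (t, x)).comp (ContinuousLinearMap.inr ℝ ℝ (Space d))) x :=
    (hφ.differentiable (t, x)).hasFDerivAt.comp x (hasFDerivAt_prodMk_right t x)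
  rw [hc.fderiv]
  simp [pd, dirVec]

/-! ### The local energy equality -/

/-- No regularity of `f` is required: `f ∘ ρ` is measurable as an almost everywhere limit of
continuous functions of `ρ`. This gives integrability of `p(ρ)` and `P(ρ)` together with the
convergence. -/
theorem LpTendsto.of_uniform {α : Type*} [MeasurableSpace α] {μ : Measure α} [IsFiniteMeasure μ]
    {p : ℝ≥0∞} {ρ : α → ℝ} (hρ : AEStronglyMeasurable ρ μ) {a b : ℝ}
    (hab : ∀ᵐ z ∂μ, ρ z ∈ Icc a b) {h : ℕ → ℝ → ℝ} (hc : ∀ n, Continuous (h n)) {f : ℝ → ℝ}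
    {δ : ℕ → ℝ} (hδ : Tendsto δ atTop (nhds 0)) (hf : ∀ n, ∀ r ∈ Icc a b, |h n r - f r| ≤ δ n) :
    LpTendsto μ p atTop (fun n z => h n (ρ z)) fun z => f (ρ z) := by
  have hm : ∀ n, AEStronglyMeasurable (fun z => h n (ρ z)) μ := fun n =>
    (hc n).comp_aestronglyMeasurable hρ
  have hlim : ∀ᵐ z ∂μ, Tendsto (fun n => h n (ρ z)) atTop (nhds (f (ρ z))) := by
    filter_upwards [hab] with z hz
    rw [tendsto_iff_dist_tendsto_zero]
    exact squeeze_zero (fun _ => dist_nonneg) (fun n => hf n _ hz) hδ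
  have hfm : AEStronglyMeasurable (fun z => f (ρ z)) μ :=
    aestronglyMeasurable_of_tendsto_ae atTop hm hlim
  have hbd : ∀ n, ∃ B, ∀ r ∈ Icc a b, ‖h n r‖ ≤ B := fun n =>
    isCompact_Icc.exists_bound_of_continuousOn (hc n).continuousOn
  refine ⟨Eventually.of_forall fun n => ?_, ?_, ?_⟩
  · obtain ⟨B, hB⟩ := hbd n
    exact MemLp.of_bound (hm n) B (hab.mono fun z hz => hB _ hz)
  · obtain ⟨B, hB⟩ := hbd 0
    refine MemLp.of_bound hfm (B + δ 0) (hab.mono fun z hz => ?_)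
    have h1 := hB _ hz
    have h2 := hf 0 _ hz
    have h3 : f (ρ z) = h 0 (ρ z) - (h 0 (ρ z) - f (ρ z)) := by ring
    rw [h3]
    exact (norm_sub_le _ _).trans (add_le_add h1 h2)
  · have ht : Tendsto (fun n => μ univ ^ p.toReal⁻¹ * ENNReal.ofReal (δ n)) atTop (nhds 0) := by
      have := ENNReal.Tendsto.const_mul (a := μ univ ^ p.toReal⁻¹) (ENNReal.tendsto_ofReal hδ)
        (Or.inr (ENNReal.rpow_ne_top_of_nonneg (by positivity) (measure_ne_top μ univ)))
      simpa using this
    exact tendsto_of_tendsto_of_tendsto_of_le_of_le tendsto_const_nhds ht (fun _ => zero_le)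
      fun n => eLpNorm_le_of_ae_bound (hab.mono fun z hz => hf n _ hz)

variable {d : ℕ}

theorem IsWindowNull.congr {a b : ℝ} {f g : SpaceTime d → ℝ} (hf : IsWindowNull a b f)
    (h : ∀ z : SpaceTime d, z.1 ∈ Icc a b → f z = g z) : IsWindowNull a b g := by
  have hae : f =ᵐ[windowMeasure d a b] g := by
    filter_upwards [ae_restrict_mem (measurableSet_Icc.prod (measurableSet_torusCell d))] with z hz
    exact h z hz.1
  exact ⟨hf.1.congr hae, by rw [← integral_congr_ae hae, hf.2]⟩

theorem timeCut_zero (T : ℝ) : (timeCut T fun _ : SpaceTime d => (0 : ℝ)) = fun _ => 0 :=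
  indicator_zero _ _

theorem Integrable.locIntegrable {F : Type*} [NormedAddCommGroup F] {T : ℝ} {f : SpaceTime d → F}
    (hf : Integrable f (slabMeasure d T)) : LocIntegrable T f := fun _ _ ha hb =>
  hf.mono_measure (windowMeasure_le_slabMeasure ha hb)

theorem memLp_apply {p : ℝ≥0∞} {μ : Measure (SpaceTime d)} {u : SpaceTime d → Space d}
    (hu : MemLp u p μ) (i : Fin d) : MemLp (fun z => u z i) p μ := hu.eval_piLp i

theorem abs_apply_sub_le (i : Fin d) (x y : Space d) : |x i - y i| ≤ ‖x - y‖ := by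
  simpa using PiLp.norm_apply_le (x - y) i

/-- Local energy equality for a symmetric square integrable stress field `σ`. -/
theorem localEnergyEquality_of_isDistribSolution {T α β : ℝ} (hα : α ∈ Icc (0 : ℝ) 1)
    (hβ : β ∈ Icc (0 : ℝ) 1) (h₁ : 1 < 2 * α + β) (h₂ : 1 < α + 2 * β) {ρmin ρmax : ℝ}
    (hρmin : 0 ≤ ρmin) {p : ℝ → ℝ} (hp : ContinuousOn p (Icc ρmin ρmax))
    (hP : ∀ r ∈ Icc ρmin ρmax, 0 < r → IntervalIntegrable (fun s => p s / s ^ 2) volume 1 r)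
    {ρ : SpaceTime d → ℝ} {u : SpaceTime d → Space d}
    {G σ : SpaceTime d → Matrix (Fin d) (Fin d) ℝ}
    (hρper : IsSpacePeriodic ρ) (huper : IsSpacePeriodic u)
    (hu : MemBesov 3 α T u) (hρ : MemBesov 3 β T ρ)
    (hρu : MemBesov 3 β T fun z => ρ z • u z) (hG : MemL2H1 T u G)
    (hbound : ∀ᵐ z ∂(slabMeasure d T), ρmin ≤ ρ z ∧ ρ z ≤ ρmax)
    (hσper : IsSpacePeriodic σ) (hσ : ∀ i j, MemLp (fun z => σ z i j) 2 (slabMeasure d T))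
    (hσsymm : ∀ z i j, σ z i j = σ z j i) (hsol : IsDistribSolution T p ρ u σ) :
    LocalEnergyEquality T p ρ u G σ := by
  have hu3 := fun i => memLp_apply hu.memLp i
  have hu2 := fun i => memLp_apply hG.memLp i
  have hm3 : ∀ i, MemLp (fun z => ρ z * u z i) 3 (slabMeasure d T) := fun i =>
    memLp_apply hρu.memLp i
  have hnorm : MemLp (fun z => ‖u z‖ * ‖u z‖) (3 / 2) (slabMeasure d T) :=
    hu.memLp.norm.mul' hu.memLp.norm
  have happ : ∀ n : ℕ, ∃ h : ℝ → ℝ, ContDiff ℝ ∞ h ∧ ∀ r ∈ Icc ρmin ρmax,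
      |h r - pressurePotential p r| ≤ 1 / ((n : ℝ) + 1) ∧
      |r * deriv h r - h r - p r| ≤ 1 / ((n : ℝ) + 1) := fun n =>
    exists_potential_approx hρmin hp hP (by positivity)
  choose h hsm happ using happ
  have hq : ∀ n, Continuous fun r => r * deriv (h n) r - h n r := fun n =>
    (continuous_id.mul ((hsm n).continuous_deriv (by simp))).sub (hsm n).continuous
  have lP : LpTendsto (slabMeasure d T) 2 atTop (fun n z => h n (ρ z))
      fun z => pressurePotential p (ρ z) := LpTendsto.of_uniform hρ.memLp.1 hbound
    (fun n => (hsm n).continuous) tendsto_one_div_add_atTop_nhds_zero_nat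
    fun n r hr => (happ n r hr).1
  have lp : LpTendsto (slabMeasure d T) 2 atTop
      (fun n z => ρ z * deriv (h n) (ρ z) - h n (ρ z)) fun z => p (ρ z) :=
    LpTendsto.of_uniform (h := fun n r => r * deriv (h n) r - h n r) hρ.memLp.1
      hbound hq tendsto_one_div_add_atTop_nhds_zero_nat fun n r hr => (happ n r hr).2
  have hPm := lP.memLp
  have hpm := lp.memLp
  have int22 : ∀ {f g : SpaceTime d → ℝ}, MemLp f 2 (slabMeasure d T) →
      MemLp g 2 (slabMeasure d T) → Integrable (fun z => f z * g z) (slabMeasure d T) :=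
    fun hf hg => memLp_one_iff_integrable.1 (hg.mul' hf)
  have i1 : Integrable (fun z => 1 / 2 * ρ z * ‖u z‖ ^ 2) (slabMeasure d T) := by
    have : MemLp (fun z => ρ z * (‖u z‖ * ‖u z‖)) 1 (slabMeasure d T) := hnorm.mul' hρ.memLp
    refine ((memLp_one_iff_integrable.1 this).const_mul (1 / 2)).congr
      (Eventually.of_forall fun z => ?_)
    simp only
    ring
  -- The energy flux is grouped as `ρ u_j ∈ L³` times `|u|² ∈ L^{3/2}`.
  have i2 : ∀ j, Integrable (fun z => 1 / 2 * ρ z * ‖u z‖ ^ 2 * u z j) (slabMeasure d T) := by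
    intro j
    have : MemLp (fun z => ρ z * u z j * (‖u z‖ * ‖u z‖)) 1 (slabMeasure d T) :=
      hnorm.mul' (hm3 j)
    refine ((memLp_one_iff_integrable.1 this).const_mul (1 / 2)).congr
      (Eventually.of_forall fun z => ?_)
    simp only
    ring
  refine ⟨Integrable.locIntegrable (i1.add (hPm.integrable (by norm_num))),
    Integrable.locIntegrable (Integrable.of_eval_piLp fun j => ?_),
    Integrable.locIntegrable (integrable_finsetSum _ fun i _ => integrable_finsetSum _ fun j _ =>
      int22 (hσ i j) (hG.grad_memLp i j)), fun φ hφ => ?_⟩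
  · refine (((i2 j).add ((int22 hpm (hu2 j)).add (int22 hPm (hu2 j)))).sub
      (integrable_finsetSum Finset.univ fun k _ => int22 (hσ j k) (hu2 k))).congr
      (Eventually.of_forall fun z => ?_)
    simp only [Pi.sub_apply, Pi.add_apply, PiLp.sub_apply, PiLp.smul_apply, smul_eq_mul]
    ring
  obtain ⟨a, b, ha, hb, hsupp⟩ := hφ.support
  have hφT : IsTestIn a b φ := ⟨⟨hφ.smooth, hφ.periodic⟩, hsupp⟩
  have hin : ∀ {z : SpaceTime d}, z.1 ∈ Icc a b → z.1 ∈ Ioo 0 T := fun hz =>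
    Icc_subset_Ioo ha hb hz
  -- The larger window `[a/2, (b+T)/2]` still lies inside `(0, T)` and leaves room for mollification
  -- around the support of `φ`.
  have ha' : 0 < a / 2 := half_pos ha
  have haa : a / 2 < a := half_lt_self ha
  have hb' : (b + T) / 2 < T := by linarith
  have hbb : b < (b + T) / 2 := by linarith
  set M : Option (Fin d) → SpaceTime d → ℝ := fun o => o.elim (timeCut T ρ)
    fun j => timeCut T fun z => ρ z * u z j with hM
  set U : Fin d → SpaceTime d → ℝ := fun i => timeCut T fun z => u z i with hU
  set Γ : Fin d → Fin d → SpaceTime d → ℝ := fun i j => timeCut T fun z => G z i j with hΓ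
  set S : Fin d → Fin d → SpaceTime d → ℝ := fun i j => timeCut T fun z => σ z i j with hS
  set π : SpaceTime d → ℝ := timeCut T fun z => p (ρ z) with hπ
  have hup : ∀ i, IsSpacePeriodic fun z => u z i := fun i => huper.map fun v => v i
  have hMmem : ∀ o, PerMemLp 3 (M o) := by
    rintro (_ | j)
    · exact perMemLp_timeCut (by norm_num) hρper hρ.memLp
    · exact perMemLp_timeCut (by norm_num) (hρper.map₂ (hup j) fun r s => r * s) (hm3 j)
  have hMs : ∀ o, ShiftBound a b β (M o) := by
    rintro (_ | j)
    · exact hρ.shiftBound_timeCut hβ.1 ha hb (c := id) fun x y => le_rfl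
    · exact hρu.shiftBound_timeCut hβ.1 ha hb (c := fun v => v j) (abs_apply_sub_le j)
  have hUmem : ∀ i, PerMemLp 3 (U i) := fun i => perMemLp_timeCut (by norm_num) (hup i) (hu3 i)
  have hUs : ∀ i, ShiftBound a b α (U i) := fun i =>
    hu.shiftBound_timeCut hα.1 ha hb (c := fun v => v i) (abs_apply_sub_le i)
  have hΓmem : ∀ i j, PerMemLp 2 (Γ i j) := fun i j => perMemLp_timeCut (by norm_num)
    (hG.periodic.map fun A => A i j) (hG.grad_memLp i j)
  have hSmem : ∀ i j, PerMemLp 2 (S i j) := fun i j => perMemLp_timeCut (by norm_num)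
    (hσper.map fun A => A i j) (hσ i j)
  have hπmem : PerMemLp 2 π := perMemLp_timeCut (by norm_num) (hρper.map p) hpm
  have hMU : ∀ i o, Integrable (fun z => M o z * U i z) (stripMeasure d) := by
    intro i o
    have key : ∀ {f : SpaceTime d → ℝ}, MemLp f 3 (slabMeasure d T) →
        Integrable (fun z => timeCut T f z * U i z) (stripMeasure d) := fun {f} hf => by
      have h1 := integrable_timeCut (int22 (hf.mono_exponent (by norm_num)) (hu2 i))
      refine h1.congr (Eventually.of_forall fun z => ?_)
      by_cases hz : z.1 ∈ Ioo 0 T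
      · simp [hU, timeCut_apply hz]
      · simp [hU, timeCut_of_notMem hz]
    rcases o with _ | j
    · exact key hρ.memLp
    · exact key (hm3 j)
  have hcont : WeakDiv (a / 2) ((b + T) / 2) M fun _ => 0 := by
    have := hsol.continuity.weakDiv ha' hb'
    rwa [timeCut_zero] at this
  have hmom : ∀ i, WeakDiv (a / 2) ((b + T) / 2) (fun o z => M o z * U i z + o.elim 0
      fun j => (if j = i then π z else 0) - S i j z) fun _ => 0 := by
    intro i
    have := (hsol.momentum i).weakDiv ha' hb'
    rw [timeCut_zero] at this
    convert this using 1
    funext o z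
    by_cases hz : z.1 ∈ Ioo 0 T
    · rcases o with _ | j
      · simp [hM, hU, timeCut_apply hz]
      · simp only [hM, hU, hS, hπ, Option.elim, timeCut_apply hz, PiLp.sub_apply, PiLp.add_apply,
          PiLp.smul_apply, smul_eq_mul, PiLp.single_apply, mul_ite, mul_one, mul_zero]
        ring
    · rcases o with _ | j
      · simp [hM, hU, timeCut_of_notMem hz]
      · simp [hM, hU, hS, hπ, timeCut_of_notMem hz]
  have hgrad : ∀ i j, WeakPartial (a / 2) ((b + T) / 2) j (U i) (Γ i j) := fun i j =>
    hG.weakPartial i j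
  have hkin : IsWindowNull a b fun z => ρ z * (1 / 2 * ‖u z‖ ^ 2) * pd none φ z
      + ∑ j, ρ z * u z j * (1 / 2 * ‖u z‖ ^ 2) * pd (some j) φ z
      + ∑ j, p (ρ z) * u z j * pd (some j) φ z + ∑ j, p (ρ z) * G z j j * φ z
      - ∑ i, ∑ j, σ z i j * u z i * pd (some j) φ z - ∑ i, ∑ j, σ z i j * G z i j * φ z := by
    refine (isWindowNull_kinetic hα h₁ haa hbb hMmem hMs hUmem hUs hπmem hSmem hΓmem hMU hcont hmom
      hgrad hφT).congr fun z hz => ?_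
    have hz' := hin hz
    have hn : ‖u z‖ ^ 2 = ∑ i, u z i * u z i := by
      rw [EuclideanSpace.real_norm_sq_eq]
      exact Finset.sum_congr rfl fun i _ => sq _
    simp only [hn, hM, hU, hS, hπ, hΓ, Fintype.sum_option, Option.elim, timeCut_apply hz']
  have hren : ∀ n, IsWindowNull a b fun z => h n (ρ z) * pd none φ z
      + ∑ j, h n (ρ z) * u z j * pd (some j) φ z
      - ∑ j, (ρ z * deriv (h n) (ρ z) - h n (ρ z)) * G z j j * φ z := by
    intro n
    refine (isWindowNull_renormalized (m := max 0 ρmax) hβ h₂ haa hbb hMmem (hMs none) ?_ ?_ hUmem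
      hUs hΓmem hcont hgrad hφT (hsm n)).congr fun z hz => ?_
    · exact ae_timeCut_mem_Icc (le_max_left _ _) hρper (hbound.mono fun z hz =>
        ⟨hρmin.trans hz.1, hz.2.trans (le_max_right _ _)⟩)
    · intro j
      funext z
      by_cases hz : z.1 ∈ Ioo 0 T
      · simp [hM, hU, timeCut_apply hz]
      · simp [hM, hU, timeCut_of_notMem hz]
    · have hz' := hin hz
      simp only [hM, hU, hΓ, Option.elim, timeCut_apply hz']
  have hpot : IsWindowNull a b fun z => pressurePotential p (ρ z) * pd none φ z
      + ∑ j, pressurePotential p (ρ z) * u z j * pd (some j) φ z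
      - ∑ j, p (ρ z) * G z j j * φ z := by
    have hle := windowMeasure_le_slabMeasure (d := d) ha hb
    have mono : ∀ {F : ℕ → SpaceTime d → ℝ} {f}, LpTendsto (slabMeasure d T) 2 atTop F f →
        LpTendsto (windowMeasure d a b) 2 atTop F f := fun hF =>
      ⟨hF.memLp_approx.mono fun _ h => h.mono_measure hle, hF.memLp.mono_measure hle,
        tendsto_of_tendsto_of_tendsto_of_le_of_le tendsto_const_nhds hF.tendsto
          (fun _ => zero_le) fun _ => eLpNorm_mono_measure _ hle⟩
    have lP' := mono lP
    have lp' := mono lp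
    have t1 := (lP'.mono_exponent (p := 1) (by norm_num)).mul_windowed (hφT.pd_windowed none)
    have t2 := LpTendsto.sum le_rfl Finset.univ fun j =>
      (lP'.mul (r := 1) (by norm_num) le_rfl
        (LpTendsto.const ((hu2 j).mono_measure hle))).mul_windowed (hφT.pd_windowed (some j))
    have t3 := LpTendsto.sum le_rfl Finset.univ fun j =>
      (lp'.mul (r := 1) (by norm_num) le_rfl
        (LpTendsto.const ((hG.grad_memLp j j).mono_measure hle))).mul_windowed hφT.isWindowed
    have L := (t1.add le_rfl t2).sub le_rfl t3
    refine ⟨memLp_one_iff_integrable.1 L.memLp, ?_⟩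
    -- The renormalized balances have zero integral for every `n`; the uniform approximation carries
    -- this over to `P` and `p`.
    exact tendsto_nhds_unique L.tendsto_integral
      (tendsto_const_nhds.congr fun n => (hren n).2.symm)
  rw [← integral_timeCut, integral_strip_eq_window (a := a) (b := b)]
  -- Adding the kinetic and potential balances cancels the terms `p(ρ) div u φ`.
  · have hsum : IsWindowNull a b _ := ⟨hkin.1.add hpot.1, (integral_add hkin.1 hpot.1).trans
      (by rw [hkin.2, hpot.2, add_zero])⟩
    refine (hsum.congr fun z hz => ?_).2
    rw [timeCut_apply (hin hz), fderiv_space_eq_sum]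
    -- The kinetic balance produces `σᵀ u` in the flux; symmetry of the stress turns it into `σ u`.
    have hσu : ∑ i, ∑ j, σ z i j * u z i * pd (some j) φ z
        = ∑ j, (∑ k, σ z j k * u z k) * pd (some j) φ z := by
      rw [Finset.sum_comm]
      refine Finset.sum_congr rfl fun j _ => ?_
      rw [Finset.sum_mul]
      exact Finset.sum_congr rfl fun i _ => by rw [hσsymm z j i]
    have hF : ∑ j, ((1 / 2 * ρ z * ‖u z‖ ^ 2 + p (ρ z) + pressurePotential p (ρ z)) • u z
        - WithLp.toLp 2 fun i => ∑ j, σ z i j * u z j) j * pd (some j) φ z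
        = ∑ j, ρ z * u z j * (1 / 2 * ‖u z‖ ^ 2) * pd (some j) φ z
          + ∑ j, p (ρ z) * u z j * pd (some j) φ z
          + ∑ j, pressurePotential p (ρ z) * u z j * pd (some j) φ z
          - ∑ i, ∑ j, σ z i j * u z i * pd (some j) φ z := by
      rw [hσu, ← Finset.sum_add_distrib, ← Finset.sum_add_distrib, ← Finset.sum_sub_distrib]
      refine Finset.sum_congr rfl fun j _ => ?_
      simp only [PiLp.sub_apply, PiLp.smul_apply, smul_eq_mul]
      ring
    rw [hF]
    have h0 : fderiv ℝ φ z (1, 0) = pd none φ z := rfl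
    simp only [h0, Finset.sum_mul, Pi.add_apply]
    ring
  · intro t x ht
    by_cases hz : (t, x).1 ∈ Ioo 0 T
    · rw [timeCut_apply hz, fderiv_space_eq_sum]
      have h0 : fderiv ℝ φ (t, x) (1, 0) = pd none φ (t, x) := rfl
      simp [h0, hsupp t x ht, (hφT.pd_windowed _).support t x ht]
    · exact timeCut_of_notMem hz

/-! ### The two viscous stresses -/

theorem viscousStress_symm (μ ν : ℝ) (A : Matrix (Fin d) (Fin d) ℝ) (i j : Fin d) :
    viscousStress μ ν A i j = viscousStress μ ν A j i := by
  simp only [viscousStress, Matrix.add_apply, Matrix.smul_apply, Matrix.sub_apply,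
    Matrix.transpose_apply, Matrix.one_apply, eq_comm (a := i) (b := j), add_comm (A i j)]

theorem memLp_viscousStress {m : Measure (SpaceTime d)} {p : ℝ≥0∞} (μ ν : ℝ)
    {G : SpaceTime d → Matrix (Fin d) (Fin d) ℝ} (hG : ∀ i j, MemLp (fun z => G z i j) p m)
    (i j : Fin d) : MemLp (fun z => viscousStress μ ν (G z) i j) p m := by
  have htr : MemLp (fun z => (G z).trace) p m := memLp_finsetSum _ fun k _ => hG k k
  simp only [viscousStress, Matrix.add_apply, Matrix.smul_apply, Matrix.sub_apply,
    Matrix.transpose_apply, smul_eq_mul]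
  exact ((((hG i j).add (hG j i)).sub ((htr.const_mul (2 / 3)).mul_const _)).const_mul μ).add
    ((htr.const_mul ν).mul_const _)

end

theorem mainTheorem4 {d : ℕ} (T : ℝ) (hT : 0 < T) (μ ν : ℝ) (α β : ℝ)
    (hα : α ∈ Icc (0 : ℝ) 1) (hβ : β ∈ Icc (0 : ℝ) 1)
    (hαβ : max (1 - 2 * α) ((1 - α) / 2) < β)
    (ρmin ρmax : ℝ) (hρmin : 0 ≤ ρmin)
    (p : ℝ → ℝ) (hp : ContinuousOn p (Icc ρmin ρmax))
    (hP : ∀ r ∈ Icc ρmin ρmax, 0 < r →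
      IntervalIntegrable (fun s => p s / s ^ 2) volume 1 r)
    (ρ : SpaceTime d → ℝ) (u : SpaceTime d → Space d)
    (G : SpaceTime d → Matrix (Fin d) (Fin d) ℝ)
    (hρper : IsSpacePeriodic ρ) (huper : IsSpacePeriodic u)
    (hu : MemBesov 3 α T u) (hρ : MemBesov 3 β T ρ)
    (hρu : MemBesov 3 β T (fun z => ρ z • u z))
    (hG : MemL2H1 T u G)
    (hbound : ∀ᵐ z ∂(slabMeasure d T), ρmin ≤ ρ z ∧ ρ z ≤ ρmax) :
    (IsDistribSolution T p ρ u (fun z => viscousStress μ ν (G z)) →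
      LocalEnergyEquality T p ρ u G (fun z => viscousStress μ ν (G z))) ∧
    (IsDistribSolution T p ρ u (fun z => ρ z • viscousStress μ ν (G z)) →
      LocalEnergyEquality T p ρ u G (fun z => ρ z • viscousStress μ ν (G z))) := by
  have h₁ : 1 < 2 * α + β := by linarith [(le_max_left _ _).trans_lt hαβ]
  have h₂ : 1 < α + 2 * β := by linarith [(le_max_right _ _).trans_lt hαβ]
  have hS := memLp_viscousStress μ ν hG.grad_memLp
  have hSper : IsSpacePeriodic fun z => viscousStress μ ν (G z) := hG.periodic.map _
  refine ⟨localEnergyEquality_of_isDistribSolution hα hβ h₁ h₂ hρmin hp hP hρper huper hu hρ hρu hG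
    hbound hSper hS fun z i j => viscousStress_symm μ ν (G z) i j,
    localEnergyEquality_of_isDistribSolution hα hβ h₁ h₂ hρmin hp hP hρper huper hu hρ hρu hG
      hbound (hρper.map₂ hSper fun r A => r • A) (fun i j => ?_)
      fun z i j => congrArg (ρ z * ·) (viscousStress_symm μ ν (G z) i j)⟩
  -- The degenerate stress is square integrable because the density is bounded.
  have hb : ∀ᵐ z ∂(slabMeasure d T), ‖ρ z‖ ≤ ρmax := hbound.mono fun z hz => by
    rw [Real.norm_of_nonneg (hρmin.trans hz.1)]; exact hz.2
  exact MemLp.of_le_mul (c := ρmax) (hS i j) (hρ.memLp.1.mul (hS i j).1)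
    (hb.mono fun z hz => by
      rw [Matrix.smul_apply, smul_eq_mul, norm_mul]
      exact mul_le_mul_of_nonneg_right hz (norm_nonneg _))
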